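/- Let $n\ge 0$ and let $M$ be a $2n$-dimensional Kähler manifold with flat metric $\langle\cdot,\cdot\rangle$, complex structure $J$ and $\omega(X,Y)=\langle JX,Y\rangle$. Let $\pi_1,\pi_2:TM\to TM$ be parallel bundle maps which are orthogonal projections on each fibre, with $\pi_1+\pi_2=\mathrm{id}$, and whose kernels are Lagrangian subspaces on each fibre. Let $L$ be an $n$-manifold, $T\in(0,\infty]$, and let $F:L\times[0,T)\to M$ be a Lagrangian mean curvature flow, that is, a smooth family of Lagrangian immersions $F_t=F(\cdot,t)$ with $\partial_tF=H$, where $H$ is the mean curvature vector of $F_t$. Assume that the flow is graphical: $\pi_1\circ dF_t$ is injective on $T_xL$ for all $(x,t)$. At every $(x,t)$ there are an orthonormal basis $\{a_i\}$ of $\pi_1(T_{F(x,t)}M)$ and real numbers $\lambda_1,\dots,\lambda_n$ such that $e_i=\frac{1}{\sqrt{1+\lambda_i^2}}(a_i+\lambda_iJa_i)$, $i=1,\dots,n$, form an orthonormal basis of $dF_t(T_xL)$. Put $h_{ijk}=\langle\bar\nabla_{e_i}e_j,Je_k\rangle$, where $\bar\nabla$ is the Levi-Civita connection of $M$. Let $\Omega$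 be the $n$-form on $M$ obtained by pulling back the volume form of $\pi_1(TM)$ by $\pi_1$, and let $*\Omega$ be the Hodge star of $F_t^*\Omega$ with respect to the metric induced by $F_t$, with orientations chosen so that $*\Omega>0$; explicitly, $*\Omega$ at $(x,t)$ is $|\Omega(e_1,\dots,e_n)|$. Let $\Delta$ be the Laplace–Beltrami operator of the metric induced by $F_t$. Then $\log(*\Omega)$ is smooth on $L\times[0,T)$, and at every $(x,t)$ and for every such frame, $$\begin{aligned}(\partial_t-\Delta)\log(*\Omega)=&\sum_i(1+\lambda_i^2)h_{iii}^2+\sum_{i\ne j}(3+\lambda_i^2+2\lambda_i\lambda_j)h_{iij}^2\\&+\sum_{i<j<k}(6+2\lambda_i\lambda_j+2\lambda_j\lambda_k+2\lambda_k\lambda_i)h_{ijk}^2.\end{aligned}$$ If the flow is in addition two-convex, that is, $\lambda_i+\lambda_j>0$ and $1+\lambda_i\lambda_j>0$ for all $i\ne j$ at every $(x,t)$, then $(\partial_t-\Delta)\log(*\Omega)\ge 0$. If moreover $L$ is compact and non-empty, then $\min_{L}\log(*\Omega)(\cdot,t)$ is non-decreasing in $t\in[0,T)$, and there is a constant $C$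 (depending on the flow) such that $|\lambda_i|\le C$ for all $i$ and all $(x,t)\in L\times[0,T)$. -/

import Mathlib

open Set Filter Topology Manifold Bundle
open scoped ContDiff Matrix

noncomputable section

namespace LagMCF

/-- The model space `ℝᵐ` with its Euclidean inner product. -/
abbrev E (m : ℕ) : Type := EuclideanSpace ℝ (Fin m)

/-- A smooth Riemannian metric on an `m`-manifold. -/
abbrev Metric (m : ℕ) (M : Type*) [TopologicalSpace M] [ChartedSpace (E m) M]
    [IsManifold 𝓘(ℝ, E m) ∞ M] : Type _ :=
  ContMDiffRiemannianMetric 𝓘(ℝ, E m) ∞ (E m) (fun p : M => TangentSpace 𝓘(ℝ, E m) p)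

section Ambient

variable {m : ℕ} {M : Type*} [TopologicalSpace M] [ChartedSpace (E m) M]

/-- The differential at `q` of a chart `φ` of `M`, with values in the model space. -/
def chartDeriv (φ : OpenPartialHomeomorph M (E m)) (q : M) :
    TangentSpace 𝓘(ℝ, E m) q →L[ℝ] E m :=
  mfderiv 𝓘(ℝ, E m) 𝓘(ℝ, E m) φ q

/-- A flat chart: a smooth chart of `M` which is an isometry onto an open subset of Euclidean
space. In such a chart the Christoffel symbols vanish, so that the Levi-Civita connection is
the componentwise derivative. -/
structure IsFlatChart [IsManifold 𝓘(ℝ, E m) ∞ M] (g : Metric m M)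
    (φ : OpenPartialHomeomorph M (E m)) : Prop where
  smooth : φ ∈ IsManifold.maximalAtlas 𝓘(ℝ, E m) ∞ M
  isometry : ∀ q ∈ φ.source, ∀ v w : TangentSpace 𝓘(ℝ, E m) q,
    inner ℝ (chartDeriv φ q v) (chartDeriv φ q w) = g.inner q v w

/-- A Riemannian metric is flat if it is locally isometric to Euclidean space. -/
def IsFlat [IsManifold 𝓘(ℝ, E m) ∞ M] (g : Metric m M) : Prop :=
  ∀ p : M, ∃ φ : OpenPartialHomeomorph M (E m), IsFlatChart g φ ∧ p ∈ φ.source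

/-- A field of endomorphisms `A` of the tangent bundle of a flat manifold is parallel: in flat
charts its matrix is locally constant. -/
def IsParallel [IsManifold 𝓘(ℝ, E m) ∞ M] (g : Metric m M)
    (A : ∀ p : M, TangentSpace 𝓘(ℝ, E m) p →L[ℝ] TangentSpace 𝓘(ℝ, E m) p) : Prop :=
  ∀ φ : OpenPartialHomeomorph M (E m), IsFlatChart g φ → ∀ p ∈ φ.source,
    ∃ B : E m →L[ℝ] E m, ∀ᶠ q in 𝓝 p, ∀ v : TangentSpace 𝓘(ℝ, E m) q,
      chartDeriv φ q (A q v) = B (chartDeriv φ q v)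

end Ambient

/-- A Kähler structure with flat metric on a `2n`-manifold `M`, together with a splitting of `TM`
by two parallel orthogonal projections whose kernels are Lagrangian. -/
structure FlatKahlerSplitting (n : ℕ) (M : Type*) [TopologicalSpace M]
    [ChartedSpace (E (2 * n)) M] [IsManifold 𝓘(ℝ, E (2 * n)) ∞ M] where
  /-- the Riemannian metric -/
  g : Metric (2 * n) M
  flat : IsFlat g
  /-- the complex structure -/
  J : ∀ p : M, TangentSpace 𝓘(ℝ, E (2 * n)) p →L[ℝ] TangentSpace 𝓘(ℝ, E (2 * n)) p
  J_J : ∀ p v, J p (J p v) = -v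
  J_isometry : ∀ p v w, g.inner p (J p v) (J p w) = g.inner p v w
  J_parallel : IsParallel g J
  /-- the first projection -/
  pr₁ : ∀ p : M, TangentSpace 𝓘(ℝ, E (2 * n)) p →L[ℝ] TangentSpace 𝓘(ℝ, E (2 * n)) p
  /-- the second projection -/
  pr₂ : ∀ p : M, TangentSpace 𝓘(ℝ, E (2 * n)) p →L[ℝ] TangentSpace 𝓘(ℝ, E (2 * n)) p
  pr₁_parallel : IsParallel g pr₁
  pr₂_parallel : IsParallel g pr₂
  pr₁_idem : ∀ p v, pr₁ p (pr₁ p v) = pr₁ p v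
  pr₂_idem : ∀ p v, pr₂ p (pr₂ p v) = pr₂ p v
  pr₁_symm : ∀ p v w, g.inner p (pr₁ p v) w = g.inner p v (pr₁ p w)
  pr₂_symm : ∀ p v w, g.inner p (pr₂ p v) w = g.inner p v (pr₂ p w)
  pr₁_add_pr₂ : ∀ p v, pr₁ p v + pr₂ p v = v
  ker_pr₁_isotropic : ∀ p v w, pr₁ p v = 0 → pr₁ p w = 0 → g.inner p (J p v) w = 0
  ker_pr₂_isotropic : ∀ p v w, pr₂ p v = 0 → pr₂ p w = 0 → g.inner p (J p v) w = 0
  finrank_ker_pr₁ : ∀ p, Module.finrank ℝ (pr₁ p).ker = n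
  finrank_ker_pr₂ : ∀ p, Module.finrank ℝ (pr₂ p).ker = n

section Submanifold

variable {n : ℕ}
  {M : Type*} [TopologicalSpace M] [ChartedSpace (E (2 * n)) M]
  [IsManifold 𝓘(ℝ, E (2 * n)) ∞ M]
  {L : Type*} [TopologicalSpace L] [ChartedSpace (E n) L]

/-- The symplectic form `ω(v, w) = ⟨J v, w⟩`. -/
def FlatKahlerSplitting.omega (S : FlatKahlerSplitting n M) (p : M)
    (v w : TangentSpace 𝓘(ℝ, E (2 * n)) p) : ℝ :=
  S.g.inner p (S.J p v) w

/-- A choice of flat chart around each point. -/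
def FlatKahlerSplitting.flatChartAt (S : FlatKahlerSplitting n M) (p : M) :
    OpenPartialHomeomorph M (E (2 * n)) :=
  (S.flat p).choose

/-- The differential `dF : T_x L → T_{F x} M`. -/
def dF (F : L → M) (x : L) :
    TangentSpace 𝓘(ℝ, E n) x →L[ℝ] TangentSpace 𝓘(ℝ, E (2 * n)) (F x) :=
  mfderiv 𝓘(ℝ, E n) 𝓘(ℝ, E (2 * n)) F x

/-- The `i`-th coordinate vector at `x`: `T_x L` is modelled on `ℝⁿ` through the preferred chart
at `x`. -/
def coordVec (x : L) (i : Fin n) : TangentSpace 𝓘(ℝ, E n) x :=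
  (EuclideanSpace.single i (1 : ℝ) : E n)

/-- The metric on `L` induced by `F`. -/
def inducedMetric (S : FlatKahlerSplitting n M) (F : L → M) (x : L)
    (u v : TangentSpace 𝓘(ℝ, E n) x) : ℝ :=
  S.g.inner (F x) (dF F x u) (dF F x v)

/-- The matrix `g_{ij}` of the induced metric at `x` in the preferred chart at `x`. -/
def gram (S : FlatKahlerSplitting n M) (F : L → M) (x : L) : Matrix (Fin n) (Fin n) ℝ :=
  Matrix.of fun i j => inducedMetric S F x (coordVec x i) (coordVec x j)

/-- The matrix `⟨π₁ dF(∂ᵢ), π₁ dF(∂ⱼ)⟩`. -/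
def gramPr (S : FlatKahlerSplitting n M) (F : L → M) (x : L) : Matrix (Fin n) (Fin n) ℝ :=
  Matrix.of fun i j => S.g.inner (F x)
    (S.pr₁ (F x) (dF F x (coordVec x i))) (S.pr₁ (F x) (dF F x (coordVec x j)))

/-- `*Ω`, the Hodge star of the restriction to `L` of `Ω`, the pull-back by `π₁` of the volume form
of `π₁(TM)`, with `L` oriented so that `*Ω ≥ 0`. For a basis `vᵢ` of `T_x L`, it is the quotient
of `|Ω(v₁, …, vₙ)|`, the volume of the parallelepiped spanned by the `π₁ vᵢ`, by the volume
of the parallelepiped spanned by the `vᵢ`; both volumes are square roots of Gram determinants, and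
the quotient does not depend on the basis. -/
def starOmega (S : FlatKahlerSplitting n M) (F : L → M) (x : L) : ℝ :=
  √(gramPr S F x).det / √(gram S F x).det

/-- The second derivative at `x` of `F`, read in the preferred chart at `x` and in the chart `φ` of
`M`. If `φ` is a flat chart and `v` is extended as a coordinate-constant vector field on `L`, this
is the expression in `φ` of the ambient covariant derivative of `dF(v)` in the direction `u`. -/
def secondDeriv (φ : OpenPartialHomeomorph M (E (2 * n))) (F : L → M) (x : L)
    (u v : TangentSpace 𝓘(ℝ, E n) x) : E (2 * n) :=
  fderiv ℝ (fun y : E n => fderiv ℝ (fun z : E n => φ (F ((chartAt (E n) x).symm z))) y)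
    (chartAt (E n) x x) u v

/-- The second fundamental form `h(u, v, w) = ⟨∇̄_u v, J w⟩` of a Lagrangian immersion. -/
def secondFund (S : FlatKahlerSplitting n M) (F : L → M) (x : L)
    (u v w : TangentSpace 𝓘(ℝ, E n) x) : ℝ :=
  inner ℝ (secondDeriv (S.flatChartAt (F x)) F x u v)
    (chartDeriv (S.flatChartAt (F x)) (F x) (S.J (F x) (dF F x w)))

/-- The mean curvature vector of the immersion `F` at `x`, in the flat chart `φ`: the normal part of
`g^{ij} ∇̄_{∂ᵢ} dF(∂ⱼ)`. -/
def meanCurvature (S : FlatKahlerSplitting n M) (φ : OpenPartialHomeomorph M (E (2 * n)))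
    (F : L → M) (x : L) : E (2 * n) :=
  (LinearMap.range ((chartDeriv φ (F x)).comp (dF F x)).toLinearMap)ᗮ.starProjection
    (∑ i, ∑ j, (gram S F x)⁻¹ i j • secondDeriv φ F x (coordVec x i) (coordVec x j))

/-- `V ∈ T_{F x} M` is the mean curvature vector of `F` at `x`. -/
def IsMeanCurvatureVector (S : FlatKahlerSplitting n M) (F : L → M) (x : L)
    (V : TangentSpace 𝓘(ℝ, E (2 * n)) (F x)) : Prop :=
  ∀ φ : OpenPartialHomeomorph M (E (2 * n)), IsFlatChart S.g φ → F x ∈ φ.source →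
    chartDeriv φ (F x) V = meanCurvature S φ F x

/-- The immersion `F` is Lagrangian at every point. -/
def IsLagrangian (S : FlatKahlerSplitting n M) (F : L → M) : Prop :=
  ∀ x u v, S.omega (F x) (dF F x u) (dF F x v) = 0

/-- `F` is graphical: `π₁` is injective on the tangent spaces of the submanifold. -/
def IsGraphical (S : FlatKahlerSplitting n M) (F : L → M) : Prop :=
  ∀ x, Function.Injective fun u : TangentSpace 𝓘(ℝ, E n) x => S.pr₁ (F x) (dF F x u)

/-- An orthonormal basis `aᵢ` of `π₁(T_{F x} M)` and numbers `lamᵢ` such that the tangent vectors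
`eᵢ = (1 + lamᵢ²)^(-1/2) (aᵢ + lamᵢ J aᵢ)` form a basis of the tangent space of the submanifold (which
is then orthonormal). -/
structure IsAdaptedFrame (S : FlatKahlerSplitting n M) (F : L → M) (x : L)
    (e : Fin n → TangentSpace 𝓘(ℝ, E n) x)
    (a : Fin n → TangentSpace 𝓘(ℝ, E (2 * n)) (F x)) (lam : Fin n → ℝ) : Prop where
  orthonormal : ∀ i j, S.g.inner (F x) (a i) (a j) = if i = j then 1 else 0
  mem : ∀ i, S.pr₁ (F x) (a i) = a i
  frame : ∀ i, dF F x (e i) = (1 / √(1 + lam i ^ 2)) • (a i + lam i • S.J (F x) (a i))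
  orthonormal_frame : ∀ i j, inducedMetric S F x (e i) (e j) = if i = j then 1 else 0

/-- `F` is two-convex: `λᵢ + λⱼ > 0` and `1 + λᵢ λⱼ > 0` for all `i ≠ j`, at every point. -/
def IsTwoConvex (S : FlatKahlerSplitting n M) (F : L → M) : Prop :=
  ∀ x e a lam, IsAdaptedFrame S F x e a lam →
    ∀ i j, i ≠ j → 0 < lam i + lam j ∧ 0 < 1 + lam i * lam j

end Submanifold

section Laplacian

variable {n : ℕ} {L : Type*} [TopologicalSpace L] [ChartedSpace (E n) L]

/-- The coefficients in the preferred chart at `x₀`, at the point of coordinates `y`, of a field `γ` of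
bilinear forms on `L`. -/
def metricCoeff (γ : ∀ x : L, TangentSpace 𝓘(ℝ, E n) x → TangentSpace 𝓘(ℝ, E n) x → ℝ)
    (x₀ : L) (y : E n) : Matrix (Fin n) (Fin n) ℝ :=
  Matrix.of fun i j => γ ((chartAt (E n) x₀).symm y)
    (mfderiv 𝓘(ℝ, E n) 𝓘(ℝ, E n) (chartAt (E n) x₀).symm y (EuclideanSpace.single i (1 : ℝ) : E n))
    (mfderiv 𝓘(ℝ, E n) 𝓘(ℝ, E n) (chartAt (E n) x₀).symm y (EuclideanSpace.single j (1 : ℝ) : E n))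

/-- The `i`-th partial derivative. -/
def pd (i : Fin n) (f : E n → ℝ) (y : E n) : ℝ :=
  fderiv ℝ f y (EuclideanSpace.single i (1 : ℝ))

/-- The Christoffel symbol `Γ^k_{ij}` of the matrix field `G = (g_{ij})` at `y`. -/
def christoffel (G : E n → Matrix (Fin n) (Fin n) ℝ) (k i j : Fin n) (y : E n) : ℝ :=
  (1 / 2) * ∑ l, (G y)⁻¹ k l *
    (pd i (fun z => G z j l) y + pd j (fun z => G z i l) y - pd l (fun z => G z i j) y)

/-- The Laplace–Beltrami operator `Δ f = g^{ij} (∂ᵢ∂ⱼ f - Γ^k_{ij} ∂ₖ f)` of the metric `γ`,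
computed at `x` in the preferred chart at `x`. -/
def laplacian (γ : ∀ x : L, TangentSpace 𝓘(ℝ, E n) x → TangentSpace 𝓘(ℝ, E n) x → ℝ)
    (f : L → ℝ) (x : L) : ℝ :=
  let y₀ : E n := chartAt (E n) x x
  let G := metricCoeff γ x
  let u : E n → ℝ := fun y => f ((chartAt (E n) x).symm y)
  ∑ i, ∑ j, (G y₀)⁻¹ i j *
    (pd i (pd j u) y₀ - ∑ k, christoffel G k i j y₀ * pd k u y₀)

end Laplacian

/-- The time interval `[0, T)`, where `T` may be infinite. -/
def timeInterval (T : EReal) : Set ℝ := {t : ℝ | 0 ≤ t ∧ (t : EReal) < T}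

section Flow

variable {n : ℕ}
  {M : Type*} [TopologicalSpace M] [ChartedSpace (E (2 * n)) M]
  [IsManifold 𝓘(ℝ, E (2 * n)) ∞ M]
  {L : Type*} [TopologicalSpace L] [ChartedSpace (E n) L]

/-- `F : [0, T) × L → M` is a Lagrangian mean curvature flow: a smooth family of Lagrangian immersions
with `∂F/∂t = H`. -/
structure IsLagrangianMCF (S : FlatKahlerSplitting n M) (T : EReal) (F : ℝ → L → M) : Prop where
  smooth : ContMDiffOn (𝓘(ℝ, ℝ).prod 𝓘(ℝ, E n)) 𝓘(ℝ, E (2 * n)) ∞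
    (fun z : ℝ × L => F z.1 z.2) (timeInterval T ×ˢ univ)
  immersion : ∀ t ∈ timeInterval T, ∀ x : L, Function.Injective (dF (n := n) (F t) x)
  lagrangian : ∀ t ∈ timeInterval T, IsLagrangian S (F t)
  flow : ∀ t ∈ timeInterval T, ∀ x, IsMeanCurvatureVector S (F t) x
    (mfderivWithin 𝓘(ℝ, ℝ) 𝓘(ℝ, E (2 * n)) (fun s => F s x) (timeInterval T) t (1 : ℝ))

/-- `log(*Ω)` along the flow. -/
def logStarOmega (S : FlatKahlerSplitting n M) (F : ℝ → L → M) (t : ℝ) (x : L) : ℝ :=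
  Real.log (starOmega S (F t) x)

/-- `(∂_t - Δ) f` at `(t, x)`, with `Δ` the Laplacian of the metric induced by `F t`. -/
def heat (S : FlatKahlerSplitting n M) (T : EReal) (F : ℝ → L → M) (f : ℝ → L → ℝ)
    (t : ℝ) (x : L) : ℝ :=
  derivWithin (fun s => f s x) (timeInterval T) t - laplacian (inducedMetric S (F t)) (f t) x

end Flow

end LagMCF

end

/-!
In flat charts of `M` the projection `π₁` and the complex structure are constant matrices `B` and
`J`, so the flow becomes a map `u` from a space-time domain to Euclidean space. With
`uᵢ = ∂ᵢ u` one has `log(*Ω) = ½ log det ⟨B uᵢ, B uⱼ⟩ - ½ log det ⟨uᵢ, uⱼ⟩`, and by Jacobi's formula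
every directional derivative of it is `∂ log(*Ω) = ∑ₖ ⟨Rₖ, ∂uₖ⟩`, where `Rₖ = Kₖ - Sₖ` is the
difference of the frames dual to `uₖ` in `π₁(TM)` and in the tangent space
(`GraphFlow.dirDeriv_logRatio`). As `⟨Rₖ, uⱼ⟩ = 0`, tangential terms are not seen. In
`(∂ₜ - Δ) log(*Ω)` the third derivatives of `u` cancel, and so do the Christoffel symbols, since
the mean curvature vector is `g^{ij}(∂ᵢ∂ⱼu - Γᵏᵢⱼ ∂ₖu)`; no normal coordinates are needed. What is
left involves the first derivatives of `g^{ij}` and of `Rₖ`, and these are known: `Kₖ` stays in the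
image of `B` and is dual to `uⱼ`. In an adapted frame `Kₖ = eₖ - λₖ J eₖ`, and the result is
`∑ᵢⱼₖ (1 + λⱼλₖ) hᵢⱼₖ²` (`GraphFlow.evolution`). Since `h` is totally symmetric, collecting equal
triples gives the stated form (`sum_secondFund_regroup`).

The definitions use the preferred chart at each point of `L`. To work in one chart near a
point, `*Ω`, the mean curvature vector and the Laplacian are shown to be computable in any basis
(`starOmega_eq_frame`, `meanCurvature_eq_frame`, `laplacian_eq_frame`); all three rest on the
invariance of traces, `trace_change`, or of quotients of Gram determinants, `gram_map`.
Adapted frames are eigenbases of the symmetric operator whose graph is the tangent space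
(`exists_isModelFrame`).

In the two-convex case all coefficients are nonnegative, and the minimum principle
(`exists_logStarOmega_le`) shows that a lower bound of `log(*Ω)` persists. As
`*Ω = ∏ᵢ (1 + λᵢ²)^(-1/2)`, the bound at the initial time controls every `λᵢ`.
-/

noncomputable section

namespace LagMCF

/-! ### Calculus with directional derivatives on space-time domains -/

section DirDeriv

variable {X W : Type*} [NormedAddCommGroup X] [NormedSpace ℝ X]
  [NormedAddCommGroup W] [NormedSpace ℝ W] {S : Set X}

/-- The derivative of `f` within `S` in the constant direction `v`. -/
def dirDeriv (S : Set X) (v : X) (f : X → W) (z : X) : W :=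
  fderivWithin ℝ f S z v

/-- The conditions on `S` under which derivatives within `S` are unique and, as every point is a limit
of interior points, directional derivatives commute. The typical example is a space-time domain
`[0, δ) × U`, which is neither open nor closed. -/
structure IsCalcDomain (S : Set X) : Prop where
  uniqueDiff : UniqueDiffOn ℝ S
  subset_closure : S ⊆ closure (interior S)

variable {z : X} {v w : X} {f g : X → W}

lemma diffWithinAt_of_contDiffOn (hf : ContDiffOn ℝ ∞ f S) (hz : z ∈ S) :
    DifferentiableWithinAt ℝ f S z :=
  (hf z hz).differentiableWithinAt (by simp)

lemma contDiffOn_dirDeriv (hS : IsCalcDomain S) (hf : ContDiffOn ℝ ∞ f S) (v : X) :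
    ContDiffOn ℝ ∞ (dirDeriv S v f) S :=
  (hf.fderivWithin hS.uniqueDiff (by simp)).clm_apply contDiffOn_const

lemma dirDeriv_congr (h : ∀ y ∈ S, f y = g y) (hz : z ∈ S) :
    dirDeriv S v f z = dirDeriv S v g z := by
  unfold dirDeriv
  rw [fderivWithin_congr h (h z hz)]

lemma dirDeriv_dirDeriv (hS : IsCalcDomain S) (hf : ContDiffOn ℝ ∞ f S) (hz : z ∈ S) (v w : X) :
    dirDeriv S v (dirDeriv S w f) z = fderivWithin ℝ (fderivWithin ℝ f S) S z v w := by
  have hd : DifferentiableWithinAt ℝ (fderivWithin ℝ f S) S z :=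
    diffWithinAt_of_contDiffOn (hf.fderivWithin hS.uniqueDiff (by simp)) hz
  unfold dirDeriv
  rw [fderivWithin_clm_apply (hS.uniqueDiff z hz) hd (differentiableWithinAt_const w)]
  simp [fderivWithin_const_apply]

lemma dirDeriv_comm (hS : IsCalcDomain S) (hf : ContDiffOn ℝ ∞ f S) (hz : z ∈ S) (v w : X) :
    dirDeriv S v (dirDeriv S w f) z = dirDeriv S w (dirDeriv S v f) z := by
  rw [dirDeriv_dirDeriv hS hf hz, dirDeriv_dirDeriv hS hf hz]
  exact (hf z hz).isSymmSndFDerivWithinAt (by simpa using ENat.LEInfty.out) hS.uniqueDiff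
    (hS.subset_closure hz) hz v w

lemma dirDeriv_const (c : W) : dirDeriv S v (fun _ => c) z = 0 := by
  simp [dirDeriv]

lemma dirDeriv_sub (hS : IsCalcDomain S) (hf : ContDiffOn ℝ ∞ f S) (hg : ContDiffOn ℝ ∞ g S)
    (hz : z ∈ S) :
    dirDeriv S v (fun y => f y - g y) z = dirDeriv S v f z - dirDeriv S v g z := by
  unfold dirDeriv
  rw [fderivWithin_fun_sub (hS.uniqueDiff z hz) (diffWithinAt_of_contDiffOn hf hz) (diffWithinAt_of_contDiffOn hg hz)]
  simp

lemma dirDeriv_sum (hS : IsCalcDomain S) {ι : Type*} {s : Finset ι} {F : ι → X → W}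
    (hF : ∀ i, ContDiffOn ℝ ∞ (F i) S) (hz : z ∈ S) :
    dirDeriv S v (fun y => ∑ i ∈ s, F i y) z = ∑ i ∈ s, dirDeriv S v (F i) z := by
  unfold dirDeriv
  rw [fderivWithin_fun_sum (hS.uniqueDiff z hz) (fun i _ => diffWithinAt_of_contDiffOn (hF i) hz)]
  simp

lemma dirDeriv_smul (hS : IsCalcDomain S) {c : X → ℝ} (hc : ContDiffOn ℝ ∞ c S)
    (hf : ContDiffOn ℝ ∞ f S) (hz : z ∈ S) :
    dirDeriv S v (fun y => c y • f y) z = c z • dirDeriv S v f z + dirDeriv S v c z • f z := by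
  unfold dirDeriv
  rw [fderivWithin_fun_smul (hS.uniqueDiff z hz) (diffWithinAt_of_contDiffOn hc hz) (diffWithinAt_of_contDiffOn hf hz)]
  simp

lemma dirDeriv_mul (hS : IsCalcDomain S) {c d : X → ℝ} (hc : ContDiffOn ℝ ∞ c S)
    (hd : ContDiffOn ℝ ∞ d S) (hz : z ∈ S) :
    dirDeriv S v (fun y => c y * d y) z = c z * dirDeriv S v d z + dirDeriv S v c z * d z :=
  dirDeriv_smul hS hc hd hz

lemma dirDeriv_clm (hS : IsCalcDomain S) {W' : Type*} [NormedAddCommGroup W'] [NormedSpace ℝ W']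
    (A : W →L[ℝ] W') (hf : ContDiffOn ℝ ∞ f S) (hz : z ∈ S) :
    dirDeriv S v (fun y => A (f y)) z = A (dirDeriv S v f z) := by
  unfold dirDeriv
  have := (A.hasFDerivAt.comp_hasFDerivWithinAt z (diffWithinAt_of_contDiffOn hf hz).hasFDerivWithinAt)
  exact DFunLike.congr_fun (HasFDerivWithinAt.fderivWithin this (hS.uniqueDiff z hz)) v

lemma dirDeriv_log (hS : IsCalcDomain S) {c : X → ℝ} (hc : ContDiffOn ℝ ∞ c S)
    (h0 : c z ≠ 0) (hz : z ∈ S) :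
    dirDeriv S v (fun y => Real.log (c y)) z = (c z)⁻¹ * dirDeriv S v c z := by
  unfold dirDeriv
  rw [fderivWithin.log (diffWithinAt_of_contDiffOn hc hz) h0 (hS.uniqueDiff z hz)]
  simp

variable {V : Type*} [NormedAddCommGroup V] [InnerProductSpace ℝ V]

lemma dirDeriv_inner (hS : IsCalcDomain S) {f g : X → V} (hf : ContDiffOn ℝ ∞ f S)
    (hg : ContDiffOn ℝ ∞ g S) (hz : z ∈ S) :
    dirDeriv S v (fun y => inner ℝ (f y) (g y)) z =
      inner ℝ (f z) (dirDeriv S v g z) + inner ℝ (dirDeriv S v f z) (g z) := by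
  unfold dirDeriv
  rw [((diffWithinAt_of_contDiffOn hf hz).hasFDerivWithinAt.inner ℝ
    (diffWithinAt_of_contDiffOn hg hz).hasFDerivWithinAt).fderivWithin (hS.uniqueDiff z hz)]
  simp

/-! ### Determinants and inverses of smooth matrices -/

variable {n : ℕ} {A : X → Matrix (Fin n) (Fin n) ℝ}

lemma contDiffOn_det (hA : ∀ i j, ContDiffOn ℝ ∞ (fun y => A y i j) S) :
    ContDiffOn ℝ ∞ (fun y => (A y).det) S := by
  simp only [Matrix.det_apply']
  exact ContDiffOn.sum fun σ _ => contDiffOn_const.mul (contDiffOn_prod fun i _ => hA _ _)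

lemma contDiffOn_inv (hA : ∀ i j, ContDiffOn ℝ ∞ (fun y => A y i j) S)
    (hdet : ∀ y ∈ S, (A y).det ≠ 0) (i j : Fin n) :
    ContDiffOn ℝ ∞ (fun y => (A y)⁻¹ i j) S := by
  have : (fun y => (A y)⁻¹ i j) =
      fun y => ((A y).det)⁻¹ * ((A y).updateRow j (Pi.single i 1)).det := by
    funext y
    rw [Matrix.inv_def, Matrix.smul_apply, Matrix.adjugate_apply, Ring.inverse_eq_inv', smul_eq_mul]
  rw [this]
  refine ((contDiffOn_det hA).inv hdet).mul (contDiffOn_det fun k l => ?_)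
  by_cases hk : k = j
  · subst hk; simpa using contDiffOn_const
  · simpa [Matrix.updateRow_ne hk] using hA k l

/-- Jacobi's formula for the derivative of a determinant. -/
lemma dirDeriv_det (hS : IsCalcDomain S) (hA : ∀ i j, ContDiffOn ℝ ∞ (fun y => A y i j) S)
    (hz : z ∈ S) :
    dirDeriv S v (fun y => (A y).det) z =
      ∑ i, ∑ j, (A z).adjugate i j * dirDeriv S v (fun y => A y j i) z := by
  have h1 : HasFDerivWithinAt (fun y => (A y).det)
      (∑ σ : Equiv.Perm (Fin n), ((Equiv.Perm.sign σ : ℤ) : ℝ) •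
        ∑ i, (∏ j ∈ Finset.univ.erase i, A z (σ j) j) •
          fderivWithin ℝ (fun y => A y (σ i) i) S z) S z := by
    simp only [Matrix.det_apply']
    refine HasFDerivWithinAt.fun_sum fun σ _ => ?_
    refine HasFDerivWithinAt.const_mul ?_ _
    exact HasFDerivWithinAt.finsetProd fun i _ => (diffWithinAt_of_contDiffOn (hA _ _) hz).hasFDerivWithinAt
  have h2 : ∀ i, ∑ j, (A z).adjugate i j * dirDeriv S v (fun y => A y j i) z =
      ((A z).updateCol i (fun j => dirDeriv S v (fun y => A y j i) z)).det := by
    intro i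
    rw [← Matrix.cramer_apply, Matrix.cramer_eq_adjugate_mulVec]
    rfl
  simp only [h2]
  unfold dirDeriv
  rw [h1.fderivWithin (hS.uniqueDiff z hz)]
  simp only [Matrix.det_apply']
  rw [Finset.sum_comm]
  simp only [sum_apply, smul_apply, smul_eq_mul]
  refine Finset.sum_congr rfl fun σ _ => ?_
  rw [Finset.mul_sum]
  refine Finset.sum_congr rfl fun i _ => ?_
  congr 1
  rw [← Finset.mul_prod_erase Finset.univ _ (Finset.mem_univ i), mul_comm]
  congr 1
  · simp
  · refine Finset.prod_congr rfl fun j hj => ?_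
    rw [Matrix.updateCol_ne (Finset.ne_of_mem_erase hj)]

/-- At a point where a matrix function is the identity, its inverse has the opposite derivative. -/
lemma dirDeriv_inv_of_eq_one (hS : IsCalcDomain S)
    (hA : ∀ i j, ContDiffOn ℝ ∞ (fun y => A y i j) S)
    (hdet : ∀ y ∈ S, (A y).det ≠ 0) (hz : z ∈ S) (h1 : A z = 1) (i j : Fin n) :
    dirDeriv S v (fun y => (A y)⁻¹ i j) z = - dirDeriv S v (fun y => A y i j) z := by
  have hI := contDiffOn_inv hA hdet
  have e1 : dirDeriv S v (fun y => ∑ k, A y i k * (A y)⁻¹ k j) z = 0 := by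
    rw [dirDeriv_congr (g := fun _ => (1 : Matrix (Fin n) (Fin n) ℝ) i j) _ hz, dirDeriv_const]
    intro y hy
    rw [← Matrix.mul_apply, Matrix.mul_nonsing_inv _ (hdet y hy).isUnit]
  rw [dirDeriv_sum hS (fun k => (hA i k).mul (hI k j)) hz] at e1
  simp only [dirDeriv_mul hS (hA i _) (hI _ j) hz, h1, inv_one, Finset.sum_add_distrib,
    Matrix.one_apply, ite_mul, one_mul, zero_mul, mul_ite, mul_one, mul_zero,
    Finset.sum_ite_eq, Finset.sum_ite_eq', Finset.mem_univ, if_true] at e1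
  linarith

end DirDeriv

/-! ### The evolution equation in flat coordinates -/

section DualFrame

variable {V : Type*} [NormedAddCommGroup V] [InnerProductSpace ℝ V] {n : ℕ}

/-- The frame of `span w` dual to `w` with respect to the inner product. For linearly dependent `w`
the inverse of the Gram matrix is `0`, and so is this frame. -/
def dualFrame (w : Fin n → V) (k : Fin n) : V :=
  ∑ l, (Matrix.gram ℝ w)⁻¹ k l • w l

variable {w : Fin n → V}

lemma det_gram_pos (hw : LinearIndependent ℝ w) : 0 < (Matrix.gram ℝ w).det :=
  (Matrix.posDef_gram_of_linearIndependent hw).det_pos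

lemma gram_inv_symm (w : Fin n → V) (i j : Fin n) :
    (Matrix.gram ℝ w)⁻¹ i j = (Matrix.gram ℝ w)⁻¹ j i := by
  have h : (Matrix.gram ℝ w)ᵀ = Matrix.gram ℝ w := by
    ext a b; simp [Matrix.gram_apply, real_inner_comm]
  conv_lhs => rw [← h, ← Matrix.transpose_nonsing_inv]
  rfl

lemma inner_dualFrame (hw : LinearIndependent ℝ w) (k j : Fin n) :
    inner ℝ (dualFrame w k) (w j) = if k = j then 1 else 0 := by
  have h : ((Matrix.gram ℝ w)⁻¹ * Matrix.gram ℝ w) k j = (1 : Matrix (Fin n) (Fin n) ℝ) k j := by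
    rw [Matrix.nonsing_inv_mul _ (det_gram_pos hw).ne'.isUnit]
  rw [Matrix.mul_apply, Matrix.one_apply] at h
  rw [← h, dualFrame, sum_inner]
  simp [inner_smul_left, Matrix.gram_apply]

lemma dualFrame_of_orthonormal (hw : Matrix.gram ℝ w = 1) (k : Fin n) : dualFrame w k = w k := by
  simp [dualFrame, hw, Matrix.one_apply]

/-- The orthogonal projection onto the normal space of the span of a frame. -/
lemma starProjection_orthogonal_span (hw : LinearIndependent ℝ w) (K : Submodule ℝ V)
    [Kᗮ.HasOrthogonalProjection] (hK : K = Submodule.span ℝ (range w)) (v : V) :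
    Kᗮ.starProjection v = v - ∑ l, inner ℝ (dualFrame w l) v • w l := by
  have hmem : ∀ l, w l ∈ K := fun l => hK ▸ Submodule.subset_span (mem_range_self l)
  refine Submodule.eq_starProjection_of_mem_of_inner_eq_zero ?_ ?_
  · rw [Submodule.mem_orthogonal]
    have h0 : ∀ j, inner ℝ (w j) (v - ∑ l, inner ℝ (dualFrame w l) v • w l) = 0 := by
      intro j
      have e1 : v - ∑ l, inner ℝ (dualFrame w l) v • w l = v - ∑ l, inner ℝ (w l) v • dualFrame w l := by
        congr 1
        simp only [dualFrame, sum_inner, inner_smul_left, Finset.sum_smul, Finset.smul_sum, smul_smul]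
        rw [Finset.sum_comm]
        refine Finset.sum_congr rfl fun l _ => Finset.sum_congr rfl fun m _ => ?_
        rw [gram_inv_symm w m l]
        simp [mul_comm]
      rw [e1, inner_sub_right, inner_sum]
      have e2 : ∀ l, inner ℝ (w j) (inner ℝ (w l) v • dualFrame w l) =
          if l = j then inner ℝ (w j) v else 0 := by
        intro l
        rw [inner_smul_right, real_inner_comm (dualFrame w l), inner_dualFrame hw]
        split_ifs with hl <;> simp [hl]
      simp [e2]
    intro y hy
    rw [hK] at hy
    induction hy using Submodule.span_induction with
    | mem y hy => obtain ⟨j, rfl⟩ := hy; exact h0 j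
    | zero => simp
    | add a b _ _ ha hb => rw [inner_add_left, ha, hb, add_zero]
    | smul c a _ ha => rw [inner_smul_left, ha, mul_zero]
  · intro y hy
    rw [sub_sub_cancel]
    rw [Submodule.mem_orthogonal] at hy
    exact hy _ (K.sum_mem fun l _ => K.smul_mem _ (hmem l))

end DualFrame

section Smooth

variable {X V : Type*} [NormedAddCommGroup X] [NormedSpace ℝ X]
  [NormedAddCommGroup V] [InnerProductSpace ℝ V] {n : ℕ} {S : Set X} {z v : X}
  {w : Fin n → X → V}

lemma contDiffOn_gram (hw : ∀ i, ContDiffOn ℝ ∞ (w i) S) (i j : Fin n) :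
    ContDiffOn ℝ ∞ (fun y => Matrix.gram ℝ (fun i => w i y) i j) S :=
  (hw i).inner ℝ (hw j)

lemma contDiffOn_dualFrame (hw : ∀ i, ContDiffOn ℝ ∞ (w i) S)
    (hli : ∀ y ∈ S, LinearIndependent ℝ fun i => w i y) (k : Fin n) :
    ContDiffOn ℝ ∞ (fun y => dualFrame (fun i => w i y) k) S :=
  ContDiffOn.sum fun l _ => (contDiffOn_inv (contDiffOn_gram hw)
    (fun y hy => (det_gram_pos (hli y hy)).ne') k l).smul (hw l)

lemma contDiffOn_log_det_gram (hw : ∀ i, ContDiffOn ℝ ∞ (w i) S)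
    (hli : ∀ y ∈ S, LinearIndependent ℝ fun i => w i y) :
    ContDiffOn ℝ ∞ (fun y => Real.log (Matrix.gram ℝ (fun i => w i y)).det) S :=
  (contDiffOn_det (contDiffOn_gram hw)).log fun y hy => (det_gram_pos (hli y hy)).ne'

/-- First variation of the logarithm of the volume spanned by a frame. -/
lemma dirDeriv_half_log_det_gram (hS : IsCalcDomain S) (hw : ∀ i, ContDiffOn ℝ ∞ (w i) S)
    (hli : ∀ y ∈ S, LinearIndependent ℝ fun i => w i y) (hz : z ∈ S) :
    dirDeriv S v (fun y => (1 / 2 : ℝ) * Real.log (Matrix.gram ℝ (fun i => w i y)).det) z =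
      ∑ k, inner ℝ (dualFrame (fun i => w i z) k) (dirDeriv S v (w k) z) := by
  have hG := contDiffOn_gram hw
  have h0 := (det_gram_pos (hli z hz)).ne'
  rw [dirDeriv_mul hS contDiffOn_const (contDiffOn_log_det_gram hw hli) hz, dirDeriv_const,
    dirDeriv_log hS (contDiffOn_det hG) h0 hz, dirDeriv_det hS hG hz]
  set g := Matrix.gram ℝ (fun i => w i z) with hg
  have hinv : ∀ i j, g⁻¹ i j = (g.det)⁻¹ * g.adjugate i j := by
    intro i j
    rw [Matrix.inv_def, Matrix.smul_apply, Ring.inverse_eq_inv', smul_eq_mul]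
  have e : ∀ i j, dirDeriv S v (fun y => Matrix.gram ℝ (fun i => w i y) j i) z =
      inner ℝ (w j z) (dirDeriv S v (w i) z) + inner ℝ (w i z) (dirDeriv S v (w j) z) := by
    intro i j
    simp only [Matrix.gram_apply]
    rw [dirDeriv_inner hS (hw j) (hw i) hz, real_inner_comm (w i z)]
  have e2 : (g.det)⁻¹ * ∑ i, ∑ j, g.adjugate i j *
      dirDeriv S v (fun y => Matrix.gram ℝ (fun i => w i y) j i) z =
      ∑ i, ∑ j, (g⁻¹ i j * inner ℝ (w j z) (dirDeriv S v (w i) z)) +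
      ∑ i, ∑ j, (g⁻¹ i j * inner ℝ (w i z) (dirDeriv S v (w j) z)) := by
    simp only [Finset.mul_sum, ← Finset.sum_add_distrib, e, hinv]
    refine Finset.sum_congr rfl fun i _ => Finset.sum_congr rfl fun j _ => ?_
    ring
  have e3 : ∑ i, ∑ j, (g⁻¹ i j * inner ℝ (w i z) (dirDeriv S v (w j) z)) =
      ∑ i, ∑ j, (g⁻¹ i j * inner ℝ (w j z) (dirDeriv S v (w i) z)) := by
    rw [Finset.sum_comm]
    refine Finset.sum_congr rfl fun i _ => Finset.sum_congr rfl fun j _ => ?_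
    rw [hg, gram_inv_symm _ j i]
  rw [e2, e3]
  simp only [dualFrame, sum_inner, inner_smul_left, ← hg]
  simp only [conj_trivial]
  ring

end Smooth

section Core

variable {X V : Type*} [NormedAddCommGroup X] [NormedSpace ℝ X]
  [NormedAddCommGroup V] [InnerProductSpace ℝ V] {n : ℕ}

/-- The mean curvature vector up to tangential terms, `g^{pq} ∂_p ∂_q u`, with respect to the
directions `ξ`. -/
def traceHess (S : Set X) (u : X → V) (ξ : Fin n → X) (z : X) : V :=
  ∑ p, ∑ q, (Matrix.gram ℝ fun i => dirDeriv S (ξ i) u z)⁻¹ p q •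
    dirDeriv S (ξ p) (dirDeriv S (ξ q) u) z

/-- `log(*Ω)` in coordinates: the logarithm of the quotient of the volumes spanned by the vectors
`π₁ ∂_i u` and `∂_i u`, for the directions `ξ_i`. -/
def logRatio (S : Set X) (u : X → V) (ξ : Fin n → X) (B : V →L[ℝ] V) (z : X) : ℝ :=
  (1 / 2 : ℝ) * Real.log (Matrix.gram ℝ fun i => B (dirDeriv S (ξ i) u z)).det -
    (1 / 2 : ℝ) * Real.log (Matrix.gram ℝ fun i => dirDeriv S (ξ i) u z).det

/-- A graphical Lagrangian mean curvature flow in Euclidean coordinates: `u` is defined on the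
space-time domain `S`, the time direction is `τ`, the spatial directions are spanned by `ξ`,
`B` is the orthogonal projection `π₁` and `J` the complex structure, both constant. -/
structure GraphFlow (S : Set X) (u : X → V) (τ : X) (ξ : Fin n → X) (B J : V →L[ℝ] V) : Prop where
  domain : IsCalcDomain S
  smooth : ContDiffOn ℝ ∞ u S
  proj_symm : ∀ v w, inner ℝ (B v) w = inner ℝ v (B w)
  proj_idem : ∀ v, B (B v) = B v
  skew : ∀ v w, inner ℝ (J v) w = - inner ℝ v (J w)
  immersed : ∀ z ∈ S, LinearIndependent ℝ fun i => dirDeriv S (ξ i) u z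
  graphical : ∀ z ∈ S, LinearIndependent ℝ fun i => B (dirDeriv S (ξ i) u z)
  lagrangian : ∀ z ∈ S, ∀ i j, inner ℝ (J (dirDeriv S (ξ i) u z)) (dirDeriv S (ξ j) u z) = 0
  flow : ∀ z ∈ S, dirDeriv S τ u z = traceHess S u ξ z -
    ∑ l, inner ℝ (dualFrame (fun i => dirDeriv S (ξ i) u z) l) (traceHess S u ξ z) •
      dirDeriv S (ξ l) u z

namespace GraphFlow

variable {S : Set X} {u : X → V} {τ : X} {ξ : Fin n → X} {B J : V →L[ℝ] V} {z v : X}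

/-- The frame of `π₁(TM)` dual to the tangent frame. -/
def projDual (S : Set X) (u : X → V) (ξ : Fin n → X) (B : V →L[ℝ] V) (k : Fin n) (z : X) : V :=
  dualFrame (fun i => B (dirDeriv S (ξ i) u z)) k

/-- The tangent frame dual to the tangent frame. -/
def tangDual (S : Set X) (u : X → V) (ξ : Fin n → X) (k : Fin n) (z : X) : V :=
  dualFrame (fun i => dirDeriv S (ξ i) u z) k

section
variable (h : GraphFlow S u τ ξ B J)
include h

lemma contDiffOn_tang (i : Fin n) : ContDiffOn ℝ ∞ (dirDeriv S (ξ i) u) S :=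
  contDiffOn_dirDeriv h.domain h.smooth _

lemma contDiffOn_hess (i j : Fin n) :
    ContDiffOn ℝ ∞ (dirDeriv S (ξ i) (dirDeriv S (ξ j) u)) S :=
  contDiffOn_dirDeriv h.domain (h.contDiffOn_tang j) _

lemma contDiffOn_proj (i : Fin n) : ContDiffOn ℝ ∞ (fun y => B (dirDeriv S (ξ i) u y)) S :=
  B.contDiff.comp_contDiffOn (h.contDiffOn_tang i)

lemma contDiffOn_projDual (k : Fin n) : ContDiffOn ℝ ∞ (projDual S u ξ B k) S :=
  contDiffOn_dualFrame h.contDiffOn_proj h.graphical k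

lemma contDiffOn_tangDual (k : Fin n) : ContDiffOn ℝ ∞ (tangDual S u ξ k) S :=
  contDiffOn_dualFrame h.contDiffOn_tang h.immersed k

lemma contDiffOn_logRatio : ContDiffOn ℝ ∞ (logRatio S u ξ B) S :=
  (contDiffOn_const.mul (contDiffOn_log_det_gram h.contDiffOn_proj h.graphical)).sub
    (contDiffOn_const.mul (contDiffOn_log_det_gram h.contDiffOn_tang h.immersed))

lemma proj_projDual (k : Fin n) : B (projDual S u ξ B k z) = projDual S u ξ B k z := by
  simp [projDual, dualFrame, h.proj_idem]

lemma inner_projDual_tang (hz : z ∈ S) (k j : Fin n) :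
    inner ℝ (projDual S u ξ B k z) (dirDeriv S (ξ j) u z) = if k = j then 1 else 0 := by
  rw [← h.proj_projDual, h.proj_symm]
  exact inner_dualFrame (h.graphical z hz) k j

lemma inner_tangDual_tang (hz : z ∈ S) (k j : Fin n) :
    inner ℝ (tangDual S u ξ k z) (dirDeriv S (ξ j) u z) = if k = j then 1 else 0 :=
  inner_dualFrame (h.immersed z hz) k j

/-- First variation of `log(*Ω)`. The vectors paired with the derivative are normal to the
submanifold, so that tangential terms do not contribute. -/
lemma dirDeriv_logRatio (hz : z ∈ S) : dirDeriv S v (logRatio S u ξ B) z =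
    ∑ k, inner ℝ (projDual S u ξ B k z - tangDual S u ξ k z)
      (dirDeriv S v (dirDeriv S (ξ k) u) z) := by
  unfold logRatio
  rw [dirDeriv_sub h.domain
    (contDiffOn_const.mul (contDiffOn_log_det_gram h.contDiffOn_proj h.graphical))
    (contDiffOn_const.mul (contDiffOn_log_det_gram h.contDiffOn_tang h.immersed)) hz,
    dirDeriv_half_log_det_gram h.domain h.contDiffOn_proj h.graphical hz,
    dirDeriv_half_log_det_gram h.domain h.contDiffOn_tang h.immersed hz, ← Finset.sum_sub_distrib]
  refine Finset.sum_congr rfl fun k _ => ?_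
  rw [inner_sub_left, dirDeriv_clm h.domain B (h.contDiffOn_tang k) hz, ← h.proj_symm]
  congr 2
  exact h.proj_projDual k

lemma hess_comm (hz : z ∈ S) (p q : Fin n) : dirDeriv S (ξ p) (dirDeriv S (ξ q) u) z =
    dirDeriv S (ξ q) (dirDeriv S (ξ p) u) z :=
  dirDeriv_comm h.domain h.smooth hz _ _

/-- `∂_k ∂_p ∂_p u = ∂_p ∂_p ∂_k u`. -/
lemma third_comm (hz : z ∈ S) (k p : Fin n) :
    dirDeriv S (ξ k) (dirDeriv S (ξ p) (dirDeriv S (ξ p) u)) z =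
      dirDeriv S (ξ p) (dirDeriv S (ξ p) (dirDeriv S (ξ k) u)) z := by
  rw [dirDeriv_comm h.domain (h.contDiffOn_tang p) hz]
  exact dirDeriv_congr (fun y hy => h.hess_comm hy k p) hz

/-- For a Lagrangian immersion, `⟨∂_p ∂_q u, J ∂_m u⟩` is symmetric in `q` and `m`. -/
lemma secondFund_symm (hz : z ∈ S) (p q m : Fin n) :
    inner ℝ (dirDeriv S (ξ p) (dirDeriv S (ξ q) u) z) (J (dirDeriv S (ξ m) u z)) =
      inner ℝ (dirDeriv S (ξ p) (dirDeriv S (ξ m) u) z) (J (dirDeriv S (ξ q) u z)) := by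
  have e : dirDeriv S (ξ p)
      (fun y => inner ℝ (J (dirDeriv S (ξ q) u y)) (dirDeriv S (ξ m) u y)) z = 0 := by
    rw [dirDeriv_congr (g := fun _ => (0 : ℝ)) (fun y hy => h.lagrangian y hy q m) hz,
      dirDeriv_const]
  have hJ : ContDiffOn ℝ ∞ (fun y => J (dirDeriv S (ξ q) u y)) S :=
    J.contDiff.comp_contDiffOn (h.contDiffOn_tang q)
  rw [dirDeriv_inner h.domain hJ (h.contDiffOn_tang m) hz, dirDeriv_clm h.domain J (h.contDiffOn_tang q) hz,
    h.skew (dirDeriv S (ξ p) _ z)] at e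
  rw [real_inner_comm (J (dirDeriv S (ξ q) u z))]
  linarith

end


/-- The values of the data at a point where the directions `ξ` form an adapted frame with
parameters `lam`. The last condition says that the tangent frame and its image under `J` together
form an orthonormal basis. -/
structure AdaptedAt (S : Set X) (u : X → V) (ξ : Fin n → X) (B J : V →L[ℝ] V) (lam : Fin n → ℝ)
    (z : X) : Prop where
  gram_eq : (Matrix.gram ℝ fun i => dirDeriv S (ξ i) u z) = 1
  projDual_eq : ∀ k, projDual S u ξ B k z =
    dirDeriv S (ξ k) u z - lam k • J (dirDeriv S (ξ k) u z)
  proj_J : ∀ k, B (J (dirDeriv S (ξ k) u z)) = - lam k • B (dirDeriv S (ξ k) u z)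
  expand : ∀ w, w = ∑ m, inner ℝ (dirDeriv S (ξ m) u z) w • dirDeriv S (ξ m) u z +
    ∑ m, inner ℝ (J (dirDeriv S (ξ m) u z)) w • J (dirDeriv S (ξ m) u z)

section
variable (h : GraphFlow S u τ ξ B J)
include h

/-- The time derivative of the tangent frame, paired with a normal vector `R`, at a point with
orthonormal coordinate directions: the spatial derivative of the mean curvature vector. -/
lemma dirDeriv_time_tang (hz : z ∈ S) (h1 : (Matrix.gram ℝ fun i => dirDeriv S (ξ i) u z) = 1)
    (k : Fin n) (R : V) (hR : ∀ l, inner ℝ R (dirDeriv S (ξ l) u z) = 0) :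
    inner ℝ R (dirDeriv S τ (dirDeriv S (ξ k) u) z) =
      (∑ p, inner ℝ R (dirDeriv S (ξ p) (dirDeriv S (ξ p) (dirDeriv S (ξ k) u)) z)) -
      (∑ p, ∑ q, dirDeriv S (ξ k) (fun y => Matrix.gram ℝ (fun i => dirDeriv S (ξ i) u y) p q) z *
        inner ℝ R (dirDeriv S (ξ p) (dirDeriv S (ξ q) u) z)) -
      ∑ l, inner ℝ (dirDeriv S (ξ l) u z) (traceHess S u ξ z) *
        inner ℝ R (dirDeriv S (ξ l) (dirDeriv S (ξ k) u) z) := by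
  have hD := h.domain
  have hT := h.contDiffOn_tang
  have hdet : ∀ y ∈ S, (Matrix.gram ℝ (fun i => dirDeriv S (ξ i) u y)).det ≠ 0 :=
    fun y hy => (det_gram_pos (h.immersed y hy)).ne'
  have hI := contDiffOn_inv (contDiffOn_gram hT) hdet
  have hterm : ∀ p q, ContDiffOn ℝ ∞ (fun y => (Matrix.gram ℝ fun i => dirDeriv S (ξ i) u y)⁻¹ p q •
      dirDeriv S (ξ p) (dirDeriv S (ξ q) u) y) S := fun p q => (hI p q).smul (h.contDiffOn_hess p q)
  have hH : ContDiffOn ℝ ∞ (traceHess S u ξ) S :=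
    ContDiffOn.sum fun p _ => ContDiffOn.sum fun q _ => hterm p q
  have hc : ∀ l, ContDiffOn ℝ ∞ (fun y => inner ℝ (dualFrame (fun i => dirDeriv S (ξ i) u y) l)
      (traceHess S u ξ y)) S := fun l => (h.contDiffOn_tangDual l).inner ℝ hH
  have hcs : ∀ l, ContDiffOn ℝ ∞ (fun y => inner ℝ (dualFrame (fun i => dirDeriv S (ξ i) u y) l)
      (traceHess S u ξ y) • dirDeriv S (ξ l) u y) S := fun l => (hc l).smul (hT l)
  rw [dirDeriv_comm hD h.smooth hz, dirDeriv_congr h.flow hz,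
    dirDeriv_sub hD hH (ContDiffOn.sum fun l _ => hcs l) hz, dirDeriv_sum hD hcs hz]
  have eH : inner ℝ R (dirDeriv S (ξ k) (traceHess S u ξ) z) =
      (∑ p, inner ℝ R (dirDeriv S (ξ p) (dirDeriv S (ξ p) (dirDeriv S (ξ k) u)) z)) -
      (∑ p, ∑ q, dirDeriv S (ξ k) (fun y => Matrix.gram ℝ (fun i => dirDeriv S (ξ i) u y) p q) z *
        inner ℝ R (dirDeriv S (ξ p) (dirDeriv S (ξ q) u) z)) := by
    unfold traceHess
    rw [dirDeriv_sum hD (fun p => ContDiffOn.sum fun q _ => hterm p q) hz, inner_sum,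
      ← Finset.sum_sub_distrib]
    refine Finset.sum_congr rfl fun p _ => ?_
    rw [dirDeriv_sum hD (hterm p) hz, inner_sum, ← h.third_comm hz k p]
    have e : ∀ q, inner ℝ R (dirDeriv S (ξ k) (fun y =>
        (Matrix.gram ℝ fun i => dirDeriv S (ξ i) u y)⁻¹ p q •
          dirDeriv S (ξ p) (dirDeriv S (ξ q) u) y) z) =
        (if p = q then inner ℝ R (dirDeriv S (ξ k) (dirDeriv S (ξ p) (dirDeriv S (ξ q) u)) z)
          else 0) -
        dirDeriv S (ξ k) (fun y => Matrix.gram ℝ (fun i => dirDeriv S (ξ i) u y) p q) z *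
          inner ℝ R (dirDeriv S (ξ p) (dirDeriv S (ξ q) u) z) := by
      intro q
      rw [dirDeriv_smul hD (hI p q) (h.contDiffOn_hess p q) hz, h1,
        dirDeriv_inv_of_eq_one hD (contDiffOn_gram hT) hdet hz h1, inner_add_right,
        inner_smul_right, inner_smul_right, inv_one, Matrix.one_apply]
      split_ifs <;> ring
    simp only [e, Finset.sum_sub_distrib, Finset.sum_ite_eq, Finset.mem_univ, if_true]
  rw [inner_sub_right, eH, inner_sum]
  congr 1
  refine Finset.sum_congr rfl fun l _ => ?_
  rw [dirDeriv_smul hD (hc l) (hT l) hz, inner_add_right, inner_smul_right, inner_smul_right, hR,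
    dualFrame_of_orthonormal h1, h.hess_comm hz k l]
  ring

lemma inner_dirDeriv_projDual_tang (hz : z ∈ S) (k m : Fin n) :
    inner ℝ (dirDeriv S v (projDual S u ξ B k) z) (dirDeriv S (ξ m) u z) =
      - inner ℝ (projDual S u ξ B k z) (dirDeriv S v (dirDeriv S (ξ m) u) z) := by
  have e : dirDeriv S v
      (fun y => inner ℝ (projDual S u ξ B k y) (dirDeriv S (ξ m) u y)) z = 0 := by
    rw [dirDeriv_congr (fun y hy => h.inner_projDual_tang hy k m) hz, dirDeriv_const]
  rw [dirDeriv_inner h.domain (h.contDiffOn_projDual k) (h.contDiffOn_tang m) hz] at e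
  linarith

lemma proj_dirDeriv_projDual (hz : z ∈ S) (k : Fin n) :
    B (dirDeriv S v (projDual S u ξ B k) z) = dirDeriv S v (projDual S u ξ B k) z := by
  rw [← dirDeriv_clm h.domain B (h.contDiffOn_projDual k) hz]
  exact dirDeriv_congr (fun y _ => h.proj_projDual k) hz

/-- The dual frame `K` of `π₁(TM)` varies inside `π₁(TM)`, so its derivative is determined by the
pairing with the tangent frame. -/
lemma inner_dirDeriv_projDual {lam : Fin n → ℝ} (hz : z ∈ S) (ha : AdaptedAt S u ξ B J lam z)
    (k : Fin n) (w : V) :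
    inner ℝ (dirDeriv S v (projDual S u ξ B k) z) w =
      - ∑ m, (inner ℝ (dirDeriv S (ξ m) u z) w - lam m * inner ℝ (J (dirDeriv S (ξ m) u z)) w) *
        inner ℝ (projDual S u ξ B k z) (dirDeriv S v (dirDeriv S (ξ m) u) z) := by
  have hJ : ∀ m, inner ℝ (dirDeriv S v (projDual S u ξ B k) z) (J (dirDeriv S (ξ m) u z)) =
      - lam m * inner ℝ (dirDeriv S v (projDual S u ξ B k) z) (dirDeriv S (ξ m) u z) := by
    intro m
    rw [← h.proj_dirDeriv_projDual hz, h.proj_symm, h.proj_symm, ha.proj_J, inner_smul_right]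
  conv_lhs => rw [ha.expand w]
  simp only [inner_add_right, inner_sum, inner_smul_right, hJ, h.inner_dirDeriv_projDual_tang hz]
  rw [← Finset.sum_add_distrib, ← Finset.sum_neg_distrib]
  refine Finset.sum_congr rfl fun m _ => ?_
  ring

/-- The derivative of the dual frame `S` of the tangent space, in terms of those of the frame. -/
lemma inner_dirDeriv_tangDual (hz : z ∈ S)
    (h1 : (Matrix.gram ℝ fun i => dirDeriv S (ξ i) u z) = 1) (k : Fin n) (w : V) :
    inner ℝ (dirDeriv S v (tangDual S u ξ k) z) w =
      inner ℝ (dirDeriv S v (dirDeriv S (ξ k) u) z) w -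
      ∑ l, (inner ℝ (dirDeriv S (ξ l) u z) (dirDeriv S v (dirDeriv S (ξ k) u) z) +
          inner ℝ (dirDeriv S (ξ k) u z) (dirDeriv S v (dirDeriv S (ξ l) u) z)) *
        inner ℝ (dirDeriv S (ξ l) u z) w := by
  have hD := h.domain
  have hT := h.contDiffOn_tang
  have hdet : ∀ y ∈ S, (Matrix.gram ℝ (fun i => dirDeriv S (ξ i) u y)).det ≠ 0 :=
    fun y hy => (det_gram_pos (h.immersed y hy)).ne'
  have hI := contDiffOn_inv (contDiffOn_gram hT) hdet
  have hs : ∀ l, ContDiffOn ℝ ∞ (fun y =>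
      (Matrix.gram ℝ fun i => dirDeriv S (ξ i) u y)⁻¹ k l • dirDeriv S (ξ l) u y) S :=
    fun l => (hI k l).smul (hT l)
  unfold tangDual dualFrame
  rw [dirDeriv_sum hD hs hz, sum_inner]
  have e : ∀ l, inner ℝ (dirDeriv S v (fun y =>
        (Matrix.gram ℝ fun i => dirDeriv S (ξ i) u y)⁻¹ k l • dirDeriv S (ξ l) u y) z) w =
      (if k = l then inner ℝ (dirDeriv S v (dirDeriv S (ξ l) u) z) w else 0) -
      (inner ℝ (dirDeriv S (ξ l) u z) (dirDeriv S v (dirDeriv S (ξ k) u) z) +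
          inner ℝ (dirDeriv S (ξ k) u z) (dirDeriv S v (dirDeriv S (ξ l) u) z)) *
        inner ℝ (dirDeriv S (ξ l) u z) w := by
    intro l
    rw [dirDeriv_smul hD (hI k l) (hT l) hz, h1,
      dirDeriv_inv_of_eq_one hD (contDiffOn_gram hT) hdet hz h1, inv_one, Matrix.one_apply]
    simp only [Matrix.gram_apply]
    rw [dirDeriv_inner hD (hT k) (hT l) hz, inner_add_left, inner_smul_left, inner_smul_left,
      real_inner_comm (dirDeriv S (ξ l) u z) (dirDeriv S v (dirDeriv S (ξ k) u) z)]
    simp only [conj_trivial]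
    split_ifs <;> ring
  simp only [e, Finset.sum_sub_distrib, Finset.sum_ite_eq, Finset.mem_univ, if_true]

end

/-- The algebraic identity by which the Christoffel symbols `γ` drop out of the evolution
equation. -/
lemma christoffel_cancel (lam : Fin n → ℝ) (γ η : Fin n → Fin n → Fin n → ℝ)
    (hγ : ∀ p q m, γ p q m = γ q p m) (h12 : ∀ p q m, η p q m = η q p m)
    (h23 : ∀ p q m, η p q m = η p m q) :
    -(∑ k, ∑ p, ∑ q, (γ k p q + γ k q p) * (-lam k * η p q k)) -
      ∑ p, ∑ k, (-(∑ m, (γ p k m - lam m * η p k m) * (γ p m k - lam k * η p m k)) -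
        ((∑ m, γ p k m ^ 2 + ∑ m, η p k m ^ 2) - ∑ m, (γ p k m + γ p m k) * γ p k m)) =
      ∑ p, ∑ k, ∑ m, (1 + lam k * lam m) * η p k m ^ 2 := by
  have a1 : ∑ k, ∑ p, ∑ q, (γ k p q + γ k q p) * (-lam k * η p q k) =
      ∑ p, ∑ k, ∑ m, (-2 * (lam k * η p m k * γ p k m)) := by
    have b1 : ∑ k, ∑ p, ∑ q, γ k p q * (-lam k * η p q k) =
        ∑ p, ∑ k, ∑ m, -(lam k * η p m k * γ p k m) := by
      rw [Finset.sum_comm]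
      refine Finset.sum_congr rfl fun p _ => Finset.sum_congr rfl fun k _ =>
        Finset.sum_congr rfl fun m _ => ?_
      rw [hγ k p m]; ring
    have b2 : ∑ k, ∑ p, ∑ q, γ k q p * (-lam k * η p q k) =
        ∑ k, ∑ p, ∑ q, γ k p q * (-lam k * η p q k) := by
      refine Finset.sum_congr rfl fun k _ => ?_
      rw [Finset.sum_comm]
      refine Finset.sum_congr rfl fun p _ => Finset.sum_congr rfl fun q _ => ?_
      rw [h12 q p k]
    simp only [add_mul, Finset.sum_add_distrib]
    rw [b2, b1, ← Finset.sum_add_distrib]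
    refine Finset.sum_congr rfl fun p _ => ?_
    rw [← Finset.sum_add_distrib]
    refine Finset.sum_congr rfl fun k _ => ?_
    rw [← Finset.sum_add_distrib]
    refine Finset.sum_congr rfl fun m _ => ?_
    ring
  have a2 : ∑ p, ∑ k, ∑ m, lam m * η p k m * γ p m k = ∑ p, ∑ k, ∑ m, lam k * η p m k * γ p k m := by
    refine Finset.sum_congr rfl fun p _ => ?_
    rw [Finset.sum_comm]
  have a3 : ∑ p, ∑ k, (-(∑ m, (γ p k m - lam m * η p k m) * (γ p m k - lam k * η p m k)) -
        ((∑ m, γ p k m ^ 2 + ∑ m, η p k m ^ 2) - ∑ m, (γ p k m + γ p m k) * γ p k m)) =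
      (∑ p, ∑ k, ∑ m, lam m * η p k m * γ p m k) + (∑ p, ∑ k, ∑ m, lam k * η p m k * γ p k m) -
        ∑ p, ∑ k, ∑ m, (1 + lam k * lam m) * η p k m ^ 2 := by
    simp only [← Finset.sum_add_distrib, ← Finset.sum_sub_distrib, ← Finset.sum_neg_distrib]
    refine Finset.sum_congr rfl fun p _ => Finset.sum_congr rfl fun k _ =>
      Finset.sum_congr rfl fun m _ => ?_
    rw [h23 p m k]; ring
  rw [a1, a3, a2]
  simp only [← Finset.mul_sum]
  ring

/-- The evolution equation of `log(*Ω)` in coordinates. The third derivatives of `u` and the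
tangential part of the velocity cancel before any choice of normal coordinates is made. -/
theorem evolution (h : GraphFlow S u τ ξ B J) {lam : Fin n → ℝ} (hz : z ∈ S)
    (ha : AdaptedAt S u ξ B J lam z) :
    dirDeriv S τ (logRatio S u ξ B) z -
      (∑ p, dirDeriv S (ξ p) (dirDeriv S (ξ p) (logRatio S u ξ B)) z -
        ∑ q, inner ℝ (dirDeriv S (ξ q) u z) (∑ p, dirDeriv S (ξ p) (dirDeriv S (ξ p) u) z) *
          dirDeriv S (ξ q) (logRatio S u ξ B) z) =
      ∑ i, ∑ j, ∑ k, (1 + lam j * lam k) * inner ℝ (dirDeriv S (ξ i) (dirDeriv S (ξ j) u) z)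
        (J (dirDeriv S (ξ k) u z)) ^ 2 := by
  have hD := h.domain
  have hT := h.contDiffOn_tang
  have hRs : ∀ k, ContDiffOn ℝ ∞ (fun y => projDual S u ξ B k y - tangDual S u ξ k y) S :=
    fun k => (h.contDiffOn_projDual k).sub (h.contDiffOn_tangDual k)
  have htr : traceHess S u ξ z = ∑ p, dirDeriv S (ξ p) (dirDeriv S (ξ p) u) z := by
    simp [traceHess, ha.gram_eq, Matrix.one_apply]
  have hS1 : ∀ k, tangDual S u ξ k z = dirDeriv S (ξ k) u z :=
    fun k => dualFrame_of_orthonormal ha.gram_eq k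
  have eR : ∀ k, projDual S u ξ B k z - tangDual S u ξ k z =
      -lam k • J (dirDeriv S (ξ k) u z) := by
    intro k; rw [ha.projDual_eq, hS1]; module
  have hR0 : ∀ k l, inner ℝ (projDual S u ξ B k z - tangDual S u ξ k z)
      (dirDeriv S (ξ l) u z) = 0 := by
    intro k l
    rw [inner_sub_left, h.inner_projDual_tang hz, h.inner_tangDual_tang hz, sub_self]
  -- second derivatives of `log(*Ω)`
  have e2 : ∀ p, dirDeriv S (ξ p) (dirDeriv S (ξ p) (logRatio S u ξ B)) z =
      ∑ k, (inner ℝ (projDual S u ξ B k z - tangDual S u ξ k z)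
          (dirDeriv S (ξ p) (dirDeriv S (ξ p) (dirDeriv S (ξ k) u)) z) +
        (inner ℝ (dirDeriv S (ξ p) (projDual S u ξ B k) z)
            (dirDeriv S (ξ p) (dirDeriv S (ξ k) u) z) -
          inner ℝ (dirDeriv S (ξ p) (tangDual S u ξ k) z)
            (dirDeriv S (ξ p) (dirDeriv S (ξ k) u) z))) := by
    intro p
    rw [dirDeriv_congr (fun y hy => h.dirDeriv_logRatio hy) hz,
      dirDeriv_sum hD (fun k => (hRs k).inner ℝ (h.contDiffOn_hess p k)) hz]
    refine Finset.sum_congr rfl fun k _ => ?_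
    rw [dirDeriv_inner hD (hRs k) (h.contDiffOn_hess p k) hz,
      dirDeriv_sub hD (h.contDiffOn_projDual k) (h.contDiffOn_tangDual k) hz]
    simp only [inner_sub_left]
  set γ : Fin n → Fin n → Fin n → ℝ := fun p q m =>
    inner ℝ (dirDeriv S (ξ m) u z) (dirDeriv S (ξ p) (dirDeriv S (ξ q) u) z) with hγ
  set η : Fin n → Fin n → Fin n → ℝ := fun p q m =>
    inner ℝ (dirDeriv S (ξ p) (dirDeriv S (ξ q) u) z) (J (dirDeriv S (ξ m) u z)) with hη
  have hη' : ∀ p q m, inner ℝ (J (dirDeriv S (ξ m) u z))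
      (dirDeriv S (ξ p) (dirDeriv S (ξ q) u) z) = η p q m := fun p q m => real_inner_comm _ _
  have eK : ∀ p q k, inner ℝ (projDual S u ξ B k z) (dirDeriv S (ξ p) (dirDeriv S (ξ q) u) z) =
      γ p q k - lam k * η p q k := by
    intro p q k
    rw [ha.projDual_eq, inner_sub_left, real_inner_smul_left, hη']
  have eRX : ∀ p q k, inner ℝ (projDual S u ξ B k z - tangDual S u ξ k z)
      (dirDeriv S (ξ p) (dirDeriv S (ξ q) u) z) = -lam k * η p q k := by
    intro p q k
    rw [eR, real_inner_smul_left, hη']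
  have eG : ∀ k p q, dirDeriv S (ξ k)
      (fun y => Matrix.gram ℝ (fun i => dirDeriv S (ξ i) u y) p q) z = γ k p q + γ k q p := by
    intro k p q
    simp only [Matrix.gram_apply]
    rw [dirDeriv_inner hD (hT p) (hT q) hz,
      real_inner_comm (dirDeriv S (ξ q) u z), add_comm]
  have esq : ∀ p k, inner ℝ (dirDeriv S (ξ p) (dirDeriv S (ξ k) u) z)
      (dirDeriv S (ξ p) (dirDeriv S (ξ k) u) z) = ∑ m, γ p k m ^ 2 + ∑ m, η p k m ^ 2 := by
    intro p k
    conv_lhs => arg 2; rw [ha.expand (dirDeriv S (ξ p) (dirDeriv S (ξ k) u) z)]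
    simp only [inner_add_left, sum_inner, real_inner_smul_left, hη', sq]
    rfl
  rw [← christoffel_cancel lam γ η (fun p q m => by simp only [hγ]; rw [h.hess_comm hz])
    (fun p q m => by simp only [hη]; rw [h.hess_comm hz])
    (fun p q m => h.secondFund_symm hz p q m)]
  rw [h.dirDeriv_logRatio hz]
  simp only [fun k => h.dirDeriv_time_tang hz ha.gram_eq k _ (hR0 k), e2, h.dirDeriv_logRatio hz,
    htr, eG, h.inner_dirDeriv_projDual hz ha, h.inner_dirDeriv_tangDual hz ha.gram_eq, esq,
    eRX, eK, hη']
  -- `A` stands for the third derivatives, `c` for the coefficients of the tangential velocity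
  have cancel : ∀ (A r U : Fin n → Fin n → ℝ) (c Q : Fin n → ℝ),
      ∑ x, (∑ y, A x y - Q x - ∑ y, c y * r y x) -
        (∑ x, ∑ y, (A y x + U x y) - ∑ x, c x * ∑ y, r x y) =
      -(∑ x, Q x) - ∑ x, ∑ y, U x y := by
    intro A r U c Q
    have h1 : ∑ x, ∑ y, A x y = ∑ x, ∑ y, A y x := Finset.sum_comm
    have h2 : ∑ x, ∑ y, c y * r y x = ∑ x, ∑ y, c x * r x y := Finset.sum_comm
    simp only [Finset.sum_add_distrib, Finset.sum_sub_distrib, Finset.mul_sum]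
    linarith
  exact cancel (fun k p => inner ℝ (projDual S u ξ B k z - tangDual S u ξ k z)
    (dirDeriv S (ξ p) (dirDeriv S (ξ p) (dirDeriv S (ξ k) u)) z))
    (fun l k => -lam k * η l k k) _ _ _

end GraphFlow
end Core

/-! ### Traces, regrouping of sums, and slices of space-time -/

section Regroup

/-- A sum over triples of indices, grouped by coincidences and by order. -/
lemma sum_triple {n : ℕ} (f : Fin n → Fin n → Fin n → ℝ) :
    ∑ i, ∑ j, ∑ k, f i j k = (∑ i, f i i i) +
      (∑ i, ∑ j, if i ≠ j then f i i j + f i j i + f j i i else 0) +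
      ∑ i, ∑ j, ∑ k, if i < j ∧ j < k then
        f i j k + f i k j + f j i k + f j k i + f k i j + f k j i else 0 := by
  have key : ∀ i j k, f i j k =
      (if i = j then if i = k then f i i i else 0 else 0) +
      ((if i = j then if i ≠ k then f i i k else 0 else 0) +
       (if i = k then if i ≠ j then f i j i else 0 else 0) +
       (if k = j then if k ≠ i then f i k k else 0 else 0)) +
      ((if i < j ∧ j < k then f i j k else 0) + (if i < k ∧ k < j then f i j k else 0) +
       (if j < i ∧ i < k then f i j k else 0) + (if j < k ∧ k < i then f i j k else 0) +
       (if k < i ∧ i < j then f i j k else 0) + (if k < j ∧ j < i then f i j k else 0)) := by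
    intro i j k
    grind
  have s132 : ∀ g : Fin n → Fin n → Fin n → ℝ, ∑ i, ∑ j, ∑ k, g i k j = ∑ i, ∑ j, ∑ k, g i j k :=
    fun g => Finset.sum_congr rfl fun i _ => Finset.sum_comm
  have s213 : ∀ g : Fin n → Fin n → Fin n → ℝ, ∑ i, ∑ j, ∑ k, g j i k = ∑ i, ∑ j, ∑ k, g i j k :=
    fun g => Finset.sum_comm
  have s231 : ∀ g : Fin n → Fin n → Fin n → ℝ, ∑ i, ∑ j, ∑ k, g j k i = ∑ i, ∑ j, ∑ k, g i j k :=
    fun g => by rw [s213 (fun i j k => g i k j), s132]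
  have s312 : ∀ g : Fin n → Fin n → Fin n → ℝ, ∑ i, ∑ j, ∑ k, g k i j = ∑ i, ∑ j, ∑ k, g i j k :=
    fun g => by rw [s132 (fun i j k => g j i k), s213]
  have s321 : ∀ g : Fin n → Fin n → Fin n → ℝ, ∑ i, ∑ j, ∑ k, g k j i = ∑ i, ∑ j, ∑ k, g i j k :=
    fun g => by rw [s132 (fun i j k => g j k i), s231]
  have a1 : ∑ i, ∑ j, ∑ k, (if i = j then if i = k then f i i i else 0 else 0) = ∑ i, f i i i := by
    refine Finset.sum_congr rfl fun i _ => ?_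
    simp
  have a2 : ∑ i, ∑ j, ∑ k, (if i = j then if i ≠ k then f i i k else 0 else 0) =
      ∑ i, ∑ j, if i ≠ j then f i i j else 0 := by
    refine Finset.sum_congr rfl fun i _ => ?_
    rw [Finset.sum_comm]
    simp
  have a3 : ∑ i, ∑ j, ∑ k, (if i = k then if i ≠ j then f i j i else 0 else 0) =
      ∑ i, ∑ j, if i ≠ j then f i j i else 0 := by
    simp
  have a4 : ∑ i, ∑ j, ∑ k, (if k = j then if k ≠ i then f i k k else 0 else 0) =
      ∑ i, ∑ j, if i ≠ j then f j i i else 0 := by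
    rw [Finset.sum_comm]
    simp
  have p1 := s132 (fun i j k => if i < j ∧ j < k then f i k j else 0)
  have p2 := s213 (fun i j k => if i < j ∧ j < k then f j i k else 0)
  have p3 := s231 (fun i j k => if i < j ∧ j < k then f k i j else 0)
  have p4 := s312 (fun i j k => if i < j ∧ j < k then f j k i else 0)
  have p5 := s321 (fun i j k => if i < j ∧ j < k then f k j i else 0)
  rw [Finset.sum_congr rfl fun i _ => Finset.sum_congr rfl fun j _ =>
    Finset.sum_congr rfl fun k _ => key i j k]
  have r2 : ∀ i j, (if i ≠ j then f i i j + f i j i + f j i i else 0) =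
      (if i ≠ j then f i i j else 0) + (if i ≠ j then f i j i else 0) +
        (if i ≠ j then f j i i else 0) := by
    intro i j; split_ifs <;> ring
  have r3 : ∀ i j k, (if i < j ∧ j < k then
        f i j k + f i k j + f j i k + f j k i + f k i j + f k j i else 0) =
      (if i < j ∧ j < k then f i j k else 0) + (if i < j ∧ j < k then f i k j else 0) +
      (if i < j ∧ j < k then f j i k else 0) + (if i < j ∧ j < k then f j k i else 0) +
      (if i < j ∧ j < k then f k i j else 0) + (if i < j ∧ j < k then f k j i else 0) := by
    intro i j k; split_ifs <;> ring
  simp only [r2, r3, Finset.sum_add_distrib, a1, a2, a3, a4, p1, p2, p3, p4, p5]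
  ring

/-- The right-hand side of the evolution equation, collected by total symmetry of `h`. -/
lemma sum_secondFund_regroup {n : ℕ} (lam : Fin n → ℝ) (h : Fin n → Fin n → Fin n → ℝ)
    (h12 : ∀ i j k, h i j k = h j i k) (h23 : ∀ i j k, h i j k = h i k j) :
    ∑ i, ∑ j, ∑ k, (1 + lam j * lam k) * h i j k ^ 2 =
      (∑ i, (1 + lam i ^ 2) * h i i i ^ 2) +
      (∑ i, ∑ j ∈ Finset.univ.filter (fun j => i ≠ j),
        (3 + lam i ^ 2 + 2 * lam i * lam j) * h i i j ^ 2) +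
      ∑ i, ∑ j ∈ Finset.Ioi i, ∑ k ∈ Finset.Ioi j,
        (6 + 2 * lam i * lam j + 2 * lam j * lam k + 2 * lam k * lam i) * h i j k ^ 2 := by
  rw [sum_triple]
  congr 1
  · congr 1
    · exact Finset.sum_congr rfl fun i _ => by ring
    · refine Finset.sum_congr rfl fun i _ => ?_
      rw [Finset.sum_filter]
      refine Finset.sum_congr rfl fun j _ => ?_
      rw [h23 i j i, h12 j i i, h23 i j i]
      split_ifs <;> ring
  · refine Finset.sum_congr rfl fun i _ => ?_
    have hI : ∀ a : Fin n, Finset.Ioi a = Finset.univ.filter (fun b => a < b) := by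
      intro a; ext b; simp
    rw [hI, Finset.sum_filter]
    refine Finset.sum_congr rfl fun j _ => ?_
    rw [hI, Finset.sum_filter]
    by_cases hij : i < j
    · simp only [hij, true_and, if_true]
      refine Finset.sum_congr rfl fun k _ => ?_
      rw [h23 i k j, h12 j i k, h12 j k i, h23 k j i, h12 k i j, h23 i k j]
      split_ifs <;> ring
    · simp [hij]

end Regroup

section Traces

variable {V W : Type*} [NormedAddCommGroup V] [InnerProductSpace ℝ V] [AddCommGroup W] [Module ℝ W]
  {n : ℕ}

lemma linearMap_apply_eq_sum (D : E n →ₗ[ℝ] W) (v : E n) :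
    D v = ∑ j, v j • D (EuclideanSpace.single j 1) := by
  conv_lhs => rw [← (EuclideanSpace.basisFun (Fin n) ℝ).sum_repr v]
  simp

lemma linearIndependent_single :
    LinearIndependent ℝ fun i : Fin n => (EuclideanSpace.single i (1 : ℝ) : E n) := by
  have h : ⇑(EuclideanSpace.basisFun (Fin n) ℝ) =
      fun i : Fin n => (EuclideanSpace.single i (1 : ℝ) : E n) := by
    funext i; simp
  rw [← h, ← OrthonormalBasis.coe_toBasis]
  exact Module.Basis.linearIndependent _

/-- The matrix whose rows are the coordinates of the vectors `w`. -/
def rowMatrix (w : Fin n → E n) : Matrix (Fin n) (Fin n) ℝ := Matrix.of fun i j => w i j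

lemma det_rowMatrix_ne_zero {w : Fin n → E n} (hw : LinearIndependent ℝ w) :
    (rowMatrix w).det ≠ 0 := by
  have h : LinearIndependent ℝ (rowMatrix w).row :=
    hw.map' (WithLp.linearEquiv 2 ℝ (Fin n → ℝ)).toLinearMap (LinearEquiv.ker _)
  exact ((Matrix.isUnit_iff_isUnit_det _).1 (Matrix.linearIndependent_rows_iff_isUnit.1 h)).ne_zero

/-- Change of basis for Gram matrices. -/
lemma gram_map (D : E n →ₗ[ℝ] V) (w : Fin n → E n) :
    (Matrix.gram ℝ fun i => D (w i)) =
      rowMatrix w * (Matrix.gram ℝ fun i => D (EuclideanSpace.single i 1)) * (rowMatrix w)ᵀ := by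
  ext i j
  simp only [Matrix.gram_apply, Matrix.mul_apply, rowMatrix, Matrix.transpose_apply,
    Matrix.of_apply]
  rw [linearMap_apply_eq_sum D (w i), linearMap_apply_eq_sum D (w j)]
  simp only [sum_inner, inner_sum, real_inner_smul_left, real_inner_smul_right, Finset.sum_mul]
  refine Finset.sum_congr rfl fun a _ => Finset.sum_congr rfl fun b _ => ?_
  ring

/-- The trace of a bilinear map with respect to the metric pulled back by `D` does not depend on
the basis used to compute it. -/
lemma trace_change (D : E n →ₗ[ℝ] V) (Q : E n →ₗ[ℝ] E n →ₗ[ℝ] W) {w : Fin n → E n}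
    (hw : LinearIndependent ℝ w) :
    ∑ p, ∑ q, (Matrix.gram ℝ fun i => D (w i))⁻¹ p q • Q (w p) (w q) =
      ∑ i, ∑ j, (Matrix.gram ℝ fun i => D (EuclideanSpace.single i 1))⁻¹ i j •
        Q (EuclideanSpace.single i 1) (EuclideanSpace.single j 1) := by
  set A := rowMatrix w with hA
  set g := Matrix.gram ℝ fun i => D (EuclideanSpace.single i 1)
  have hAu : IsUnit A.det := (det_rowMatrix_ne_zero hw).isUnit
  have hAtu : IsUnit Aᵀ.det := by rwa [Matrix.det_transpose]
  have e : Aᵀ * (Matrix.gram ℝ fun i => D (w i))⁻¹ * A = g⁻¹ := by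
    rw [gram_map, Matrix.mul_inv_rev, Matrix.mul_inv_rev, ← Matrix.mul_assoc,
      Matrix.mul_nonsing_inv _ hAtu, Matrix.one_mul, Matrix.mul_assoc, Matrix.nonsing_inv_mul _ hAu,
      Matrix.mul_one]
  rw [← e]
  have hQ : ∀ p q, Q (w p) (w q) = ∑ i, ∑ j, (A p i * A q j) •
      Q (EuclideanSpace.single i 1) (EuclideanSpace.single j 1) := by
    intro p q
    rw [linearMap_apply_eq_sum Q (w p), LinearMap.sum_apply]
    refine Finset.sum_congr rfl fun i _ => ?_
    rw [LinearMap.smul_apply, linearMap_apply_eq_sum (Q _) (w q), Finset.smul_sum]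
    refine Finset.sum_congr rfl fun j _ => ?_
    rw [smul_smul]
    rfl
  simp only [hQ, Finset.smul_sum, Matrix.mul_apply, Finset.sum_mul, Finset.sum_smul, smul_smul,
    Matrix.transpose_apply]
  have comm4 : ∀ f : Fin n → Fin n → Fin n → Fin n → W,
      ∑ p, ∑ q, ∑ i, ∑ j, f p q i j = ∑ i, ∑ j, ∑ q, ∑ p, f p q i j := by
    intro f
    rw [Finset.sum_comm]
    calc ∑ q, ∑ p, ∑ i, ∑ j, f p q i j = ∑ q, ∑ i, ∑ p, ∑ j, f p q i j :=
          Finset.sum_congr rfl fun q _ => Finset.sum_comm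
      _ = ∑ i, ∑ q, ∑ p, ∑ j, f p q i j := Finset.sum_comm
      _ = ∑ i, ∑ q, ∑ j, ∑ p, f p q i j :=
          Finset.sum_congr rfl fun i _ => Finset.sum_congr rfl fun q _ => Finset.sum_comm
      _ = _ := Finset.sum_congr rfl fun i _ => Finset.sum_comm
  rw [comm4]
  refine Finset.sum_congr rfl fun i _ => Finset.sum_congr rfl fun j _ =>
    Finset.sum_congr rfl fun q _ => Finset.sum_congr rfl fun p _ => ?_
  congr 1; ring

end Traces

section Slices

variable {n : ℕ} {W : Type*} [NormedAddCommGroup W] [NormedSpace ℝ W]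

/-- A space-time domain `I × U`, with `I` an interval, possibly with end points, and `U` open. -/
structure IsSpaceTime (I : Set ℝ) (U : Set (E n)) : Prop where
  convex_time : Convex ℝ I
  interior_time : (interior I).Nonempty
  isOpen_space : IsOpen U
  convex_space : Convex ℝ U
  nonempty_space : U.Nonempty

variable {I : Set ℝ} {U : Set (E n)} {f : ℝ × E n → W} {t : ℝ} {y : E n}

lemma IsSpaceTime.isCalcDomain (h : IsSpaceTime I U) : IsCalcDomain (I ×ˢ U) := by
  have hc : Convex ℝ (I ×ˢ U) := h.convex_time.prod h.convex_space
  have hi : (interior (I ×ˢ U)).Nonempty := by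
    rw [interior_prod_eq, h.isOpen_space.interior_eq]
    exact h.interior_time.prod h.nonempty_space
  refine ⟨uniqueDiffOn_convex hc hi, ?_⟩
  rw [hc.closure_interior_eq_closure_of_nonempty_interior hi]
  exact subset_closure

/-- A purely spatial direction in space-time. -/
def spaceDir (v : E n) : ℝ × E n := (0, v)

/-- The time direction in space-time. -/
def timeDir : ℝ × E n := (1, 0)

/-- As `U` is open, the restriction to a time slice is differentiable in the full sense, even at an
end point of the time interval. -/
lemma IsSpaceTime.hasFDerivAt_slice (h : IsSpaceTime I U) (hf : ContDiffOn ℝ ∞ f (I ×ˢ U))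
    (ht : t ∈ I) (hy : y ∈ U) :
    HasFDerivAt (fun y' => f (t, y'))
      ((fderivWithin ℝ f (I ×ˢ U) (t, y)).comp (ContinuousLinearMap.inr ℝ ℝ (E n))) y := by
  have h1 := (diffWithinAt_of_contDiffOn hf (mk_mem_prod ht hy)).hasFDerivWithinAt
  have h2 : HasFDerivWithinAt (fun y' : E n => (t, y')) (ContinuousLinearMap.inr ℝ ℝ (E n)) U y :=
    (hasFDerivAt_prodMk_right t y).hasFDerivWithinAt
  exact (h1.comp y h2 fun y' hy' => mk_mem_prod ht hy').hasFDerivAt (h.isOpen_space.mem_nhds hy)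

lemma IsSpaceTime.fderiv_slice (h : IsSpaceTime I U) (hf : ContDiffOn ℝ ∞ f (I ×ˢ U))
    (ht : t ∈ I) (hy : y ∈ U) (v : E n) :
    fderiv ℝ (fun y' => f (t, y')) y v = dirDeriv (I ×ˢ U) (spaceDir v) f (t, y) := by
  rw [(h.hasFDerivAt_slice hf ht hy).fderiv]
  rfl

lemma IsSpaceTime.fderiv_fderiv_slice (h : IsSpaceTime I U) (hf : ContDiffOn ℝ ∞ f (I ×ˢ U))
    (ht : t ∈ I) (hy : y ∈ U) (v w : E n) :
    fderiv ℝ (fun y' => fderiv ℝ (fun y'' => f (t, y'')) y') y v w =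
      dirDeriv (I ×ˢ U) (spaceDir v) (dirDeriv (I ×ˢ U) (spaceDir w) f) (t, y) := by
  have hD := h.isCalcDomain
  have hf' := hf.fderivWithin hD.uniqueDiff (m := ∞) (by simp)
  have e : (fun y' => fderiv ℝ (fun y'' => f (t, y'')) y') =ᶠ[𝓝 y] fun y' =>
      (fderivWithin ℝ f (I ×ˢ U) (t, y')).comp (ContinuousLinearMap.inr ℝ ℝ (E n)) := by
    filter_upwards [h.isOpen_space.mem_nhds hy] with y' hy'
    exact (h.hasFDerivAt_slice hf ht hy').fderiv
  rw [e.fderiv_eq, dirDeriv_dirDeriv hD hf (mk_mem_prod ht hy),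
    ((h.hasFDerivAt_slice hf' ht hy).clm_comp (hasFDerivAt_const _ _)).fderiv]
  simp [spaceDir]

lemma IsSpaceTime.contDiffOn_slice (h : ContDiffOn ℝ ∞ f (I ×ˢ U)) (ht : t ∈ I) :
    ContDiffOn ℝ ∞ (fun y' => f (t, y')) U :=
  h.comp (contDiff_prodMk_right t).contDiffOn fun _ hy' => mk_mem_prod ht hy'

lemma IsSpaceTime.derivWithin_slice {I₀ : Set ℝ} (hf : ContDiffOn ℝ ∞ f (I ×ˢ U))
    (hI : I ∈ 𝓝[I₀] t) (hu : UniqueDiffWithinAt ℝ I₀ t) (ht : t ∈ I) (hy : y ∈ U) :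
    derivWithin (fun s => f (s, y)) I₀ t = dirDeriv (I ×ˢ U) timeDir f (t, y) := by
  have h1 := (diffWithinAt_of_contDiffOn hf (mk_mem_prod ht hy)).hasFDerivWithinAt
  have h2 : HasDerivWithinAt (fun s : ℝ => (s, y)) (1, 0) I t :=
    (hasDerivWithinAt_id t I).prodMk (hasDerivWithinAt_const t I y)
  have h3 := h1.comp_hasDerivWithinAt t h2 fun s hs => mk_mem_prod hs hy
  exact (h3.mono_of_mem_nhdsWithin hI).derivWithin hu

end Slices

/-! ### Coordinate expressions in charts -/

section FlatModel

variable {n : ℕ}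
  {M : Type*} [TopologicalSpace M] [ChartedSpace (E (2 * n)) M]
  [IsManifold 𝓘(ℝ, E (2 * n)) ∞ M]

lemma mdifferentiable_of_mem_maximalAtlas {m : ℕ} {M : Type*} [TopologicalSpace M]
    [ChartedSpace (E m) M] [IsManifold 𝓘(ℝ, E m) ∞ M] {φ : OpenPartialHomeomorph M (E m)}
    (hφ : φ ∈ IsManifold.maximalAtlas 𝓘(ℝ, E m) ∞ M) :
    φ.MDifferentiable 𝓘(ℝ, E m) 𝓘(ℝ, E m) :=
  ⟨(contMDiffOn_of_mem_maximalAtlas hφ).mdifferentiableOn (by simp),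
    (contMDiffOn_symm_of_mem_maximalAtlas hφ).mdifferentiableOn (by simp)⟩

/-- A flat chart `φ` in which the parallel fields `π₁` and `J` have constant matrices `B` and `J`
over the open set `N`. -/
structure FlatModel (S : FlatKahlerSplitting n M) (φ : OpenPartialHomeomorph M (E (2 * n)))
    (B J : E (2 * n) →L[ℝ] E (2 * n)) (N : Set M) : Prop where
  flat : IsFlatChart S.g φ
  isOpen : IsOpen N
  subset : N ⊆ φ.source
  map_pr₁ : ∀ q ∈ N, ∀ v : TangentSpace 𝓘(ℝ, E (2 * n)) q,
    chartDeriv φ q (S.pr₁ q v) = B (chartDeriv φ q v)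
  map_J : ∀ q ∈ N, ∀ v : TangentSpace 𝓘(ℝ, E (2 * n)) q,
    chartDeriv φ q (S.J q v) = J (chartDeriv φ q v)

variable {S : FlatKahlerSplitting n M} {φ : OpenPartialHomeomorph M (E (2 * n))}
  {B J : E (2 * n) →L[ℝ] E (2 * n)} {N : Set M} {q : M}

lemma exists_flatModel (hφ : IsFlatChart S.g φ) (hq : q ∈ φ.source) :
    ∃ B J N, q ∈ N ∧ FlatModel S φ B J N := by
  obtain ⟨B, hB⟩ := S.pr₁_parallel φ hφ q hq
  obtain ⟨J, hJ⟩ := S.J_parallel φ hφ q hq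
  obtain ⟨N, hN, hNo, hqN⟩ := eventually_nhds_iff.1
    ((hB.and hJ).and (φ.open_source.mem_nhds hq))
  exact ⟨B, J, N, hqN, hφ, hNo, fun p hp => (hN p hp).2, fun p hp => (hN p hp).1.1,
    fun p hp => (hN p hp).1.2⟩

lemma FlatKahlerSplitting.J_skew (S : FlatKahlerSplitting n M) (q : M)
    (v w : TangentSpace 𝓘(ℝ, E (2 * n)) q) :
    S.g.inner q (S.J q v) w = - S.g.inner q v (S.J q w) := by
  have h := S.J_isometry q v (S.J q w)
  rw [S.J_J, map_neg] at h
  linarith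

lemma FlatKahlerSplitting.range_pr₁_isotropic (S : FlatKahlerSplitting n M) (q : M)
    (v w : TangentSpace 𝓘(ℝ, E (2 * n)) q) :
    S.g.inner q (S.J q (S.pr₁ q v)) (S.pr₁ q w) = 0 := by
  have h : ∀ v, S.pr₂ q (S.pr₁ q v) = 0 := by
    intro v
    have h1 := S.pr₁_add_pr₂ q (S.pr₁ q v)
    rw [S.pr₁_idem] at h1
    exact add_eq_left.1 h1
  exact S.ker_pr₂_isotropic q _ _ (h v) (h w)

/-- `π₁ J π₁ = 0`, as the image of `π₁` is Lagrangian. -/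
lemma FlatKahlerSplitting.pr₁_J_pr₁ (S : FlatKahlerSplitting n M) (q : M)
    (v : TangentSpace 𝓘(ℝ, E (2 * n)) q) : S.pr₁ q (S.J q (S.pr₁ q v)) = 0 := by
  by_contra hne
  have := S.g.pos q _ hne
  rw [S.pr₁_symm, S.pr₁_idem, S.range_pr₁_isotropic] at this
  exact lt_irrefl _ this

namespace FlatModel
variable (h : FlatModel S φ B J N)
include h

lemma bijective (hq : q ∈ N) : Function.Bijective (chartDeriv φ q) :=
  (mdifferentiable_of_mem_maximalAtlas h.flat.smooth).mfderiv_bijective (h.subset hq)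

lemma inner_eq (hq : q ∈ N) (v w : TangentSpace 𝓘(ℝ, E (2 * n)) q) :
    S.g.inner q v w = inner ℝ (chartDeriv φ q v) (chartDeriv φ q w) :=
  (h.flat.isometry q (h.subset hq) v w).symm

lemma proj_symm (hq : q ∈ N) (v w : E (2 * n)) : inner ℝ (B v) w = inner ℝ v (B w) := by
  obtain ⟨v, rfl⟩ := (h.bijective hq).2 v
  obtain ⟨w, rfl⟩ := (h.bijective hq).2 w
  rw [← h.map_pr₁ q hq, ← h.map_pr₁ q hq, ← h.inner_eq hq, ← h.inner_eq hq, S.pr₁_symm]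

lemma proj_idem (hq : q ∈ N) (v : E (2 * n)) : B (B v) = B v := by
  obtain ⟨v, rfl⟩ := (h.bijective hq).2 v
  rw [← h.map_pr₁ q hq, ← h.map_pr₁ q hq, S.pr₁_idem]

lemma skew (hq : q ∈ N) (v w : E (2 * n)) : inner ℝ (J v) w = - inner ℝ v (J w) := by
  obtain ⟨v, rfl⟩ := (h.bijective hq).2 v
  obtain ⟨w, rfl⟩ := (h.bijective hq).2 w
  rw [← h.map_J q hq, ← h.map_J q hq, ← h.inner_eq hq, ← h.inner_eq hq, S.J_skew]

lemma J_J (hq : q ∈ N) (v : E (2 * n)) : J (J v) = -v := by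
  obtain ⟨v, rfl⟩ := (h.bijective hq).2 v
  rw [← h.map_J q hq, ← h.map_J q hq, S.J_J, map_neg]

lemma proj_J_proj (hq : q ∈ N) (v : E (2 * n)) : B (J (B v)) = 0 := by
  obtain ⟨v, rfl⟩ := (h.bijective hq).2 v
  rw [← h.map_pr₁ q hq, ← h.map_J q hq, ← h.map_pr₁ q hq, S.pr₁_J_pr₁, map_zero]

end FlatModel

end FlatModel

section Rep

variable {n : ℕ}
  {M : Type*} [TopologicalSpace M] [ChartedSpace (E (2 * n)) M]
  [IsManifold 𝓘(ℝ, E (2 * n)) ∞ M]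
  {L : Type*} [TopologicalSpace L] [ChartedSpace (E n) L]

/-- The coordinate expression of `G : L → M` in the preferred chart at `x₀` and the chart `φ`. -/
def rep (φ : OpenPartialHomeomorph M (E (2 * n))) (G : L → M) (x₀ : L) (y : E n) : E (2 * n) :=
  φ (G ((chartAt (E n) x₀).symm y))

/-- The vector field on `L` which is the constant `v` in the preferred chart at `x₀`. -/
def coordField (x₀ : L) (y : E n) :
    E n →L[ℝ] TangentSpace 𝓘(ℝ, E n) ((chartAt (E n) x₀).symm y) :=
  mfderiv 𝓘(ℝ, E n) 𝓘(ℝ, E n) (chartAt (E n) x₀).symm y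

variable {S : FlatKahlerSplitting n M} {φ : OpenPartialHomeomorph M (E (2 * n))}
  {B J : E (2 * n) →L[ℝ] E (2 * n)} {N : Set M} {G : L → M} {x₀ : L} {y : E n}

/-- In the preferred chart at `x`, the coordinate vector fields at `x` itself are `coordVec`. -/
lemma fderiv_rep_self (hφ : IsFlatChart S.g φ) (hG : ContMDiff 𝓘(ℝ, E n) 𝓘(ℝ, E (2 * n)) ∞ G)
    (x : L) (hGx : G x ∈ φ.source) (v : TangentSpace 𝓘(ℝ, E n) x) :
    fderiv ℝ (rep φ G x) (chartAt (E n) x x) v = chartDeriv φ (G x) (dF G x v) := by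
  have h2 := ((contMDiffOn_of_mem_maximalAtlas hφ.smooth).contMDiffAt
    (φ.open_source.mem_nhds hGx)).mdifferentiableAt (n := ∞) (by simp)
  have h3 := (hG x).mdifferentiableAt (n := ∞) (by simp)
  have e := mfderiv_comp x h2 h3
  rw [(h2.comp x h3).mfderiv] at e
  have e2 := DFunLike.congr_fun e v
  simp only [mfld_simps, fderivWithin_univ] at e2
  exact e2

/-- The differential of `G` at `x` read in the chart `φ`. -/
def tangentMap (φ : OpenPartialHomeomorph M (E (2 * n))) (G : L → M) (x : L) :
    E n →ₗ[ℝ] E (2 * n) :=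
  ((chartDeriv φ (G x)).comp (dF (n := n) G x)).toLinearMap

lemma gram_eq_gram_tangentMap (hφ : IsFlatChart S.g φ) {x : L} (hGx : G x ∈ φ.source) :
    gram S G x = Matrix.gram ℝ fun i => tangentMap φ G x (EuclideanSpace.single i 1) := by
  ext i j
  exact (hφ.isometry _ hGx _ _).symm

lemma gramPr_eq_gram_tangentMap (h : FlatModel S φ B J N) {x : L} (hGx : G x ∈ N) :
    gramPr S G x = Matrix.gram ℝ fun i => B (tangentMap φ G x (EuclideanSpace.single i 1)) := by
  ext i j
  have := (h.flat.isometry _ (h.subset hGx) (S.pr₁ _ (dF G x (coordVec x i)))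
    (S.pr₁ _ (dF G x (coordVec x j)))).symm
  rw [h.map_pr₁ _ hGx, h.map_pr₁ _ hGx] at this
  exact this

/-- `*Ω` can be computed in any basis of the tangent space. -/
lemma starOmega_eq_frame (h : FlatModel S φ B J N) {x : L} (hGx : G x ∈ N)
    {w : Fin n → E n} (hw : LinearIndependent ℝ w) :
    starOmega S G x = √(Matrix.gram ℝ fun i => B (tangentMap φ G x (w i))).det /
      √(Matrix.gram ℝ fun i => tangentMap φ G x (w i)).det := by
  have hA := det_rowMatrix_ne_zero hw
  have e : ∀ D : E n →ₗ[ℝ] E (2 * n), √(Matrix.gram ℝ fun i => D (w i)).det =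
      |(rowMatrix w).det| * √(Matrix.gram ℝ fun i => D (EuclideanSpace.single i 1)).det := by
    intro D
    rw [gram_map, Matrix.det_mul, Matrix.det_mul, Matrix.det_transpose, mul_right_comm, ← sq,
      Real.sqrt_mul (sq_nonneg _), Real.sqrt_sq_eq_abs]
  have e1 := e (tangentMap φ G x)
  have e2 := e (B.toLinearMap ∘ₗ tangentMap φ G x)
  simp only [LinearMap.comp_apply, ContinuousLinearMap.coe_coe] at e2
  rw [e1, e2, starOmega, gram_eq_gram_tangentMap h.flat (h.subset hGx),
    gramPr_eq_gram_tangentMap h hGx, mul_div_mul_left _ _ (abs_pos.2 hA).ne']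

/-- Transformation of the second derivative under a change of coordinates. -/
lemma fderiv_fderiv_comp {W : Type*} [NormedAddCommGroup W] [NormedSpace ℝ W] {m : ℕ}
    {f : E m → W} {τ : E m → E m} {z : E m} (hf : ContDiffAt ℝ ∞ f (τ z)) (hτ : ContDiffAt ℝ ∞ τ z)
    (a b : E m) :
    fderiv ℝ (fun y => fderiv ℝ (f ∘ τ) y) z a b =
      fderiv ℝ (fun y => fderiv ℝ f y) (τ z) (fderiv ℝ τ z a) (fderiv ℝ τ z b) +
      fderiv ℝ f (τ z) (fderiv ℝ (fun y => fderiv ℝ τ y) z a b) := by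
  have hf1 : ∀ᶠ y in 𝓝 (τ z), ContDiffAt ℝ 1 f y :=
    (hf.of_le (mod_cast le_top)).eventually (by simp)
  have hτ1 : ∀ᶠ y in 𝓝 z, ContDiffAt ℝ 1 τ y :=
    (hτ.of_le (mod_cast le_top)).eventually (by simp)
  have e : (fun y => fderiv ℝ (f ∘ τ) y) =ᶠ[𝓝 z]
      fun y => (fderiv ℝ f (τ y)).comp (fderiv ℝ τ y) := by
    filter_upwards [hτ.continuousAt.eventually hf1, hτ1] with y hy1 hy2
    exact fderiv_comp y (hy1.differentiableAt (by simp)) (hy2.differentiableAt (by simp))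
  have d1 : HasFDerivAt (fun y => fderiv ℝ f y) (fderiv ℝ (fun y => fderiv ℝ f y) (τ z)) (τ z) :=
    ((hf.fderiv_right (m := ∞) (by simp)).differentiableAt (by simp)).hasFDerivAt
  have d2 : HasFDerivAt (fun y => fderiv ℝ τ y) (fderiv ℝ (fun y => fderiv ℝ τ y) z) z :=
    ((hτ.fderiv_right (m := ∞) (by simp)).differentiableAt (by simp)).hasFDerivAt
  have d3 : HasFDerivAt τ (fderiv ℝ τ z) z := (hτ.differentiableAt (by simp)).hasFDerivAt
  have d4 : HasFDerivAt (fun y => fderiv ℝ f (τ y))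
      ((fderiv ℝ (fun y => fderiv ℝ f y) (τ z)).comp (fderiv ℝ τ z)) z := d1.comp z d3
  rw [e.fderiv_eq, (d4.clm_comp d2).fderiv]
  simp [add_comm]

variable [IsManifold 𝓘(ℝ, E n) ∞ L]

lemma coordField_bijective (hy : y ∈ (chartAt (E n) x₀).target) :
    Function.Bijective (coordField (L := L) x₀ y) :=
  (mdifferentiable_of_mem_maximalAtlas (m := n) (M := L)
    (IsManifold.chart_mem_maximalAtlas x₀)).symm.mfderiv_bijective hy

lemma contDiffAt_rep (hφ : IsFlatChart S.g φ) (hG : ContMDiff 𝓘(ℝ, E n) 𝓘(ℝ, E (2 * n)) ∞ G)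
    (hy : y ∈ (chartAt (E n) x₀).target) (hGy : G ((chartAt (E n) x₀).symm y) ∈ φ.source) :
    ContDiffAt ℝ ∞ (rep φ G x₀) y := by
  rw [← contMDiffAt_iff_contDiffAt]
  have h1 : ContMDiffAt 𝓘(ℝ, E n) 𝓘(ℝ, E n) ∞ (chartAt (E n) x₀).symm y :=
    contMDiffOn_chart_symm.contMDiffAt ((chartAt (E n) x₀).open_target.mem_nhds hy)
  have h2 := (contMDiffOn_of_mem_maximalAtlas hφ.smooth).contMDiffAt (φ.open_source.mem_nhds hGy)
  exact h2.comp y ((hG _).comp y h1)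

lemma fderiv_rep (hφ : IsFlatChart S.g φ) (hG : ContMDiff 𝓘(ℝ, E n) 𝓘(ℝ, E (2 * n)) ∞ G)
    (hy : y ∈ (chartAt (E n) x₀).target) (hGy : G ((chartAt (E n) x₀).symm y) ∈ φ.source)
    (v : E n) :
    fderiv ℝ (rep φ G x₀) y v =
      chartDeriv φ (G ((chartAt (E n) x₀).symm y)) (dF G _ (coordField x₀ y v)) := by
  have h1 : MDifferentiableAt 𝓘(ℝ, E n) 𝓘(ℝ, E n) (chartAt (E n) x₀).symm y :=
    (contMDiffOn_chart_symm (n := ∞).contMDiffAt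
      ((chartAt (E n) x₀).open_target.mem_nhds hy)).mdifferentiableAt (by simp)
  have h2 := ((contMDiffOn_of_mem_maximalAtlas hφ.smooth).contMDiffAt
    (φ.open_source.mem_nhds hGy)).mdifferentiableAt (by simp)
  have h3 := (hG ((chartAt (E n) x₀).symm y)).mdifferentiableAt (by simp)
  rw [← mfderiv_eq_fderiv]
  have e : rep φ G x₀ = φ ∘ (G ∘ (chartAt (E n) x₀).symm) := rfl
  rw [e, mfderiv_comp y h2 (h3.comp y h1), mfderiv_comp y h3 h1]
  rfl

/-- The mean curvature vector can be computed in any chart and any basis. -/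
lemma meanCurvature_eq_frame (hφ : IsFlatChart S.g φ)
    (hG : ContMDiff 𝓘(ℝ, E n) 𝓘(ℝ, E (2 * n)) ∞ G)
    (hy : y ∈ (chartAt (E n) x₀).target) (hGy : G ((chartAt (E n) x₀).symm y) ∈ φ.source)
    (him : Function.Injective (dF (n := n) G ((chartAt (E n) x₀).symm y)))
    {e : Fin n → E n} (he : LinearIndependent ℝ e) {H : E (2 * n)}
    (hH : H = ∑ p, ∑ q, (Matrix.gram ℝ fun i => fderiv ℝ (rep φ G x₀) y (e i))⁻¹ p q •
      fderiv ℝ (fun y => fderiv ℝ (rep φ G x₀) y) y (e p) (e q)) :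
    meanCurvature S φ G ((chartAt (E n) x₀).symm y) =
      H - ∑ l, inner ℝ (dualFrame (fun i => fderiv ℝ (rep φ G x₀) y (e i)) l) H •
        fderiv ℝ (rep φ G x₀) y (e l) := by
  set x := (chartAt (E n) x₀).symm y with hx
  set z := chartAt (E n) x x with hz
  set D := fderiv ℝ (rep φ G x₀) y with hD
  set τ : E n → E n := fun z => chartAt (E n) x₀ ((chartAt (E n) x).symm z) with hτ
  have hxs : x ∈ (chartAt (E n) x₀).source := (chartAt (E n) x₀).map_target hy
  have hzt : z ∈ (chartAt (E n) x).target := mem_chart_target (E n) x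
  have hzx : (chartAt (E n) x).symm z = x := (chartAt (E n) x).left_inv (mem_chart_source _ x)
  have hτz : τ z = y := by
    simp only [hτ, hzx]
    exact (chartAt (E n) x₀).right_inv hy
  have cτ : ContDiffAt ℝ ∞ τ z := by
    rw [← contMDiffAt_iff_contDiffAt]
    have h1 : ContMDiffAt 𝓘(ℝ, E n) 𝓘(ℝ, E n) ∞ (chartAt (E n) x).symm z :=
      contMDiffOn_chart_symm.contMDiffAt ((chartAt (E n) x).open_target.mem_nhds hzt)
    have h2 : ContMDiffAt 𝓘(ℝ, E n) 𝓘(ℝ, E n) ∞ (chartAt (E n) x₀) ((chartAt (E n) x).symm z) := by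
      rw [hzx]
      exact contMDiffOn_chart.contMDiffAt ((chartAt (E n) x₀).open_source.mem_nhds hxs)
    exact h2.comp z h1
  have cf : ContDiffAt ℝ ∞ (rep φ G x₀) (τ z) := by
    rw [hτz]; exact contDiffAt_rep hφ hG hy hGy
  have erep : rep φ G x =ᶠ[𝓝 z] rep φ G x₀ ∘ τ := by
    have h1 : ∀ᶠ z' in 𝓝 z, (chartAt (E n) x).symm z' ∈ (chartAt (E n) x₀).source := by
      refine ((chartAt (E n) x).continuousAt_symm hzt).eventually ?_
      rw [hzx]
      exact (chartAt (E n) x₀).open_source.mem_nhds hxs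
    filter_upwards [h1] with z' hz'
    simp only [rep, hτ, Function.comp_apply]
    rw [(chartAt (E n) x₀).left_inv hz']
  have eD : ∀ v : E n, tangentMap φ G x v = D (fderiv ℝ τ z v) := by
    intro v
    have h1 := fderiv_rep_self hφ hG x hGy v
    rw [← hz, erep.fderiv_eq, fderiv_comp z (cf.differentiableAt (by simp))
      (cτ.differentiableAt (by simp)), hτz] at h1
    exact h1.symm
  have eD2 : ∀ v : E n, D v = tangentMap φ G x (coordField x₀ y v) :=
    fun v => fderiv_rep hφ hG hy hGy v
  have hDinj : Function.Injective D := by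
    intro a b hab
    rw [eD2, eD2] at hab
    have hinj := (mdifferentiable_of_mem_maximalAtlas hφ.smooth).mfderiv_injective hGy
    exact (coordField_bijective hy).1 (him (hinj hab))
  have hTinj : Function.Injective (tangentMap φ G x) := by
    intro a b hab
    have hinj := (mdifferentiable_of_mem_maximalAtlas hφ.smooth).mfderiv_injective hGy
    exact him (hinj hab)
  have hwli : LinearIndependent ℝ fun i => fderiv ℝ τ z (EuclideanSpace.single i (1 : ℝ)) := by
    refine LinearIndependent.of_comp D.toLinearMap ?_
    have h1 : (D.toLinearMap ∘ fun i => fderiv ℝ τ z (EuclideanSpace.single i (1 : ℝ))) =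
        fun i => tangentMap φ G x (EuclideanSpace.single i (1 : ℝ)) := by
      funext i; exact (eD _).symm
    rw [h1]
    exact linearIndependent_single.map' (tangentMap φ G x) (LinearMap.ker_eq_bot.2 hTinj)
  -- the range of the differential is spanned by the frame
  set R := LinearMap.range ((chartDeriv φ (G x)).comp (dF (n := n) G x)).toLinearMap with hR
  have hRspan : R = Submodule.span ℝ (range fun i => D (e i)) := by
    have hspan : Submodule.span ℝ (range e) = ⊤ :=
      he.span_eq_top_of_card_eq_finrank' (by simp)
    have h1 : (range fun i => D (e i)) = D.toLinearMap '' range e := by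
      rw [← range_comp]; rfl
    rw [h1, Submodule.span_image, hspan, Submodule.map_top]
    ext v
    constructor
    · rintro ⟨a, rfl⟩
      exact ⟨fderiv ℝ τ z a, (eD a).symm⟩
    · rintro ⟨a, rfl⟩
      exact ⟨coordField x₀ y a, (eD2 a).symm⟩
  have hDe : LinearIndependent ℝ fun i => D (e i) :=
    he.map' D.toLinearMap (LinearMap.ker_eq_bot.2 hDinj)
  rw [← starProjection_orthogonal_span hDe R hRspan]
  change Rᗮ.starProjection (∑ i, ∑ j, (gram S G x)⁻¹ i j •
    secondDeriv φ G x (coordVec x i) (coordVec x j)) = _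
  set Q : E n →ₗ[ℝ] E n →ₗ[ℝ] E (2 * n) := LinearMap.mk₂ ℝ
    (fun a b => fderiv ℝ (fun y => fderiv ℝ (rep φ G x₀) y) y a b)
    (by simp) (by simp) (by simp) (by simp) with hQ
  have hHQ : H = ∑ i, ∑ j, (gram S G x)⁻¹ i j •
      Q (fderiv ℝ τ z (EuclideanSpace.single i (1 : ℝ)))
        (fderiv ℝ τ z (EuclideanSpace.single j (1 : ℝ))) := by
    have h1 := trace_change D.toLinearMap Q he
    have h2 := trace_change D.toLinearMap Q hwli
    rw [gram_eq_gram_tangentMap hφ hGy]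
    simp only [eD]
    exact (hH.trans h1).trans h2.symm
  have hsec : ∀ a b : E n, secondDeriv φ G x a b =
      Q (fderiv ℝ τ z a) (fderiv ℝ τ z b) + D (fderiv ℝ (fun y => fderiv ℝ τ y) z a b) := by
    intro a b
    have h1 : secondDeriv φ G x a b = fderiv ℝ (fun y => fderiv ℝ (rep φ G x) y) z a b := rfl
    have h2 := fderiv_fderiv_comp cf cτ a b
    rw [hτz] at h2
    rw [h1, erep.fderiv.fderiv_eq]
    exact h2
  have hkill : ∀ v, Rᗮ.starProjection (D v) = 0 := by
    intro v
    rw [Submodule.starProjection_apply_eq_zero_iff]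
    exact R.le_orthogonal_orthogonal ⟨coordField x₀ y v, (eD2 v).symm⟩
  rw [hHQ]
  simp only [map_sum, map_smul]
  refine Finset.sum_congr rfl fun i _ => Finset.sum_congr rfl fun j _ => ?_
  congr 1
  have := hsec (coordVec x i) (coordVec x j)
  rw [this, map_add, hkill, add_zero]
  rfl

end Rep

/-! ### The Laplace-Beltrami operator and the time interval -/

section LaplacianFrame

variable {n : ℕ}
  {M : Type*} [TopologicalSpace M] [ChartedSpace (E (2 * n)) M]
  [IsManifold 𝓘(ℝ, E (2 * n)) ∞ M]
  {L : Type*} [TopologicalSpace L] [ChartedSpace (E n) L] [IsManifold 𝓘(ℝ, E n) ∞ L]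
  {S : FlatKahlerSplitting n M} {φ : OpenPartialHomeomorph M (E (2 * n))} {G : L → M}

lemma pd_pd {f : E n → ℝ} {y : E n} (hf : ContDiffAt ℝ ∞ f y) (i j : Fin n) :
    pd i (pd j f) y = fderiv ℝ (fun y => fderiv ℝ f y) y (EuclideanSpace.single i 1)
      (EuclideanSpace.single j 1) := by
  have d : DifferentiableAt ℝ (fun y => fderiv ℝ f y) y :=
    (hf.fderiv_right (m := ∞) (by simp)).differentiableAt (by simp)
  unfold pd
  rw [fderiv_clm_apply d (differentiableAt_const _)]
  simp

lemma metricCoeff_eventuallyEq (hφ : IsFlatChart S.g φ)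
    (hG : ContMDiff 𝓘(ℝ, E n) 𝓘(ℝ, E (2 * n)) ∞ G) {x : L} (hGx : G x ∈ φ.source) :
    metricCoeff (inducedMetric S G) x =ᶠ[𝓝 (chartAt (E n) x x)] fun y =>
      Matrix.gram ℝ fun i => fderiv ℝ (rep φ G x) y (EuclideanSpace.single i 1) := by
  have hzt := mem_chart_target (E n) x
  have hzx : (chartAt (E n) x).symm (chartAt (E n) x x) = x :=
    (chartAt (E n) x).left_inv (mem_chart_source _ x)
  have h1 : ∀ᶠ y in 𝓝 (chartAt (E n) x x), G ((chartAt (E n) x).symm y) ∈ φ.source := by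
    refine (hG.continuous.continuousAt.comp ((chartAt (E n) x).continuousAt_symm hzt)).eventually ?_
    simp only [Function.comp_apply, hzx]
    exact φ.open_source.mem_nhds hGx
  filter_upwards [h1, (chartAt (E n) x).open_target.mem_nhds hzt] with y hy1 hy2
  ext i j
  simp only [Matrix.gram_apply, fderiv_rep hφ hG hy2 hy1]
  exact (hφ.isometry _ hy1 _ _).symm

/-- The Laplace-Beltrami operator in terms of an orthonormal basis of the tangent space: the trace
of the coordinate Hessian, corrected by the tangential part of the trace of the second derivative
of the immersion. -/
lemma laplacian_eq_frame (hφ : IsFlatChart S.g φ)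
    (hG : ContMDiff 𝓘(ℝ, E n) 𝓘(ℝ, E (2 * n)) ∞ G) {x : L} (hGx : G x ∈ φ.source)
    {e : Fin n → E n} (he : LinearIndependent ℝ e)
    (h1 : (Matrix.gram ℝ fun i => fderiv ℝ (rep φ G x) (chartAt (E n) x x) (e i)) = 1)
    {f : L → ℝ} {v : E n → ℝ} (hv : v =ᶠ[𝓝 (chartAt (E n) x x)] fun y => f ((chartAt (E n) x).symm y))
    (hvs : ContDiffAt ℝ ∞ v (chartAt (E n) x x)) :
    laplacian (inducedMetric S G) f x =
      ∑ p, fderiv ℝ (fun y => fderiv ℝ v y) (chartAt (E n) x x) (e p) (e p) -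
      ∑ q, inner ℝ (fderiv ℝ (rep φ G x) (chartAt (E n) x x) (e q))
        (∑ p, fderiv ℝ (fun y => fderiv ℝ (rep φ G x) y) (chartAt (E n) x x) (e p) (e p)) *
        fderiv ℝ v (chartAt (E n) x x) (e q) := by
  set y₀ := chartAt (E n) x x with hy₀
  set D := fderiv ℝ (rep φ G x) y₀ with hD
  set D2 := fderiv ℝ (fun y => fderiv ℝ (rep φ G x) y) y₀ with hD2
  have hzx : (chartAt (E n) x).symm y₀ = x := (chartAt (E n) x).left_inv (mem_chart_source _ x)
  have hrep : ContDiffAt ℝ ∞ (rep φ G x) y₀ :=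
    contDiffAt_rep hφ hG (mem_chart_target (E n) x) (by rw [hzx]; exact hGx)
  have hsymm : ∀ a b, D2 a b = D2 b a := fun a b =>
    (hrep.isSymmSndFDerivAt (by simpa using ENat.LEInfty.out)) a b
  have hmet := metricCoeff_eventuallyEq hφ hG hGx
  have hG0 : metricCoeff (inducedMetric S G) x y₀ =
      Matrix.gram ℝ fun i => D (EuclideanSpace.single i 1) := hmet.self_of_nhds
  have hpd : ∀ l i j, pd l (fun z => metricCoeff (inducedMetric S G) x z i j) y₀ =
      inner ℝ (D (EuclideanSpace.single i 1)) (D2 (EuclideanSpace.single l 1) (EuclideanSpace.single j 1)) +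
      inner ℝ (D2 (EuclideanSpace.single l 1) (EuclideanSpace.single i 1)) (D (EuclideanSpace.single j 1)) := by
    intro l i j
    have d : ∀ k : Fin n, HasFDerivAt
        (fun y => fderiv ℝ (rep φ G x) y (EuclideanSpace.single k (1 : ℝ)))
        (D2.flip (EuclideanSpace.single k (1 : ℝ))) y₀ := by
      intro k
      have d0 : HasFDerivAt (fun y => fderiv ℝ (rep φ G x) y) D2 y₀ :=
        ((hrep.fderiv_right (m := ∞) (by simp)).differentiableAt (by simp)).hasFDerivAt
      exact (d0.clm_apply (hasFDerivAt_const (EuclideanSpace.single k (1 : ℝ)) y₀)).congr_fderiv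
        (by ext; simp)
    have heq : (fun z => metricCoeff (inducedMetric S G) x z i j) =ᶠ[𝓝 y₀] fun y =>
        inner ℝ (fderiv ℝ (rep φ G x) y (EuclideanSpace.single i (1 : ℝ)))
          (fderiv ℝ (rep φ G x) y (EuclideanSpace.single j (1 : ℝ))) := by
      filter_upwards [hmet] with y hy
      rw [hy]; rfl
    unfold pd
    rw [heq.fderiv_eq, ((d i).inner ℝ (d j)).fderiv]
    simp
    rfl
  have hchr : ∀ k i j, christoffel (metricCoeff (inducedMetric S G) x) k i j y₀ =
      ∑ l, (Matrix.gram ℝ fun i => D (EuclideanSpace.single i 1))⁻¹ k l *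
        inner ℝ (D (EuclideanSpace.single l 1))
          (D2 (EuclideanSpace.single i 1) (EuclideanSpace.single j 1)) := by
    intro k i j
    unfold christoffel
    rw [Finset.mul_sum, hG0]
    refine Finset.sum_congr rfl fun l _ => ?_
    rw [hpd, hpd, hpd, hsymm (EuclideanSpace.single j 1) (EuclideanSpace.single l 1),
      hsymm (EuclideanSpace.single l 1) (EuclideanSpace.single i 1),
      hsymm (EuclideanSpace.single j 1) (EuclideanSpace.single i 1),
      real_inner_comm (D (EuclideanSpace.single j 1)),
      real_inner_comm (D (EuclideanSpace.single l 1)) (D2 (EuclideanSpace.single i 1) (EuclideanSpace.single j 1))]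
    ring
  -- the first order part is itself a trace
  have hfirst : ∀ X : E (2 * n), ∑ k, (∑ l, (Matrix.gram ℝ fun i => D (EuclideanSpace.single i 1))⁻¹ k l *
      inner ℝ (D (EuclideanSpace.single l 1)) X) * fderiv ℝ v y₀ (EuclideanSpace.single k 1) =
      ∑ q, inner ℝ (D (e q)) X * fderiv ℝ v y₀ (e q) := by
    intro X
    have := trace_change D.toLinearMap (LinearMap.mk₂ ℝ
      (fun a b => inner ℝ (D b) X * fderiv ℝ v y₀ a)
      (by intros; simp; ring) (by intros; simp; ring)
      (by intros; simp [inner_add_left]; ring) (by intros; simp [real_inner_smul_left]; ring)) he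
    simp only [LinearMap.mk₂_apply, ContinuousLinearMap.coe_coe, h1, inv_one, Matrix.one_apply,
      ite_smul, one_smul, zero_smul, Finset.sum_ite_eq, Finset.mem_univ, if_true] at this
    rw [this]
    refine Finset.sum_congr rfl fun k _ => ?_
    rw [Finset.sum_mul]
    refine Finset.sum_congr rfl fun l _ => ?_
    rw [smul_eq_mul]; ring
  have hvd : fderiv ℝ (fun y => f ((chartAt (E n) x).symm y)) =ᶠ[𝓝 y₀] fderiv ℝ v :=
    hv.symm.fderiv
  have hpp : ∀ i j, pd i (pd j fun y => f ((chartAt (E n) x).symm y)) y₀ =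
      fderiv ℝ (fun y => fderiv ℝ v y) y₀ (EuclideanSpace.single i 1) (EuclideanSpace.single j 1) := by
    intro i j
    rw [← pd_pd hvs]
    have hj : pd j (fun y => f ((chartAt (E n) x).symm y)) =ᶠ[𝓝 y₀] pd j v := by
      filter_upwards [hvd] with y hy
      unfold pd
      rw [hy]
    unfold pd at hj ⊢
    rw [hj.fderiv_eq]
  have hp : ∀ k, pd k (fun y => f ((chartAt (E n) x).symm y)) y₀ =
      fderiv ℝ v y₀ (EuclideanSpace.single k 1) := by
    intro k
    unfold pd
    rw [hvd.self_of_nhds]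
  have htrace := trace_change D.toLinearMap (LinearMap.mk₂ ℝ
    (fun a b => fderiv ℝ (fun y => fderiv ℝ v y) y₀ a b -
      ∑ q, inner ℝ (D (e q)) (D2 a b) * fderiv ℝ v y₀ (e q))
    (by intros; simp [inner_add_right, add_mul, Finset.sum_add_distrib]; ring)
    (by intros; simp [real_inner_smul_right, mul_sub, Finset.mul_sum, mul_assoc])
    (by intros; simp [inner_add_right, add_mul, Finset.sum_add_distrib]; ring)
    (by intros; simp [real_inner_smul_right, mul_sub, Finset.mul_sum, mul_assoc])) he
  simp only [LinearMap.mk₂_apply, ContinuousLinearMap.coe_coe, h1, inv_one, Matrix.one_apply,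
    ite_smul, one_smul, zero_smul, Finset.sum_ite_eq, Finset.mem_univ, if_true] at htrace
  have hlap : laplacian (inducedMetric S G) f x =
      ∑ i, ∑ j, (Matrix.gram ℝ fun i => D (EuclideanSpace.single i 1))⁻¹ i j •
        (fderiv ℝ (fun y => fderiv ℝ v y) y₀ (EuclideanSpace.single i 1) (EuclideanSpace.single j 1) -
          ∑ q, inner ℝ (D (e q)) (D2 (EuclideanSpace.single i 1) (EuclideanSpace.single j 1)) *
            fderiv ℝ v y₀ (e q)) := by
    unfold laplacian
    simp only [← hy₀, hG0, hpp, hp, hchr, hfirst, smul_eq_mul]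
  rw [hlap, ← htrace, Finset.sum_sub_distrib]
  congr 1
  rw [Finset.sum_comm]
  refine Finset.sum_congr rfl fun q _ => ?_
  rw [inner_sum, Finset.sum_mul]

end LaplacianFrame

section TimeInterval

variable {T : EReal} {t : ℝ}

lemma ordConnected_timeInterval : (timeInterval T).OrdConnected :=
  ⟨fun _ ha _ hb _ hc => ⟨ha.1.trans hc.1, lt_of_le_of_lt (EReal.coe_le_coe hc.2) hb.2⟩⟩

lemma exists_Ioo_subset_timeInterval (ht : t ∈ timeInterval T) {δ : ℝ} (hδ : 0 < δ) :
    ∃ s, t < s ∧ Ioo t s ⊆ timeInterval T ∩ Ioo (t - δ) (t + δ) := by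
  obtain ⟨r, hr1, hr2⟩ := EReal.lt_iff_exists_real_btwn.1 ht.2
  rw [EReal.coe_lt_coe_iff] at hr1
  refine ⟨min r (t + δ), lt_min hr1 (by linarith), fun s hs => ⟨⟨ht.1.trans hs.1.le, ?_⟩, ?_, ?_⟩⟩
  · exact lt_trans (EReal.coe_lt_coe (hs.2.trans_le (min_le_left _ _))) hr2
  · linarith [hs.1]
  · exact hs.2.trans_le (min_le_right _ _)

lemma uniqueDiffOn_timeInterval : UniqueDiffOn ℝ (timeInterval T) := by
  rcases (timeInterval T).eq_empty_or_nonempty with h | ⟨t, ht⟩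
  · rw [h]; exact uniqueDiffOn_empty
  · refine uniqueDiffOn_convex ordConnected_timeInterval.convex ?_
    obtain ⟨s, hs, hsub⟩ := exists_Ioo_subset_timeInterval ht one_pos
    exact (nonempty_Ioo.2 hs).mono
      (isOpen_Ioo.subset_interior_iff.2 (hsub.trans inter_subset_left))

end TimeInterval

/-! ### The flow in flat coordinates -/

section LocalFlow

variable {n : ℕ}
  {M : Type*} [TopologicalSpace M] [ChartedSpace (E (2 * n)) M]
  [IsManifold 𝓘(ℝ, E (2 * n)) ∞ M]
  {L : Type*} [TopologicalSpace L] [ChartedSpace (E n) L]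
  {S : FlatKahlerSplitting n M} {φ : OpenPartialHomeomorph M (E (2 * n))}
  {B J : E (2 * n) →L[ℝ] E (2 * n)} {N : Set M} {T : EReal} {F : ℝ → L → M}
  {t₀ : ℝ} {x₀ : L}

/-- The flow read in the preferred chart at `x₀` and the chart `φ`. -/
def flowRep (φ : OpenPartialHomeomorph M (E (2 * n))) (F : ℝ → L → M) (x₀ : L) (z : ℝ × E n) :
    E (2 * n) :=
  rep φ (F z.1) x₀ z.2

/-- A space-time neighbourhood `I × U` of `(t₀, x₀)`, in the preferred chart at `x₀`, which the flow
maps into the domain `N` of a flat model. -/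
structure IsFlowNhd (T : EReal) (F : ℝ → L → M) (N : Set M) (t₀ : ℝ) (x₀ : L) (I : Set ℝ)
    (U : Set (E n)) : Prop where
  isSpaceTime : IsSpaceTime I U
  subset_time : I ⊆ timeInterval T
  mem_nhds_time : ∀ t ∈ I, I ∈ 𝓝[timeInterval T] t
  mem_time : t₀ ∈ I
  mem_space : chartAt (E n) x₀ x₀ ∈ U
  subset_space : U ⊆ (chartAt (E n) x₀).target
  maps : ∀ t ∈ I, ∀ y ∈ U, F t ((chartAt (E n) x₀).symm y) ∈ N

lemma IsLagrangianMCF.contMDiff_slice (hF : IsLagrangianMCF S T F) {t : ℝ}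
    (ht : t ∈ timeInterval T) : ContMDiff 𝓘(ℝ, E n) 𝓘(ℝ, E (2 * n)) ∞ (F t) := by
  have h : ContMDiff 𝓘(ℝ, E n) (𝓘(ℝ, ℝ).prod 𝓘(ℝ, E n)) ∞ (fun x : L => (t, x)) :=
    contMDiff_const.prodMk contMDiff_id
  rw [← contMDiffOn_univ] at h ⊢
  exact hF.smooth.comp h fun x _ => ⟨ht, mem_univ _⟩

lemma exists_isFlowNhd (hF : IsLagrangianMCF S T F) (hN : IsOpen N) (ht : t₀ ∈ timeInterval T)
    (hmem : F t₀ x₀ ∈ N) : ∃ (I : Set ℝ) (U : Set (E n)), IsFlowNhd T F N t₀ x₀ I U := by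
  set c := chartAt (E n) x₀ with hc
  have hzx : c.symm (c x₀) = x₀ := c.left_inv (mem_chart_source _ x₀)
  have hcont : ContinuousWithinAt (fun z : ℝ × E n => F z.1 (c.symm z.2))
      (timeInterval T ×ˢ c.target) (t₀, c x₀) := by
    have h1 : ContinuousOn (fun z : ℝ × E n => (z.1, c.symm z.2)) (timeInterval T ×ˢ c.target) :=
      continuousOn_fst.prodMk (c.continuousOn_symm.comp continuousOn_snd fun z hz => hz.2)
    exact (hF.smooth.continuousOn.comp h1 fun z hz => ⟨hz.1, mem_univ _⟩) _
      ⟨ht, mem_chart_target (E n) x₀⟩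
  have hev : ∀ᶠ z in 𝓝[timeInterval T ×ˢ c.target] (t₀, c x₀), F z.1 (c.symm z.2) ∈ N := by
    refine hcont.eventually_mem (hN.mem_nhds ?_)
    simpa only [hzx] using hmem
  rw [nhdsWithin_prod_eq, c.open_target.nhdsWithin_eq (mem_chart_target (E n) x₀)] at hev
  obtain ⟨A, hA, V, hV, hAV⟩ := Filter.eventually_prod_iff.1 hev
  obtain ⟨δ, hδ, hδA⟩ := Metric.mem_nhdsWithin_iff.1 hA
  obtain ⟨ε, hε, hεV⟩ := Metric.mem_nhds_iff.1
    (Filter.inter_mem hV (c.open_target.mem_nhds (mem_chart_target (E n) x₀)))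
  have hball : Metric.ball t₀ δ = Ioo (t₀ - δ) (t₀ + δ) := Real.ball_eq_Ioo t₀ δ
  refine ⟨timeInterval T ∩ Ioo (t₀ - δ) (t₀ + δ), Metric.ball (c x₀) ε, ?_⟩
  refine ⟨⟨?_, ?_, Metric.isOpen_ball, convex_ball _ _, ⟨_, Metric.mem_ball_self hε⟩⟩,
    inter_subset_left, ?_, ?_, Metric.mem_ball_self hε, fun y hy => (hεV hy).2, ?_⟩
  · exact ordConnected_timeInterval.convex.inter (convex_Ioo _ _)
  · obtain ⟨s, hs, hsub⟩ := exists_Ioo_subset_timeInterval ht hδ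
    exact (nonempty_Ioo.2 hs).mono (isOpen_Ioo.subset_interior_iff.2 hsub)
  · exact fun t ht' => inter_mem_nhdsWithin _ (isOpen_Ioo.mem_nhds ht'.2)
  · exact ⟨ht, by linarith, by linarith⟩
  · intro t htI y hy
    exact hAV (hδA ⟨hball ▸ htI.2, htI.1⟩) (hεV hy).1

variable [IsManifold 𝓘(ℝ, E n) ∞ L]

namespace IsFlowNhd

variable {I : Set ℝ} {U : Set (E n)} {t : ℝ} {y : E n}

section
variable (hF : IsLagrangianMCF S T F) (hmod : FlatModel S φ B J N)
  (hU : IsFlowNhd T F N t₀ x₀ I U)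
include hF hmod hU

lemma contDiffOn_flowRep : ContDiffOn ℝ ∞ (flowRep φ F x₀) (I ×ˢ U) := by
  have h1 : ContMDiffOn (𝓘(ℝ, ℝ).prod 𝓘(ℝ, E n)) (𝓘(ℝ, ℝ).prod 𝓘(ℝ, E n)) ∞
      (fun z : ℝ × E n => (z.1, (chartAt (E n) x₀).symm z.2)) (I ×ˢ U) :=
    contMDiffOn_fst.prodMk (contMDiffOn_chart_symm.comp contMDiffOn_snd
      fun z hz => hU.subset_space hz.2)
  have h2 := hF.smooth.comp h1 fun z hz => ⟨hU.subset_time hz.1, mem_univ _⟩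
  have h3 := (contMDiffOn_of_mem_maximalAtlas hmod.flat.smooth).comp h2
    fun z hz => hmod.subset (hU.maps _ hz.1 _ hz.2)
  rw [← modelWithCornersSelf_prod, chartedSpaceSelf_prod] at h3
  exact h3.contDiffOn

lemma dirDeriv_space (ht : t ∈ I) (hy : y ∈ U) (v : E n) :
    dirDeriv (I ×ˢ U) (spaceDir v) (flowRep φ F x₀) (t, y) = fderiv ℝ (rep φ (F t) x₀) y v :=
  (hU.isSpaceTime.fderiv_slice (contDiffOn_flowRep hF hmod hU) ht hy v).symm

lemma dirDeriv_space_eq (ht : t ∈ I) (hy : y ∈ U) (v : E n) :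
    dirDeriv (I ×ˢ U) (spaceDir v) (flowRep φ F x₀) (t, y) =
      tangentMap φ (F t) ((chartAt (E n) x₀).symm y) (coordField x₀ y v) := by
  rw [dirDeriv_space hF hmod hU ht hy]
  exact fderiv_rep hmod.flat (hF.contMDiff_slice (hU.subset_time ht)) (hU.subset_space hy)
    (hmod.subset (hU.maps t ht y hy)) v

lemma dirDeriv_space_space (ht : t ∈ I) (hy : y ∈ U) (v w : E n) :
    dirDeriv (I ×ˢ U) (spaceDir v) (dirDeriv (I ×ˢ U) (spaceDir w) (flowRep φ F x₀)) (t, y) =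
      fderiv ℝ (fun y => fderiv ℝ (rep φ (F t) x₀) y) y v w :=
  (hU.isSpaceTime.fderiv_fderiv_slice (contDiffOn_flowRep hF hmod hU) ht hy v w).symm

lemma dirDeriv_time (ht : t ∈ I) (hy : y ∈ U) :
    dirDeriv (I ×ˢ U) timeDir (flowRep φ F x₀) (t, y) =
      chartDeriv φ (F t ((chartAt (E n) x₀).symm y))
        (mfderivWithin 𝓘(ℝ, ℝ) 𝓘(ℝ, E (2 * n)) (fun s => F s ((chartAt (E n) x₀).symm y))
          (timeInterval T) t (1 : ℝ)) := by
  have htT := hU.subset_time ht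
  set x := (chartAt (E n) x₀).symm y
  have hu := uniqueDiffOn_timeInterval (T := T) t htT
  rw [← IsSpaceTime.derivWithin_slice (contDiffOn_flowRep hF hmod hU) (hU.mem_nhds_time t ht) hu ht hy]
  have hin : φ ∈ IsManifold.maximalAtlas 𝓘(ℝ, E (2 * n)) ∞ M := hmod.flat.smooth
  have h1 : MDifferentiableWithinAt 𝓘(ℝ, ℝ) 𝓘(ℝ, E (2 * n)) (fun s => F s x) (timeInterval T) t := by
    have h : ContMDiffOn 𝓘(ℝ, ℝ) (𝓘(ℝ, ℝ).prod 𝓘(ℝ, E n)) ∞ (fun s : ℝ => (s, x))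
        (timeInterval T) := contMDiffOn_id.prodMk contMDiffOn_const
    exact (hF.smooth.comp h fun s hs => ⟨hs, mem_univ _⟩).mdifferentiableOn (by simp) t htT
  have h2 : MDifferentiableAt 𝓘(ℝ, E (2 * n)) 𝓘(ℝ, E (2 * n)) φ (F t x) :=
    (mdifferentiable_of_mem_maximalAtlas hin).mdifferentiableAt (hmod.subset (hU.maps t ht y hy))
  have h3 := mfderiv_comp_mfderivWithin t h2 h1 hu.uniqueMDiffWithinAt
  rw [mfderivWithin_eq_fderivWithin] at h3
  exact DFunLike.congr_fun h3 (1 : ℝ)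

end

/-- In a flat chart, and in any constant frame of directions, the flow satisfies the Euclidean
equations. -/
lemma graphFlow (hF : IsLagrangianMCF S T F) (hgraph : ∀ t ∈ timeInterval T, IsGraphical S (F t))
    (hmod : FlatModel S φ B J N) (hU : IsFlowNhd T F N t₀ x₀ I U) {e : Fin n → E n}
    (he : LinearIndependent ℝ e) :
    GraphFlow (I ×ˢ U) (flowRep φ F x₀) timeDir (fun i => spaceDir (e i)) B J := by
  have hq := hU.maps _ hU.mem_time _ hU.mem_space
  have hfield : ∀ y ∈ U, LinearIndependent ℝ fun i => (coordField (L := L) x₀ y (e i) : E n) :=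
    fun y hy => he.map' (coordField (L := L) x₀ y).toLinearMap
      (LinearMap.ker_eq_bot.2 (coordField_bijective (hU.subset_space hy)).1)
  refine ⟨hU.isSpaceTime.isCalcDomain, contDiffOn_flowRep hF hmod hU, hmod.proj_symm hq,
    hmod.proj_idem hq, hmod.skew hq, ?_, ?_, ?_, ?_⟩
  · rintro ⟨t, y⟩ ⟨ht, hy⟩
    simp only [dirDeriv_space_eq hF hmod hU ht hy]
    refine (hfield y hy).map' _ (LinearMap.ker_eq_bot.2 ?_)
    exact (hmod.bijective (hU.maps t ht y hy)).1.comp (hF.immersion t (hU.subset_time ht) _)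
  · rintro ⟨t, y⟩ ⟨ht, hy⟩
    simp only [dirDeriv_space_eq hF hmod hU ht hy]
    refine (hfield y hy).map' (B.toLinearMap ∘ₗ tangentMap φ (F t) _) (LinearMap.ker_eq_bot.2 ?_)
    have hN := hU.maps t ht y hy
    intro a b hab
    refine hgraph t (hU.subset_time ht) _ ((hmod.bijective hN).1 ?_)
    change chartDeriv φ _ (S.pr₁ _ _) = chartDeriv φ _ (S.pr₁ _ _)
    rw [hmod.map_pr₁ _ hN, hmod.map_pr₁ _ hN]
    exact hab
  · rintro ⟨t, y⟩ ⟨ht, hy⟩ i j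
    rw [dirDeriv_space_eq hF hmod hU ht hy, dirDeriv_space_eq hF hmod hU ht hy]
    have hN := hU.maps t ht y hy
    have h := hF.lagrangian t (hU.subset_time ht) ((chartAt (E n) x₀).symm y)
      (coordField x₀ y (e i)) (coordField x₀ y (e j))
    rw [FlatKahlerSplitting.omega, hmod.inner_eq hN, hmod.map_J _ hN] at h
    exact h
  · rintro ⟨t, y⟩ ⟨ht, hy⟩
    have hN := hU.maps t ht y hy
    have htT := hU.subset_time ht
    rw [dirDeriv_time hF hmod hU ht hy, hF.flow t htT _ φ hmod.flat (hmod.subset hN),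
      meanCurvature_eq_frame hmod.flat (hF.contMDiff_slice htT) (hU.subset_space hy)
        (hmod.subset hN) (hF.immersion t htT _) he
        (H := traceHess (I ×ˢ U) (flowRep φ F x₀) (fun i => spaceDir (e i)) (t, y))]
    · simp only [dirDeriv_space hF hmod hU ht hy]
    · simp only [traceHess, dirDeriv_space hF hmod hU ht hy, dirDeriv_space_space hF hmod hU ht hy]

/-- `log(*Ω)`, defined through the preferred chart at each point, is `logRatio` in a single chart. -/
lemma logStarOmega_eq (hF : IsLagrangianMCF S T F)
    (hgraph : ∀ t ∈ timeInterval T, IsGraphical S (F t))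
    (hmod : FlatModel S φ B J N) (hU : IsFlowNhd T F N t₀ x₀ I U) {e : Fin n → E n}
    (he : LinearIndependent ℝ e) (ht : t ∈ I) (hy : y ∈ U) :
    logStarOmega S F t ((chartAt (E n) x₀).symm y) =
      logRatio (I ×ˢ U) (flowRep φ F x₀) (fun i => spaceDir (e i)) B (t, y) ∧
    0 < starOmega S (F t) ((chartAt (E n) x₀).symm y) := by
  have hfield : LinearIndependent ℝ fun i => (coordField (L := L) x₀ y (e i) : E n) :=
    he.map' (coordField (L := L) x₀ y).toLinearMap
      (LinearMap.ker_eq_bot.2 (coordField_bijective (hU.subset_space hy)).1)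
  have hG := graphFlow hF hgraph hmod hU he
  have hP := det_gram_pos (hG.graphical _ (mk_mem_prod ht hy))
  have hg := det_gram_pos (hG.immersed _ (mk_mem_prod ht hy))
  unfold logStarOmega logRatio
  simp only [dirDeriv_space_eq hF hmod hU ht hy] at hP hg ⊢
  rw [starOmega_eq_frame hmod (hU.maps t ht y hy) hfield]
  refine ⟨?_, div_pos (Real.sqrt_pos.2 hP) (Real.sqrt_pos.2 hg)⟩
  rw [Real.log_div (Real.sqrt_pos.2 hP).ne' (Real.sqrt_pos.2 hg).ne', Real.log_sqrt hP.le,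
    Real.log_sqrt hg.le]
  ring

end IsFlowNhd

end LocalFlow

/-! ### Adapted frames -/

section ModelFrame

variable {n : ℕ} {V : Type*} [NormedAddCommGroup V] [InnerProductSpace ℝ V]

/-- A vector space with a complex structure `J` and an orthogonal projection `B` whose image and
kernel are Lagrangian. -/
structure IsLagrangianSplitting (B J : V →L[ℝ] V) : Prop where
  proj_symm : ∀ v w, inner ℝ (B v) w = inner ℝ v (B w)
  proj_idem : ∀ v, B (B v) = B v
  skew : ∀ v w, inner ℝ (J v) w = - inner ℝ v (J w)
  J_J : ∀ v, J (J v) = -v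
  proj_J_proj : ∀ v, B (J (B v)) = 0
  proj_J_of_ker : ∀ v, B v = 0 → B (J v) = J v

/-- The vectors `wᵢ = (1 + lamᵢ²)^(-1/2) (αᵢ + lamᵢ J αᵢ)` attached to an orthonormal family `αᵢ` in the
image of `B`. -/
structure IsModelFrame (B J : V →L[ℝ] V) (w α : Fin n → V) (lam : Fin n → ℝ) : Prop where
  orthonormal : ∀ i j, inner ℝ (α i) (α j) = if i = j then (1 : ℝ) else 0
  mem : ∀ i, B (α i) = α i
  frame : ∀ i, w i = (1 / √(1 + lam i ^ 2)) • (α i + lam i • J (α i))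

lemma one_add_sq_pos (x : ℝ) : 0 < 1 + x ^ 2 := by positivity

namespace IsModelFrame

variable {B J : V →L[ℝ] V} {w α : Fin n → V} {lam : Fin n → ℝ}
  (hBJ : IsLagrangianSplitting B J) (h : IsModelFrame B J w α lam)
include hBJ h

lemma proj_J (i : Fin n) : B (J (α i)) = 0 := by
  rw [← h.mem i]; exact hBJ.proj_J_proj _

lemma inner_J (i j : Fin n) : inner ℝ (α i) (J (α j)) = 0 := by
  rw [← h.mem i, hBJ.proj_symm, h.proj_J hBJ, inner_zero_right]

lemma inner_J_J (i j : Fin n) : inner ℝ (J (α i)) (J (α j)) = if i = j then (1 : ℝ) else 0 := by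
  rw [hBJ.skew, hBJ.J_J, inner_neg_right, neg_neg, h.orthonormal]

lemma proj_frame (i : Fin n) : B (w i) = (1 / √(1 + lam i ^ 2)) • α i := by
  rw [h.frame, map_smul, map_add, map_smul, h.mem, h.proj_J hBJ, smul_zero, add_zero]

lemma J_frame (i : Fin n) : J (w i) = (1 / √(1 + lam i ^ 2)) • (J (α i) - lam i • α i) := by
  rw [h.frame, map_smul, map_add, map_smul, hBJ.J_J, smul_neg, sub_eq_add_neg]

lemma proj_J_frame (i : Fin n) : B (J (w i)) = -lam i • B (w i) := by
  rw [h.proj_frame hBJ, h.J_frame hBJ, map_smul, map_sub, map_smul, h.mem, h.proj_J hBJ]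
  module

lemma inner_frame (i j : Fin n) : inner ℝ (w i) (w j) = if i = j then (1 : ℝ) else 0 := by
  have h1 : ∀ i j, inner ℝ (J (α i)) (α j) = 0 := fun i j => by
    rw [real_inner_comm]; exact h.inner_J hBJ j i
  rw [h.frame, h.frame]
  simp only [real_inner_smul_left, real_inner_smul_right, inner_add_left, inner_add_right,
    h.orthonormal, h.inner_J hBJ, h.inner_J_J hBJ, h1]
  split_ifs with hij
  · subst hij
    have := Real.mul_self_sqrt (one_add_sq_pos (lam i)).le
    have := (Real.sqrt_pos.2 (one_add_sq_pos (lam i))).ne'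
    field_simp
    nlinarith
  · simp

lemma inner_frame_J (i j : Fin n) : inner ℝ (w i) (J (w j)) = 0 := by
  have h1 : ∀ i j, inner ℝ (J (α i)) (α j) = 0 := fun i j => by
    rw [real_inner_comm]; exact h.inner_J hBJ j i
  rw [h.J_frame hBJ, h.frame]
  simp only [real_inner_smul_left, real_inner_smul_right, inner_add_left, inner_sub_right,
    h.orthonormal, h.inner_J hBJ, h.inner_J_J hBJ, h1]
  split_ifs with hij
  · subst hij; ring
  · simp

lemma gram_frame : Matrix.gram ℝ w = 1 := by
  ext i j
  rw [Matrix.gram_apply, h.inner_frame hBJ, Matrix.one_apply]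

lemma gram_proj_frame :
    (Matrix.gram ℝ fun i => B (w i)) = Matrix.diagonal fun i => (1 + lam i ^ 2)⁻¹ := by
  ext i j
  rw [Matrix.gram_apply, h.proj_frame hBJ, h.proj_frame hBJ, real_inner_smul_left,
    real_inner_smul_right, h.orthonormal, Matrix.diagonal_apply]
  split_ifs with hij
  · subst hij
    rw [mul_one, one_div, ← mul_inv, Real.mul_self_sqrt (one_add_sq_pos _).le]
  · simp

lemma dualFrame_proj (k : Fin n) :
    dualFrame (fun i => B (w i)) k = w k - lam k • J (w k) := by
  have hinv : (Matrix.gram ℝ fun i => B (w i))⁻¹ = Matrix.diagonal fun i => (1 + lam i ^ 2) := by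
    apply Matrix.inv_eq_right_inv
    rw [h.gram_proj_frame hBJ, Matrix.diagonal_mul_diagonal, ← Matrix.diagonal_one]
    congr 1
    funext i
    exact inv_mul_cancel₀ (one_add_sq_pos _).ne'
  rw [dualFrame, hinv]
  simp only [Matrix.diagonal_apply, ite_smul, zero_smul, Finset.sum_ite_eq, Finset.mem_univ,
    if_true]
  rw [h.proj_frame hBJ, h.J_frame hBJ, h.frame]
  module

lemma expand (hdim : Module.finrank ℝ V = 2 * n) [FiniteDimensional ℝ V] (v : V) :
    v = ∑ m, inner ℝ (w m) v • w m + ∑ m, inner ℝ (J (w m)) v • J (w m) := by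
  have horth : Orthonormal ℝ (Sum.elim w fun i => J (w i)) := by
    rw [orthonormal_iff_ite]
    have h2 : ∀ i j, inner ℝ (J (w i)) (w j) = 0 := fun i j => by
      rw [real_inner_comm]; exact h.inner_frame_J hBJ j i
    rintro (i | i) (j | j)
    · simp [h.inner_frame hBJ]
    · simp [h.inner_frame_J hBJ]
    · simp [h2]
    · simp [hBJ.skew, hBJ.J_J, h.inner_frame hBJ]
  have hcard : Fintype.card (Fin n ⊕ Fin n) = Module.finrank ℝ V := by
    simp [hdim, two_mul]
  have hspan : ⊤ ≤ Submodule.span ℝ (range (Sum.elim w fun i => J (w i))) :=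
    (horth.linearIndependent.span_eq_top_of_card_eq_finrank' hcard).ge
  have hb := (OrthonormalBasis.mk horth hspan).sum_repr' v
  simp only [OrthonormalBasis.coe_mk, Fintype.sum_sum_type, Sum.elim_inl, Sum.elim_inr] at hb
  exact hb.symm

end IsModelFrame

/-- Existence of adapted frames: a Lagrangian graph over the image of `B` is the graph of `J A` for a
symmetric operator `A` of the image of `B`, whose eigenbasis is an adapted frame. -/
lemma exists_isModelFrame [FiniteDimensional ℝ V] {B J : V →L[ℝ] V}
    (hdim : Module.finrank ℝ V = 2 * n) (hBJ : IsLagrangianSplitting B J)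
    (D : E n →ₗ[ℝ] V) (hD : Function.Injective fun v => B (D v))
    (hlag : ∀ a b, inner ℝ (J (D a)) (D b) = 0) :
    ∃ (e : Fin n → E n) (α : Fin n → V) (lam : Fin n → ℝ),
      IsModelFrame B J (fun i => D (e i)) α lam := by
  set W : Submodule ℝ V := LinearMap.range B.toLinearMap with hW
  have hBW : ∀ w : W, B w = w := by
    rintro ⟨_, v, rfl⟩; exact hBJ.proj_idem v
  -- the image of `B` has dimension `n`: it contains the injective image of `ℝⁿ`, and `J` embeds it
  -- into the kernel of `B`
  set P : E n →ₗ[ℝ] W := (B.toLinearMap ∘ₗ D).codRestrict W (fun v => ⟨D v, rfl⟩) with hP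
  have hPc : ∀ v, (P v : V) = B (D v) := fun v => rfl
  have hPinj : Function.Injective P := fun a b hab => hD (congrArg Subtype.val hab)
  have hker : ∀ w : W, J w ∈ LinearMap.ker B.toLinearMap := by
    intro w
    rw [LinearMap.mem_ker, ← hBW w]
    exact hBJ.proj_J_proj _
  have hWn : Module.finrank ℝ W = n := by
    have h1 : n ≤ Module.finrank ℝ W := by
      simpa using LinearMap.finrank_le_finrank_of_injective hPinj
    have h2 : Module.finrank ℝ W ≤ Module.finrank ℝ (LinearMap.ker B.toLinearMap) := by
      refine LinearMap.finrank_le_finrank_of_injective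
        (f := (J.toLinearMap ∘ₗ W.subtype).codRestrict _ hker) ?_
      intro a b hab
      have h3 : J a = J b := congrArg Subtype.val hab
      have h4 := congrArg J h3
      rw [hBJ.J_J, hBJ.J_J] at h4
      exact Subtype.ext (neg_injective h4)
    have h3 := LinearMap.finrank_range_add_finrank_ker B.toLinearMap
    rw [hdim] at h3
    have h4 : Module.finrank ℝ W = Module.finrank ℝ (LinearMap.range B.toLinearMap) := rfl
    omega
  set p : E n ≃ₗ[ℝ] W := LinearEquiv.ofInjectiveOfFinrankEq P hPinj (by simp [hWn]) with hp
  have hpP : ∀ w, B (D (p.symm w)) = w := by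
    intro w
    rw [← hPc]
    have : p (p.symm w) = w := p.apply_symm_apply w
    exact congrArg Subtype.val this
  -- `A w = - J (v - w)`, where `v` is the point of the graph over `w`
  have hmem : ∀ w : W, -J (D (p.symm w) - w) ∈ W := by
    intro w
    have h0 : B (D (p.symm w) - w) = 0 := by rw [map_sub, hpP, hBW, sub_self]
    exact W.neg_mem ⟨_, hBJ.proj_J_of_ker _ h0⟩
  set A : W →ₗ[ℝ] W :=
    (-(J.toLinearMap ∘ₗ (D ∘ₗ p.symm.toLinearMap - W.subtype))).codRestrict W hmem with hA
  have hAc : ∀ w : W, D (p.symm w) = w + J (A w) := by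
    intro w
    have : (A w : V) = -J (D (p.symm w) - w) := rfl
    rw [this, map_neg, hBJ.J_J, neg_neg]
    abel
  have hiso : ∀ v w : W, inner ℝ (v : V) (J w) = 0 := by
    intro v w
    have h0 : B (J w) = 0 := hker w
    rw [← hBW v, hBJ.proj_symm, h0, inner_zero_right]
  have hAs : A.IsSymmetric := by
    intro v w
    have h1 := hlag (p.symm v) (p.symm w)
    rw [hAc, hAc, map_add, hBJ.J_J] at h1
    simp only [inner_add_left, inner_add_right, inner_neg_left, hiso] at h1
    rw [hBJ.skew, hBJ.skew, hBJ.J_J, hiso, inner_neg_right] at h1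
    simp only [Submodule.coe_inner]
    linarith
  set b := hAs.eigenvectorBasis hWn
  set lam := hAs.eigenvalues hWn
  have hb : ∀ i, (A (b i) : V) = lam i • (b i : V) := by
    intro i
    have := hAs.apply_eigenvectorBasis hWn i
    exact congrArg Subtype.val this
  refine ⟨fun i => (1 / √(1 + lam i ^ 2)) • p.symm (b i), fun i => b i, lam, ?_, fun i => hBW _, ?_⟩
  · intro i j
    have := orthonormal_iff_ite.1 b.orthonormal i j
    exact this
  · intro i
    rw [map_smul, hAc, hb, map_smul]

end ModelFrame

section AdaptedFrame

variable {n : ℕ}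
  {M : Type*} [TopologicalSpace M] [ChartedSpace (E (2 * n)) M]
  [IsManifold 𝓘(ℝ, E (2 * n)) ∞ M]
  {L : Type*} [TopologicalSpace L] [ChartedSpace (E n) L]
  {S : FlatKahlerSplitting n M} {φ : OpenPartialHomeomorph M (E (2 * n))}
  {B J : E (2 * n) →L[ℝ] E (2 * n)} {N : Set M} {G : L → M} {x : L}

lemma FlatModel.isLagrangianSplitting (h : FlatModel S φ B J N) {q : M} (hq : q ∈ N) :
    IsLagrangianSplitting B J := by
  refine ⟨h.proj_symm hq, h.proj_idem hq, h.skew hq, h.J_J hq, h.proj_J_proj hq, ?_⟩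
  have hiso : ∀ v w, B v = 0 → B w = 0 → inner ℝ (J v) w = 0 := by
    intro v w hv hw
    obtain ⟨v, rfl⟩ := (h.bijective hq).2 v
    obtain ⟨w, rfl⟩ := (h.bijective hq).2 w
    rw [← h.map_pr₁ q hq] at hv hw
    rw [← h.map_J q hq, ← h.inner_eq hq]
    exact S.ker_pr₁_isotropic q v w ((h.bijective hq).1 (hv.trans (map_zero _).symm))
      ((h.bijective hq).1 (hw.trans (map_zero _).symm))
  intro v hv
  -- the component of `J v` in the kernel of `B` is orthogonal to itself
  have h1 : B (J v - B (J v)) = 0 := by rw [map_sub, h.proj_idem hq, sub_self]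
  have h2 := hiso v _ hv h1
  have h3 : inner ℝ (J v - B (J v)) (J v - B (J v)) = 0 := by
    rw [inner_sub_left, h2, h.proj_symm hq, h1, inner_zero_right, sub_zero]
  exact (sub_eq_zero.1 (inner_self_eq_zero.1 h3)).symm

/-- An adapted frame, read in a flat chart. -/
lemma IsAdaptedFrame.isModelFrame (h : FlatModel S φ B J N) (hGx : G x ∈ N)
    {e : Fin n → TangentSpace 𝓘(ℝ, E n) x}
    {a : Fin n → TangentSpace 𝓘(ℝ, E (2 * n)) (G x)} {lam : Fin n → ℝ}
    (ha : IsAdaptedFrame S G x e a lam) :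
    IsModelFrame B J (fun i => tangentMap φ G x (e i)) (fun i => chartDeriv φ (G x) (a i)) lam := by
  refine ⟨fun i j => ?_, fun i => ?_, fun i => ?_⟩
  · rw [← h.inner_eq hGx, ha.orthonormal]
  · rw [← h.map_pr₁ _ hGx, ha.mem]
  · have h1 := congrArg (chartDeriv φ (G x)) (ha.frame i)
    rw [map_smul, map_add, map_smul, h.map_J _ hGx] at h1
    exact h1

lemma IsAdaptedFrame.linearIndependent (h : FlatModel S φ B J N) (hGx : G x ∈ N)
    {e : Fin n → TangentSpace 𝓘(ℝ, E n) x}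
    {a : Fin n → TangentSpace 𝓘(ℝ, E (2 * n)) (G x)} {lam : Fin n → ℝ}
    (ha : IsAdaptedFrame S G x e a lam) : LinearIndependent ℝ (fun i => (e i : E n)) := by
  have h1 := (ha.isModelFrame h hGx).gram_frame (h.isLagrangianSplitting hGx)
  have h2 : LinearIndependent ℝ fun i => tangentMap φ G x (e i) :=
    Matrix.linearIndependent_of_det_gram_ne_zero (𝕜 := ℝ) (by rw [h1]; simp)
  exact LinearIndependent.of_comp (tangentMap φ G x) h2

lemma exists_isAdaptedFrame (h : FlatModel S φ B J N) (hGx : G x ∈ N)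
    (hgraph : IsGraphical S G) (hlag : IsLagrangian S G) :
    ∃ e a lam, IsAdaptedFrame S G x e a lam := by
  have hBJ := h.isLagrangianSplitting hGx
  obtain ⟨e, α, lam, hf⟩ := exists_isModelFrame (by simp) hBJ (tangentMap φ G x)
    (by
      intro u v huv
      refine hgraph x ((h.bijective hGx).1 ?_)
      change chartDeriv φ _ (S.pr₁ _ _) = chartDeriv φ _ (S.pr₁ _ _)
      rw [h.map_pr₁ _ hGx, h.map_pr₁ _ hGx]
      exact huv)
    (by
      intro u v
      have h1 := hlag x u v
      rw [FlatKahlerSplitting.omega, h.inner_eq hGx, h.map_J _ hGx] at h1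
      exact h1)
  choose a ha using fun i => (h.bijective hGx).2 (α i)
  refine ⟨e, a, lam, fun i j => ?_, fun i => ?_, fun i => ?_, fun i j => ?_⟩
  · rw [h.inner_eq hGx, ha, ha, hf.orthonormal]
  · refine (h.bijective hGx).1 ?_
    rw [h.map_pr₁ _ hGx, ha, hf.mem]
  · refine (h.bijective hGx).1 ?_
    rw [map_smul, map_add, map_smul, h.map_J _ hGx, ha]
    exact hf.frame i
  · exact (h.inner_eq hGx _ _).trans (hf.inner_frame hBJ i j)

/-- `*Ω = ∏ᵢ (1 + lamᵢ²)^(-1/2)` is at most each of its factors. -/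
lemma IsAdaptedFrame.starOmega_le (h : FlatModel S φ B J N) (hGx : G x ∈ N)
    {e : Fin n → TangentSpace 𝓘(ℝ, E n) x}
    {a : Fin n → TangentSpace 𝓘(ℝ, E (2 * n)) (G x)} {lam : Fin n → ℝ}
    (ha : IsAdaptedFrame S G x e a lam) (i : Fin n) :
    starOmega S G x ≤ (√(1 + lam i ^ 2))⁻¹ := by
  have hBJ := h.isLagrangianSplitting hGx
  have hf := ha.isModelFrame h hGx
  rw [starOmega_eq_frame h hGx (ha.linearIndependent h hGx), hf.gram_frame hBJ,
    hf.gram_proj_frame hBJ, Matrix.det_diagonal, Matrix.det_one, Real.sqrt_one, div_one,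
    ← Real.sqrt_inv]
  refine Real.sqrt_le_sqrt ?_
  rw [← Finset.mul_prod_erase Finset.univ _ (Finset.mem_univ i)]
  refine mul_le_of_le_one_right (inv_nonneg.2 (one_add_sq_pos _).le) ?_
  refine Finset.prod_le_one (fun j _ => inv_nonneg.2 (one_add_sq_pos _).le) fun j _ => ?_
  exact inv_le_one_of_one_le₀ (by nlinarith [sq_nonneg (lam j)])

end AdaptedFrame

/-! ### The evolution equation and the minimum principle -/

section Minimum

variable {n : ℕ}

/-- The second derivative test at a minimum. -/
lemma fderiv_fderiv_nonneg_of_isLocalMin {v : E n → ℝ} {y : E n} (hv : ContDiffAt ℝ ∞ v y)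
    (hmin : IsLocalMin v y) (a : E n) : 0 ≤ fderiv ℝ (fun y => fderiv ℝ v y) y a a := by
  have hl : ∀ s : ℝ, HasDerivAt (fun s : ℝ => y + s • a) a s := fun s => by
    simpa using ((hasDerivAt_id s).smul_const a).const_add y
  have hl0 : Tendsto (fun s : ℝ => y + s • a) (𝓝 0) (𝓝 y) := by
    simpa using (hl 0).continuousAt.tendsto
  have hv1 : ∀ᶠ z in 𝓝 y, ContDiffAt ℝ 1 v z :=
    (hv.of_le (mod_cast le_top)).eventually (by simp)
  set g : ℝ → ℝ := fun s => v (y + s • a) with hg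
  have hg1 : deriv g =ᶠ[𝓝 0] fun s => fderiv ℝ v (y + s • a) a := by
    filter_upwards [hl0.eventually hv1] with s hs
    exact ((hs.differentiableAt (by simp)).hasFDerivAt.comp_hasDerivAt s (hl s)).deriv
  have hg2 : deriv (deriv g) 0 = fderiv ℝ (fun y => fderiv ℝ v y) y a a := by
    have d : HasFDerivAt (fun y => fderiv ℝ v y) (fderiv ℝ (fun y => fderiv ℝ v y) y)
        (y + (0 : ℝ) • a) := by
      rw [zero_smul, add_zero]
      exact ((hv.fderiv_right (m := ∞) (by simp)).differentiableAt (by simp)).hasFDerivAt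
    have d2 : HasDerivAt (fun s : ℝ => fderiv ℝ v (y + s • a) a)
        (fderiv ℝ (fun y => fderiv ℝ v y) y a a) 0 := by
      have d3 : HasDerivAt (fun s : ℝ => fderiv ℝ v (y + s • a))
        (fderiv ℝ (fun y => fderiv ℝ v y) y a) 0 := d.comp_hasDerivAt (0 : ℝ) (hl 0)
      exact (d3.clm_apply (hasDerivAt_const (0 : ℝ) a)).congr_deriv (by simp)
    rw [hg1.deriv_eq, d2.deriv]
  have hgmin : IsLocalMin g 0 := by
    have := hl0.eventually hmin
    filter_upwards [this] with s hs
    simpa [hg] using hs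
  by_contra hneg
  push Not at hneg
  rw [← hg2] at hneg
  have hgc : ContinuousAt g 0 := by
    have h0 : ContinuousAt v (y + (0 : ℝ) • a) := by simpa using hv.continuousAt
    exact ContinuousAt.comp (f := fun s : ℝ => y + s • a) h0 (hl 0).continuousAt
  have hgmax := isLocalMax_of_deriv_deriv_neg hneg hgmin.deriv_eq_zero hgc
  -- a local minimum which is a local maximum: `g` is locally constant
  have hconst : g =ᶠ[𝓝 0] fun _ => g 0 := by
    filter_upwards [hgmin, hgmax] with s h1 h2
    exact le_antisymm h2 h1
  have h3 : deriv g =ᶠ[𝓝 0] fun _ => 0 := by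
    filter_upwards [hconst.deriv] with s hs
    rw [hs]; simp
  rw [h3.deriv_eq] at hneg
  simp at hneg

end Minimum

section Evolution

variable {n : ℕ}
  {M : Type*} [TopologicalSpace M] [ChartedSpace (E (2 * n)) M]
  [IsManifold 𝓘(ℝ, E (2 * n)) ∞ M]
  {L : Type*} [TopologicalSpace L] [ChartedSpace (E n) L]
  {S : FlatKahlerSplitting n M} {φ : OpenPartialHomeomorph M (E (2 * n))}
  {B J : E (2 * n) →L[ℝ] E (2 * n)} {N : Set M} {T : EReal} {F : ℝ → L → M}
  {t₀ : ℝ} {x₀ : L} {I : Set ℝ} {U : Set (E n)}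

lemma IsAdaptedFrame.gram_fderiv_rep (hF : IsLagrangianMCF S T F) (ht : t₀ ∈ timeInterval T)
    (hmod : FlatModel S φ B J N) (hN : F t₀ x₀ ∈ N) {e : Fin n → E n}
    {a : Fin n → TangentSpace 𝓘(ℝ, E (2 * n)) (F t₀ x₀)} {lam : Fin n → ℝ}
    (ha : IsAdaptedFrame S (F t₀) x₀ e a lam) :
    (Matrix.gram ℝ fun i => fderiv ℝ (rep φ (F t₀) x₀) (chartAt (E n) x₀ x₀) (e i)) = 1 := by
  have e1 : ∀ i, fderiv ℝ (rep φ (F t₀) x₀) (chartAt (E n) x₀ x₀) (e i) =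
      tangentMap φ (F t₀) x₀ (e i) := fun i =>
    fderiv_rep_self hmod.flat (hF.contMDiff_slice ht) x₀ (hmod.subset hN) (e i)
  simp only [e1]
  exact (ha.isModelFrame hmod hN).gram_frame (hmod.isLagrangianSplitting hN)

lemma exists_adaptedFrame (hF : IsLagrangianMCF S T F)
    (hgraph : ∀ t ∈ timeInterval T, IsGraphical S (F t)) (ht : t₀ ∈ timeInterval T) (x₀ : L) :
    ∃ e a lam, IsAdaptedFrame S (F t₀) x₀ e a lam := by
  obtain ⟨φ, hφ, hmem⟩ := S.flat (F t₀ x₀)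
  obtain ⟨B, J, N, hN, hmod⟩ := exists_flatModel hφ hmem
  exact exists_isAdaptedFrame hmod hN (hgraph t₀ ht) (hF.lagrangian t₀ ht)

variable [IsManifold 𝓘(ℝ, E n) ∞ L]

lemma starOmega_pos (hF : IsLagrangianMCF S T F)
    (hgraph : ∀ t ∈ timeInterval T, IsGraphical S (F t)) (ht : t₀ ∈ timeInterval T) (x₀ : L) :
    0 < starOmega S (F t₀) x₀ := by
  obtain ⟨φ, hφ, hmem⟩ := S.flat (F t₀ x₀)
  obtain ⟨B, J, N, hN, hmod⟩ := exists_flatModel hφ hmem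
  obtain ⟨I, U, hU⟩ := exists_isFlowNhd hF hmod.isOpen ht hN
  have := (IsFlowNhd.logStarOmega_eq hF hgraph hmod hU
    (e := fun i => EuclideanSpace.single i (1 : ℝ)) linearIndependent_single
    hU.mem_time hU.mem_space).2
  rwa [(chartAt (E n) x₀).left_inv (mem_chart_source _ x₀)] at this

/-- Smoothness of `log(*Ω)` up to the initial time. -/
lemma contMDiffOn_logStarOmega (hF : IsLagrangianMCF S T F)
    (hgraph : ∀ t ∈ timeInterval T, IsGraphical S (F t)) :
    ContMDiffOn (𝓘(ℝ, ℝ).prod 𝓘(ℝ, E n)) 𝓘(ℝ, ℝ) ∞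
      (fun z : ℝ × L => logStarOmega S F z.1 z.2) (timeInterval T ×ˢ univ) := by
  rintro ⟨t₀, x₀⟩ ⟨ht, -⟩
  obtain ⟨φ, hφ, hmem⟩ := S.flat (F t₀ x₀)
  obtain ⟨B, J, N, hN, hmod⟩ := exists_flatModel hφ hmem
  obtain ⟨I, U, hU⟩ := exists_isFlowNhd hF hmod.isOpen ht hN
  have hli := linearIndependent_single (n := n)
  set c := chartAt (E n) x₀ with hc
  have hsm : ContMDiffOn (𝓘(ℝ, ℝ).prod 𝓘(ℝ, E n)) 𝓘(ℝ, ℝ) ∞ (logRatio (I ×ˢ U) (flowRep φ F x₀)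
      (fun i => spaceDir (EuclideanSpace.single i (1 : ℝ))) B) (I ×ˢ U) := by
    have h := (IsFlowNhd.graphFlow hF hgraph hmod hU hli).contDiffOn_logRatio.contMDiffOn
    rw [modelWithCornersSelf_prod, ← chartedSpaceSelf_prod] at h
    exact h
  have hO : IsOpen (c.source ∩ c ⁻¹' U) := c.isOpen_inter_preimage hU.isSpaceTime.isOpen_space
  have hmap : ContMDiffOn (𝓘(ℝ, ℝ).prod 𝓘(ℝ, E n)) (𝓘(ℝ, ℝ).prod 𝓘(ℝ, E n)) ∞
      (fun z : ℝ × L => (z.1, c z.2)) (I ×ˢ (c.source ∩ c ⁻¹' U)) :=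
    contMDiffOn_fst.prodMk (contMDiffOn_chart.comp contMDiffOn_snd fun z hz => hz.2.1)
  have hcomp := hsm.comp hmap fun z hz => ⟨hz.1, hz.2.2⟩
  have hmemz : ((t₀, x₀) : ℝ × L) ∈ I ×ˢ (c.source ∩ c ⁻¹' U) :=
    ⟨hU.mem_time, mem_chart_source _ x₀, hU.mem_space⟩
  have hloc : ContMDiffWithinAt (𝓘(ℝ, ℝ).prod 𝓘(ℝ, E n)) 𝓘(ℝ, ℝ) ∞
      (fun z : ℝ × L => logStarOmega S F z.1 z.2) (I ×ˢ (c.source ∩ c ⁻¹' U)) (t₀, x₀) := by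
    have heq : ∀ z ∈ I ×ˢ (c.source ∩ c ⁻¹' U), logStarOmega S F z.1 z.2 =
        (logRatio (I ×ˢ U) (flowRep φ F x₀)
          (fun i => spaceDir (EuclideanSpace.single i (1 : ℝ))) B ∘
            fun z : ℝ × L => (z.1, c z.2)) z := by
      rintro ⟨t, x⟩ ⟨h1, h2, h3⟩
      have := (IsFlowNhd.logStarOmega_eq hF hgraph hmod hU hli h1 h3).1
      rw [c.left_inv h2] at this
      exact this
    exact (hcomp _ hmemz).congr heq (heq _ hmemz)
  refine hloc.mono_of_mem_nhdsWithin ?_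
  rw [nhdsWithin_prod_eq, nhdsWithin_univ]
  exact prod_mem_prod (hU.mem_nhds_time _ hU.mem_time) (hO.mem_nhds hmemz.2)

lemma continuous_logStarOmega (hF : IsLagrangianMCF S T F)
    (hgraph : ∀ t ∈ timeInterval T, IsGraphical S (F t)) (ht : t₀ ∈ timeInterval T) :
    Continuous fun x => logStarOmega S F t₀ x := by
  have h := (contMDiffOn_logStarOmega hF hgraph).continuousOn
  exact h.comp_continuous (f := fun x : L => (t₀, x)) (by fun_prop) fun x => ⟨ht, mem_univ x⟩

/-- The Laplacian of `log(*Ω)` in flat coordinates. -/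
lemma laplacian_logStarOmega (hF : IsLagrangianMCF S T F)
    (hgraph : ∀ t ∈ timeInterval T, IsGraphical S (F t)) (hmod : FlatModel S φ B J N)
    (hU : IsFlowNhd T F N t₀ x₀ I U) {e : Fin n → E n} (he : LinearIndependent ℝ e)
    (h1 : (Matrix.gram ℝ fun i => fderiv ℝ (rep φ (F t₀) x₀) (chartAt (E n) x₀ x₀) (e i)) = 1)
    {v : E n → ℝ} (hv : v = fun y => logRatio (I ×ˢ U) (flowRep φ F x₀)
      (fun i => spaceDir (e i)) B (t₀, y)) :
    ContDiffAt ℝ ∞ v (chartAt (E n) x₀ x₀) ∧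
    (v =ᶠ[𝓝 (chartAt (E n) x₀ x₀)]
      fun y => logStarOmega S F t₀ ((chartAt (E n) x₀).symm y)) ∧
    laplacian (inducedMetric S (F t₀)) (logStarOmega S F t₀) x₀ =
      ∑ p, fderiv ℝ (fun y => fderiv ℝ v y) (chartAt (E n) x₀ x₀) (e p) (e p) -
      ∑ q, inner ℝ (fderiv ℝ (rep φ (F t₀) x₀) (chartAt (E n) x₀ x₀) (e q))
        (∑ p, fderiv ℝ (fun y => fderiv ℝ (rep φ (F t₀) x₀) y) (chartAt (E n) x₀ x₀) (e p) (e p)) *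
        fderiv ℝ v (chartAt (E n) x₀ x₀) (e q) := by
  have hopen := hU.isSpaceTime.isOpen_space.mem_nhds hU.mem_space
  have hzx : (chartAt (E n) x₀).symm (chartAt (E n) x₀ x₀) = x₀ :=
    (chartAt (E n) x₀).left_inv (mem_chart_source _ x₀)
  have hmem := hmod.subset (hU.maps _ hU.mem_time _ hU.mem_space)
  rw [hzx] at hmem
  have hvs : ContDiffAt ℝ ∞ v (chartAt (E n) x₀ x₀) := by
    rw [hv]
    exact (IsSpaceTime.contDiffOn_slice
      (IsFlowNhd.graphFlow hF hgraph hmod hU he).contDiffOn_logRatio hU.mem_time).contDiffAt hopen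
  have heq : v =ᶠ[𝓝 (chartAt (E n) x₀ x₀)]
      fun y => logStarOmega S F t₀ ((chartAt (E n) x₀).symm y) := by
    filter_upwards [hopen] with y hy
    rw [hv]
    exact (IsFlowNhd.logStarOmega_eq hF hgraph hmod hU he hU.mem_time hy).1.symm
  exact ⟨hvs, heq, laplacian_eq_frame hmod.flat
    (hF.contMDiff_slice (hU.subset_time hU.mem_time)) hmem he h1 heq hvs⟩

/-- The evolution equation of `log(*Ω)`. -/
lemma heat_logStarOmega (hF : IsLagrangianMCF S T F)
    (hgraph : ∀ t ∈ timeInterval T, IsGraphical S (F t)) (ht : t₀ ∈ timeInterval T)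
    {e : Fin n → E n}
    {a : Fin n → TangentSpace 𝓘(ℝ, E (2 * n)) (F t₀ x₀)} {lam : Fin n → ℝ}
    (ha : IsAdaptedFrame S (F t₀) x₀ e a lam) :
    heat S T F (logStarOmega S F) t₀ x₀ =
        (∑ i, (1 + lam i ^ 2) * secondFund S (F t₀) x₀ (e i) (e i) (e i) ^ 2) +
        (∑ i, ∑ j ∈ Finset.univ.filter (fun j => i ≠ j),
          (3 + lam i ^ 2 + 2 * lam i * lam j) *
            secondFund S (F t₀) x₀ (e i) (e i) (e j) ^ 2) +
        ∑ i, ∑ j ∈ Finset.Ioi i, ∑ k ∈ Finset.Ioi j,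
          (6 + 2 * lam i * lam j + 2 * lam j * lam k + 2 * lam k * lam i) *
            secondFund S (F t₀) x₀ (e i) (e j) (e k) ^ 2 := by
  set φ := S.flatChartAt (F t₀ x₀) with hφdef
  obtain ⟨hφ, hmem⟩ : IsFlatChart S.g φ ∧ F t₀ x₀ ∈ φ.source := (S.flat (F t₀ x₀)).choose_spec
  obtain ⟨B, J, N, hN, hmod⟩ := exists_flatModel hφ hmem
  obtain ⟨I, U, hU⟩ := exists_isFlowNhd hF hmod.isOpen ht hN
  have hli := ha.linearIndependent hmod hN
  have hzx : (chartAt (E n) x₀).symm (chartAt (E n) x₀ x₀) = x₀ :=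
    (chartAt (E n) x₀).left_inv (mem_chart_source _ x₀)
  have hBJ := hmod.isLagrangianSplitting hN
  have hf := ha.isModelFrame hmod hN
  have hz : ((t₀, chartAt (E n) x₀ x₀) : ℝ × E n) ∈ I ×ˢ U := ⟨hU.mem_time, hU.mem_space⟩
  have hG := IsFlowNhd.graphFlow hF hgraph hmod hU hli
  have e1 : ∀ i, dirDeriv (I ×ˢ U) (spaceDir (e i)) (flowRep φ F x₀) (t₀, chartAt (E n) x₀ x₀) =
      tangentMap φ (F t₀) x₀ (e i) := fun i => by
    rw [IsFlowNhd.dirDeriv_space hF hmod hU hU.mem_time hU.mem_space]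
    exact fderiv_rep_self hφ (hF.contMDiff_slice ht) x₀ hmem (e i)
  have hA : GraphFlow.AdaptedAt (I ×ˢ U) (flowRep φ F x₀) (fun i => spaceDir (e i)) B J lam
      (t₀, chartAt (E n) x₀ x₀) := by
    refine ⟨?_, fun k => ?_, fun k => ?_, fun w => ?_⟩
    · simp only [e1]; exact hf.gram_frame hBJ
    · unfold GraphFlow.projDual; simp only [e1]; exact hf.dualFrame_proj hBJ k
    · simp only [e1]; exact hf.proj_J_frame hBJ k
    · simp only [e1]; exact hf.expand hBJ (by simp) w
  have hev := hG.evolution hz hA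
  obtain ⟨-, -, hlap⟩ := laplacian_logStarOmega hF hgraph hmod hU hli
    (ha.gram_fderiv_rep hF ht hmod hN) rfl
  have hΦ := hG.contDiffOn_logRatio
  have htime : derivWithin (fun s => logStarOmega S F s x₀) (timeInterval T) t₀ =
      dirDeriv (I ×ˢ U) timeDir (logRatio (I ×ˢ U) (flowRep φ F x₀) (fun i => spaceDir (e i)) B)
        (t₀, chartAt (E n) x₀ x₀) := by
    rw [← IsSpaceTime.derivWithin_slice hΦ (hU.mem_nhds_time _ hU.mem_time)
      (uniqueDiffOn_timeInterval t₀ ht) hU.mem_time hU.mem_space]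
    have heq : ∀ s ∈ I, logStarOmega S F s x₀ =
        logRatio (I ×ˢ U) (flowRep φ F x₀) (fun i => spaceDir (e i)) B (s, chartAt (E n) x₀ x₀) := by
      intro s hs
      have := (IsFlowNhd.logStarOmega_eq hF hgraph hmod hU hli hs hU.mem_space).1
      rwa [hzx] at this
    refine Filter.EventuallyEq.derivWithin_eq ?_ (heq _ hU.mem_time)
    filter_upwards [hU.mem_nhds_time _ hU.mem_time] with s hs using heq s hs
  have hst := hU.isSpaceTime
  have hh : ∀ i j k, inner ℝ (dirDeriv (I ×ˢ U) (spaceDir (e i))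
      (dirDeriv (I ×ˢ U) (spaceDir (e j)) (flowRep φ F x₀)) (t₀, chartAt (E n) x₀ x₀))
        (J (dirDeriv (I ×ˢ U) (spaceDir (e k)) (flowRep φ F x₀) (t₀, chartAt (E n) x₀ x₀))) =
      secondFund S (F t₀) x₀ (e i) (e j) (e k) := by
    intro i j k
    rw [IsFlowNhd.dirDeriv_space_space hF hmod hU hU.mem_time hU.mem_space, e1]
    unfold secondFund
    rw [← hφdef, hmod.map_J _ hN]
    rfl
  have hreg := sum_secondFund_regroup lam
    (fun i j k => secondFund S (F t₀) x₀ (e i) (e j) (e k))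
    (fun i j k => by simp only [← hh]; rw [hG.hess_comm hz])
    (fun i j k => by simp only [← hh]; exact hG.secondFund_symm hz i j k)
  beta_reduce at hreg
  rw [← hreg]
  simp only [hh] at hev
  rw [← hev]
  unfold heat
  rw [htime, hlap]
  congr 1
  simp only [hst.fderiv_slice hΦ hU.mem_time hU.mem_space,
    hst.fderiv_fderiv_slice hΦ hU.mem_time hU.mem_space,
    IsFlowNhd.dirDeriv_space hF hmod hU hU.mem_time hU.mem_space,
    IsFlowNhd.dirDeriv_space_space hF hmod hU hU.mem_time hU.mem_space]

/-- The Laplacian is nonnegative at a spatial minimum. -/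
lemma laplacian_nonneg_of_isMin (hF : IsLagrangianMCF S T F)
    (hgraph : ∀ t ∈ timeInterval T, IsGraphical S (F t)) (ht : t₀ ∈ timeInterval T)
    (hmin : ∀ x, logStarOmega S F t₀ x₀ ≤ logStarOmega S F t₀ x) :
    0 ≤ laplacian (inducedMetric S (F t₀)) (logStarOmega S F t₀) x₀ := by
  obtain ⟨φ, hφ, hmem⟩ := S.flat (F t₀ x₀)
  obtain ⟨B, J, N, hN, hmod⟩ := exists_flatModel hφ hmem
  obtain ⟨I, U, hU⟩ := exists_isFlowNhd hF hmod.isOpen ht hN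
  obtain ⟨e, a, lam, ha⟩ := exists_adaptedFrame hF hgraph ht x₀
  change Fin n → E n at e
  obtain ⟨v, hv⟩ : ∃ v : E n → ℝ, v = fun y => logRatio (I ×ˢ U) (flowRep φ F x₀)
      (fun i => spaceDir (e i)) B (t₀, y) := ⟨_, rfl⟩
  obtain ⟨hvs, heq, hlap⟩ := laplacian_logStarOmega hF hgraph hmod hU
    (ha.linearIndependent hmod hN) (ha.gram_fderiv_rep hF ht hmod hN) hv
  have hzx : (chartAt (E n) x₀).symm (chartAt (E n) x₀ x₀) = x₀ :=
    (chartAt (E n) x₀).left_inv (mem_chart_source _ x₀)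
  have hvmin : IsLocalMin v (chartAt (E n) x₀ x₀) := by
    filter_upwards [heq] with y hy
    have h0 : v (chartAt (E n) x₀ x₀) = logStarOmega S F t₀ x₀ := by
      have h1 := heq.self_of_nhds
      beta_reduce at h1
      rw [h1, hzx]
    rw [hy, h0]
    exact hmin _
  rw [hlap, hvmin.fderiv_eq_zero]
  simp only [zero_apply, mul_zero, Finset.sum_const_zero, sub_zero]
  exact Finset.sum_nonneg fun p _ => fderiv_fderiv_nonneg_of_isLocalMin hvs hvmin _

lemma heat_nonneg_of_isTwoConvex (hF : IsLagrangianMCF S T F)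
    (hgraph : ∀ t ∈ timeInterval T, IsGraphical S (F t)) (ht : t₀ ∈ timeInterval T)
    (h2 : IsTwoConvex S (F t₀)) (x₀ : L) : 0 ≤ heat S T F (logStarOmega S F) t₀ x₀ := by
  obtain ⟨e, a, lam, ha⟩ := exists_adaptedFrame hF hgraph ht x₀
  have h := fun i j hij => (h2 x₀ e a lam ha i j hij).2
  rw [heat_logStarOmega hF hgraph ht ha]
  refine add_nonneg (add_nonneg ?_ ?_) ?_
  · exact Finset.sum_nonneg fun i _ => by positivity
  · refine Finset.sum_nonneg fun i _ => Finset.sum_nonneg fun j hj => ?_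
    have := h i j (Finset.mem_filter.1 hj).2
    exact mul_nonneg (by nlinarith [sq_nonneg (lam i)]) (sq_nonneg _)
  · refine Finset.sum_nonneg fun i _ => Finset.sum_nonneg fun j hj =>
      Finset.sum_nonneg fun k hk => ?_
    have hij := Finset.mem_Ioi.1 hj
    have hjk := Finset.mem_Ioi.1 hk
    have h1 := h i j hij.ne
    have h2 := h j k hjk.ne
    have h3 := h k i (hij.trans hjk).ne'
    exact mul_nonneg (by linarith) (sq_nonneg _)

/-- The parabolic minimum principle: a lower bound of `log(*Ω)` at one time persists. -/
lemma exists_logStarOmega_le [CompactSpace L] (hF : IsLagrangianMCF S T F)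
    (hgraph : ∀ t ∈ timeInterval T, IsGraphical S (F t))
    (hheat : ∀ t ∈ timeInterval T, ∀ x, 0 ≤ heat S T F (logStarOmega S F) t x)
    {t₁ t₂ : ℝ} (h1 : t₁ ∈ timeInterval T) (h2 : t₂ ∈ timeInterval T) (h12 : t₁ ≤ t₂)
    {m : ℝ} (hm : ∀ x, m ≤ logStarOmega S F t₁ x) (x : L) : m ≤ logStarOmega S F t₂ x := by
  have hsub : Icc t₁ t₂ ⊆ timeInterval T := ordConnected_timeInterval.out h1 h2
  have hsm := contMDiffOn_logStarOmega hF hgraph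
  -- the perturbation by `ε (t - t₁)` makes the inequality for the time derivative strict
  have key : ∀ ε > 0, m ≤ logStarOmega S F t₂ x + ε * (t₂ - t₁) := by
    intro ε hε
    have hcont : ContinuousOn (fun z : ℝ × L => logStarOmega S F z.1 z.2 + ε * (z.1 - t₁))
        (Icc t₁ t₂ ×ˢ univ) :=
      (hsm.continuousOn.mono (prod_mono hsub subset_rfl)).add
        (continuousOn_const.mul (continuousOn_fst.sub continuousOn_const))
    obtain ⟨⟨t, x₁⟩, ⟨ht, -⟩, hmin⟩ := (isCompact_Icc.prod isCompact_univ).exists_isMinOn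
      ⟨(t₁, x), ⟨left_mem_Icc.2 h12, mem_univ _⟩⟩ hcont
    have hmin' : ∀ s ∈ Icc t₁ t₂, ∀ x', logStarOmega S F t x₁ + ε * (t - t₁) ≤
        logStarOmega S F s x' + ε * (s - t₁) := 
      fun s hs x' => isMinOn_iff.1 hmin (s, x') ⟨hs, mem_univ x'⟩
    change t ∈ Icc t₁ t₂ at ht
    rcases eq_or_lt_of_le ht.1 with heq | hlt
    · have h3 := hmin' t₂ (right_mem_Icc.2 h12) x
      rw [← heq, sub_self, mul_zero, add_zero] at h3
      exact (hm x₁).trans h3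
    · exfalso
      have htT := hsub ht
      have hlap := laplacian_nonneg_of_isMin hF hgraph htT (x₀ := x₁)
        (fun x' => by linarith [hmin' t ht x'])
      have hh := hheat t htT x₁
      unfold heat at hh
      have hdiff : DifferentiableWithinAt ℝ (fun s => logStarOmega S F s x₁) (timeInterval T) t := by
        have hc : ContMDiffOn 𝓘(ℝ, ℝ) (𝓘(ℝ, ℝ).prod 𝓘(ℝ, E n)) ∞ (fun s : ℝ => (s, x₁))
            (timeInterval T) := contMDiffOn_id.prodMk contMDiffOn_const
        exact ((hsm.comp hc fun s hs => ⟨hs, mem_univ _⟩).contDiffOn t htT).differentiableWithinAt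
          (by simp)
      set d := derivWithin (fun s => logStarOmega S F s x₁) (timeInterval T) t with hd
      have hder : HasDerivWithinAt (fun s => logStarOmega S F s x₁ + ε * (s - t₁)) (d + ε)
          (Icc t₁ t₂) t := by
        have h3 : HasDerivWithinAt (fun s => ε * (s - t₁)) ε (Icc t₁ t₂) t := by
          simpa using ((hasDerivWithinAt_id t (Icc t₁ t₂)).sub_const t₁).const_mul ε
        exact (hdiff.hasDerivWithinAt.mono hsub).add h3
      have hloc : IsLocalMinOn (fun s => logStarOmega S F s x₁ + ε * (s - t₁)) (Icc t₁ t₂) t := by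
        filter_upwards [self_mem_nhdsWithin] with s hs using hmin' s hs x₁
      have hcone : t₁ - t ∈ posTangentConeAt (Icc t₁ t₂) t :=
        sub_mem_posTangentConeAt_of_segment_subset
          ((convex_Icc t₁ t₂).segment_subset ht (left_mem_Icc.2 h12))
      have h4 := hloc.hasFDerivWithinAt_nonneg hder.hasFDerivWithinAt hcone
      -- pairing with the direction `t₁ - t < 0` shows that `d + ε ≤ 0`
      simp at h4
      nlinarith
  refine le_of_forall_pos_le_add fun δ hδ => ?_
  have h5 : 0 < t₂ - t₁ + 1 := by linarith
  refine (key (δ / (t₂ - t₁ + 1)) (div_pos hδ h5)).trans ?_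
  gcongr
  rw [div_mul_eq_mul_div, div_le_iff₀ h5]
  nlinarith

/-- A lower bound for `log(*Ω)` bounds the angles. -/
lemma IsAdaptedFrame.abs_le_of_le_logStarOmega (hF : IsLagrangianMCF S T F)
    (hgraph : ∀ t ∈ timeInterval T, IsGraphical S (F t)) (ht : t₀ ∈ timeInterval T)
    {e : Fin n → TangentSpace 𝓘(ℝ, E n) x₀}
    {a : Fin n → TangentSpace 𝓘(ℝ, E (2 * n)) (F t₀ x₀)} {lam : Fin n → ℝ}
    (ha : IsAdaptedFrame S (F t₀) x₀ e a lam) {m : ℝ} (hm : m ≤ logStarOmega S F t₀ x₀)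
    (i : Fin n) : |lam i| ≤ Real.exp (-m) := by
  obtain ⟨φ, hφ, hmem⟩ := S.flat (F t₀ x₀)
  obtain ⟨B, J, N, hN, hmod⟩ := exists_flatModel hφ hmem
  have h1 := ha.starOmega_le hmod hN i
  have h2 := (Real.le_log_iff_exp_le (starOmega_pos hF hgraph ht x₀)).1 hm
  have h3 : √(1 + lam i ^ 2) ≤ Real.exp (-m) := by
    rw [Real.exp_neg]
    exact (le_inv_comm₀ (Real.exp_pos _) (Real.sqrt_pos.2 (one_add_sq_pos _))).1 (h2.trans h1)
  refine le_trans ?_ h3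
  exact Real.abs_le_sqrt (by linarith)

end Evolution

end LagMCF

end

theorem proposition2p2 {n : ℕ}
    {M : Type*} [TopologicalSpace M] [T2Space M] [ChartedSpace (LagMCF.E (2 * n)) M]
    [IsManifold 𝓘(ℝ, LagMCF.E (2 * n)) ∞ M]
    {L : Type*} [TopologicalSpace L] [T2Space L] [ChartedSpace (LagMCF.E n) L]
    [IsManifold 𝓘(ℝ, LagMCF.E n) ∞ L]
    (S : LagMCF.FlatKahlerSplitting n M) (T : EReal) (hT : 0 < T) (F : ℝ → L → M)
    (hF : LagMCF.IsLagrangianMCF S T F)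
    (hgraph : ∀ t ∈ LagMCF.timeInterval T, LagMCF.IsGraphical S (F t)) :
    -- `log(*Ω)` is the logarithm of a positive function and is smooth up to the initial time
    (∀ t ∈ LagMCF.timeInterval T, ∀ x, 0 < LagMCF.starOmega S (F t) x) ∧
    ContMDiffOn (𝓘(ℝ, ℝ).prod 𝓘(ℝ, LagMCF.E n)) 𝓘(ℝ, ℝ) ∞
      (fun z : ℝ × L => LagMCF.logStarOmega S F z.1 z.2) (LagMCF.timeInterval T ×ˢ univ) ∧
    -- frames as in the definition of the `λᵢ` exist at every point
    (∀ t ∈ LagMCF.timeInterval T, ∀ x, ∃ e a lam, LagMCF.IsAdaptedFrame S (F t) x e a lam) ∧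
    -- the evolution equation
    (∀ t ∈ LagMCF.timeInterval T, ∀ x e a lam, LagMCF.IsAdaptedFrame S (F t) x e a lam →
      LagMCF.heat S T F (LagMCF.logStarOmega S F) t x =
        (∑ i, (1 + lam i ^ 2) * LagMCF.secondFund S (F t) x (e i) (e i) (e i) ^ 2) +
        (∑ i, ∑ j ∈ Finset.univ.filter (fun j => i ≠ j),
          (3 + lam i ^ 2 + 2 * lam i * lam j) *
            LagMCF.secondFund S (F t) x (e i) (e i) (e j) ^ 2) +
        ∑ i, ∑ j ∈ Finset.Ioi i, ∑ k ∈ Finset.Ioi j,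
          (6 + 2 * lam i * lam j + 2 * lam j * lam k + 2 * lam k * lam i) *
            LagMCF.secondFund S (F t) x (e i) (e j) (e k) ^ 2) ∧
    -- the two-convex case
    ((∀ t ∈ LagMCF.timeInterval T, LagMCF.IsTwoConvex S (F t)) →
      (∀ t ∈ LagMCF.timeInterval T, ∀ x,
        0 ≤ LagMCF.heat S T F (LagMCF.logStarOmega S F) t x) ∧
      (CompactSpace L → Nonempty L →
        (∃ m : ℝ → ℝ,
          (∀ t ∈ LagMCF.timeInterval T,
            IsLeast (range fun x => LagMCF.logStarOmega S F t x) (m t)) ∧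
          MonotoneOn m (LagMCF.timeInterval T)) ∧
        ∃ C : ℝ, ∀ t ∈ LagMCF.timeInterval T, ∀ x e a lam,
          LagMCF.IsAdaptedFrame S (F t) x e a lam → ∀ i, |lam i| ≤ C)) := by

  have hframe := fun t (ht : t ∈ LagMCF.timeInterval T) (x : L) =>
    LagMCF.exists_adaptedFrame hF hgraph ht x
  refine ⟨fun t ht x => LagMCF.starOmega_pos hF hgraph ht x,
    LagMCF.contMDiffOn_logStarOmega hF hgraph, hframe,
    fun t ht x e a lam ha => LagMCF.heat_logStarOmega hF hgraph ht ha, fun h2 => ?_⟩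
  have hheat := fun t (ht : t ∈ LagMCF.timeInterval T) (x : L) =>
    LagMCF.heat_nonneg_of_isTwoConvex hF hgraph ht (h2 t ht) x
  refine ⟨hheat, fun hcompact hne => ?_⟩
  have hmin : ∀ t ∈ LagMCF.timeInterval T, ∃ x₀, ∀ x,
      LagMCF.logStarOmega S F t x₀ ≤ LagMCF.logStarOmega S F t x := by
    intro t ht
    have hslice := LagMCF.continuous_logStarOmega hF hgraph ht
    obtain ⟨x₀, -, hx₀⟩ := isCompact_univ.exists_isMinOn univ_nonempty hslice.continuousOn
    exact ⟨x₀, fun x => isMinOn_iff.1 hx₀ x (mem_univ x)⟩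
  choose! p hp using hmin
  have hmono : ∀ s ∈ LagMCF.timeInterval T, ∀ t ∈ LagMCF.timeInterval T, s ≤ t → ∀ x,
      LagMCF.logStarOmega S F s (p s) ≤ LagMCF.logStarOmega S F t x := fun s hs t ht hst x =>
    LagMCF.exists_logStarOmega_le hF hgraph hheat hs ht hst (hp s hs) x
  refine ⟨⟨fun t => LagMCF.logStarOmega S F t (p t), fun t ht => ⟨mem_range_self _, ?_⟩,
    fun s hs t ht hst => hmono s hs t ht hst _⟩, ?_⟩
  · rintro _ ⟨x, rfl⟩
    exact hp t ht x
  · have h0 : (0 : ℝ) ∈ LagMCF.timeInterval T := ⟨le_rfl, by exact_mod_cast hT⟩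
    exact ⟨_, fun t ht x e a lam ha i => ha.abs_le_of_le_logStarOmega hF hgraph ht
      (hmono 0 h0 t ht ht.1 x) i⟩
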